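/- There exist a universal constant $C>0$ and a function $\varepsilon_0:\mathbb R\to(0,\infty)$ such that the following holds. Let $(\Sigma,g)$ be a compact smooth Riemannian surface without boundary, with Laplace–Beltrami operator $\Delta=\Delta_g$ and volume measure $dV=dV_g$, and let $B\in\mathbb R$. Write $B_r(p)$ for the open geodesic ball of radius $r$ about $p$, and $U^R_{R/2}(p)=B_R(p)\setminus \overline{B}_{R/2}(p)$. There exists $R_0>0$, depending only on $(\Sigma,g)$ and $B$, such that for all $A\in\mathbb R$, $p\in\Sigma$, $T\in(0,\infty]$, $0<R\le\min\left[R_0,\sqrt T\right]$ and $0\le\varepsilon<\varepsilon_0(A)$: Let $v\ge 0$ be a continuous weak solution of $$\left(\frac{\partial}{\partial t}-\Delta\right)v\le Av^3+Bv\quad\text{on } B_R(p)\times[0,T),$$ i.e. $v$ is continuous and nonnegative on $B_R(p)\times[0,T)$, and $$\int\!\!\int v\left(-\partial_t\varphi-\Delta\varphi\right)dV\,dt\le\int\!\!\int\left(Av^3+Bv\right)\varphi\,dV\,dt$$ for every smooth $\varphi\ge0$ with compact support in $B_R(p)\times(0,T)$. If $$\int_{B_R(p)}v(0)^2\,dV+\sup_{0\le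 t<T}\int_{U^R_{R/2}(p)}v(t)^2\,dV\le\varepsilon,$$ then $$\sup_{B_{R/2}(p)\times[R^2/2,\,T)}v(x,t)\le\frac{C\sqrt\varepsilon}{R}.$$ -/

import Mathlib

open Set MeasureTheory Bundle
open scoped Manifold ContDiff ENNReal

noncomputable section

namespace Surface

/-- The model space of a surface without boundary. -/
abbrev Plane : Type := EuclideanSpace ℝ (Fin 2)

/-- The coordinate vector `e i` of the plane. -/
def e (i : Fin 2) : Plane := EuclideanSpace.single i 1

section Metric

variable {M : Type*} [TopologicalSpace M] [ChartedSpace Plane M]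
  [RiemannianBundle (fun x : M => TangentSpace 𝓘(ℝ, Plane) x)]

/-- The coordinate vector field `∂ᵢ` of the chart `chartAt Plane c`, at the point with
coordinates `y`. -/
def coordVec (c : M) (i : Fin 2) (y : Plane) :
    TangentSpace 𝓘(ℝ, Plane) ((chartAt Plane c).symm y) :=
  mfderiv 𝓘(ℝ, Plane) 𝓘(ℝ, Plane) (chartAt Plane c).symm y (e i)

/-- The matrix `gᵢⱼ = ⟨∂ᵢ, ∂ⱼ⟩` of the Riemannian metric in the chart `chartAt Plane c`, at the
point with coordinates `y`. -/
def gram (c : M) (y : Plane) : Matrix (Fin 2) (Fin 2) ℝ :=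
  Matrix.of fun i j => inner ℝ (coordVec c i y) (coordVec c j y)

/-- The density `√(det g)` of the Riemannian volume in the chart `chartAt Plane c`. -/
def volDensity (c : M) (y : Plane) : ℝ := √(gram c y).det

/-- The Riemannian volume of the domain of the chart `chartAt Plane c`, as a measure on the whole
surface: the image under the inverse chart of `√(det g) dy`. -/
def chartVolume [MeasurableSpace M] (c : M) : Measure M :=
  ((volume.restrict (chartAt Plane c).target).withDensity
    fun y => ENNReal.ofReal (volDensity c y)).map (chartAt Plane c).symm

variable (M) in
/-- The Riemannian volume measure `dV_g`. The measures `chartVolume c` agree on the overlaps of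
chart domains, and their supremum is the measure which on the domain of each chart is given by
`√(det g) dy`. -/
def riemannianVolume [MeasurableSpace M] : Measure M := ⨆ c : M, chartVolume c

/-- The Laplace-Beltrami operator
`Δ f = (det g)^(-1/2) ∑ᵢ ∂ᵢ (√(det g) ∑ⱼ gⁱʲ ∂ⱼ f)`, computed at `x` in the chart at `x`. -/
def laplaceBeltrami (f : M → ℝ) (x : M) : ℝ :=
  (volDensity x (chartAt Plane x x))⁻¹ *
    ∑ i, fderiv ℝ
      (fun y => volDensity x y *
        ∑ j, (gram x y)⁻¹ i j * fderiv ℝ (f ∘ (chartAt Plane x).symm) y (e j))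
      (chartAt Plane x x) (e i)

/-- `φ` is a nonnegative smooth function on `M × ℝ` (space times time) with compact support
contained in `Ω × (0, T)`. -/
structure IsTestFunction (Ω : Set M) (T : EReal) (φ : M → ℝ → ℝ) : Prop where
  smooth : ContMDiff (𝓘(ℝ, Plane).prod 𝓘(ℝ, ℝ)) 𝓘(ℝ, ℝ) ∞ (fun z : M × ℝ => φ z.1 z.2)
  hasCompactSupport : HasCompactSupport (fun z : M × ℝ => φ z.1 z.2)
  tsupport_subset :
    tsupport (fun z : M × ℝ => φ z.1 z.2) ⊆ Ω ×ˢ {t : ℝ | 0 < t ∧ (t : EReal) < T}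
  nonneg : ∀ x t, 0 ≤ φ x t

/-- `v` is a nonnegative continuous weak solution on `Ω × [0, T)` of the differential inequality
`(∂ₜ - Δ) v ≤ A v³ + B v`: the inequality holds after multiplication with any nonnegative test
function `φ` and integration over space and time, all derivatives being moved to `φ`. -/
structure IsWeakSolution [MeasurableSpace M] (A B : ℝ) (Ω : Set M) (T : EReal)
    (v : M → ℝ → ℝ) : Prop where
  continuousOn :
    ContinuousOn (fun z : M × ℝ => v z.1 z.2) (Ω ×ˢ {t : ℝ | 0 ≤ t ∧ (t : EReal) < T})
  nonneg : ∀ x ∈ Ω, ∀ t : ℝ, 0 ≤ t → (t : EReal) < T → 0 ≤ v x t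
  weak : ∀ φ : M → ℝ → ℝ, IsTestFunction Ω T φ →
    ∫ t : ℝ, ∫ x, v x t * (-deriv (φ x) t - laplaceBeltrami (fun z => φ z t) x)
        ∂(riemannianVolume M)
      ≤ ∫ t : ℝ, ∫ x, (A * v x t ^ 3 + B * v x t) * φ x t ∂(riemannianVolume M)

/-- The energy `∫_S w² dV_g`, with values in `[0, ∞]`. -/
def energy [MeasurableSpace M] (w : M → ℝ) (S : Set M) : ℝ≥0∞ :=
  ∫⁻ x in S, ENNReal.ofReal (w x ^ 2) ∂(riemannianVolume M)

end Metric

/-- The open geodesic ball `B_r(p)`. -/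
def ball {M : Type*} [EMetricSpace M] (p : M) (r : ℝ) : Set M :=
  Metric.eball p (ENNReal.ofReal r)

/-- The annulus: the open ball `B_R(p)` minus the closed ball of radius `r` about `p`. -/
def annulus {M : Type*} [EMetricSpace M] (p : M) (r R : ℝ) : Set M :=
  ball p R \ Metric.closedEBall p (ENNReal.ofReal r)

end Surface

end

noncomputable section

namespace Surface

/-! ### The Gaussian kernel of the plane -/

/-! In dimension two the rescaling `ρ v(ρ y, ρ² s)` preserves both the cubic inequality and the
energy `∫ v²`, while `B` and the deviation of the metric from a constant one are multiplied by
positive powers of `ρ`. In coordinates in which the metric is Euclidean at the centre, the statement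
is therefore reduced to `exists_disc_bound`, a statement on the unit disc for operators whose
coefficients are close to those of the flat Laplacian. Compactness of the surface makes the
admissible scales uniform.

On the disc no energy bound is given in the interior at positive times. The proof is a pointwise
comparison `v ≤ κ M` with `M = √g + √ε / (1 - |x|²)`, where `g` is the Gaussian evolution of `v(0)²`
(`majorant`). The first term is what Jensen's inequality gives for the evolution of `v(0)`; the
second has the size, dictated by scaling, of the influence of an annulus of energy `ε`.

The comparison rests on a Duhamel inequality, `exists_representation`: the inequality is tested with
the Gaussian whose coefficients are frozen at `x₀`, times a cutoff adapted to `d = 1 - |x₀|²`. The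
variable coefficients cost `K s^(-1/2)`, and the cutoff costs `d⁻²` but sees only points of the
outer annulus. All errors are dominated by a slightly wider Gaussian. By its semigroup property and
Jensen's inequality, averaging `√g(t)` over the remaining time gives at most a multiple of `√g(t₀)`.
Since `g(t) ≤ ε / t`, the average of `g(t)^(3/2)` is at most a multiple of `ε t^(-1/2) t₀^(-1/2)
√g(t₀)`, and its time integral is a small multiple of `√g(t₀)`. Here the criticality of the cubic
term is met by the smallness of `ε`.

The core is `exists_linear_step`: `v ≤ N M` improves to `v ≤ (C₁ + N/2) M` once the parameters are
small. Duhamel's inequality is used on a window of length at most `τ d²`. If the window reaches time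
`0`, the initial data enter. Otherwise the energy at its beginning enters, which is bounded by `ε`
on the annulus and through `N M` inside; taking `τ` large makes the coefficient of `N` small. Then
`K`, `B` and `ε` are taken small depending on `τ`. Iteration yields `v ≤ 2 C₁ M`
(`le_majorant_of_step`).

For the cubic term to be linear in `N`, two of its factors are estimated independently of `N`: by `κ
M` on times already treated, and by a crude supremum `V` on a last interval of length `h`. Time thus
advances in steps of length `h`; this length depends on `v`, but the constant `κ = 2 C₁` does not.
At interior points and times at least `1/2`, `M ≤ 4 √ε`, which is the claim. -/

/-- The open unit disc. -/
abbrev disc : Set Plane := Metric.ball 0 1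

/-- The Gaussian kernel `s⁻¹ exp (-|y|² / (8 s))`, of total mass `8 π`. -/
def gaussKernel (s : ℝ) (y : Plane) : ℝ := s⁻¹ * Real.exp (-(‖y‖ ^ 2 / (8 * s)))

lemma gaussKernel_nonneg {s : ℝ} (hs : 0 ≤ s) (y : Plane) : 0 ≤ gaussKernel s y := by
  unfold gaussKernel; positivity

lemma gaussKernel_le {s : ℝ} (hs : 0 < s) (y : Plane) : gaussKernel s y ≤ s⁻¹ := by
  unfold gaussKernel
  refine mul_le_of_le_one_right (by positivity) (Real.exp_le_one_iff.2 ?_)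
  have : 0 ≤ ‖y‖ ^ 2 / (8 * s) := by positivity
  linarith

@[fun_prop]
lemma continuous_gaussKernel (s : ℝ) : Continuous (gaussKernel s) := by
  unfold gaussKernel; fun_prop

lemma gaussKernel_neg (s : ℝ) (y : Plane) : gaussKernel s (-y) = gaussKernel s y := by
  simp [gaussKernel]

lemma integral_gaussKernel {s : ℝ} (hs : 0 < s) : ∫ y, gaussKernel s y = 8 * Real.pi := by
  have h := GaussianFourier.integral_rexp_neg_mul_sq_norm (V := Plane)
    (b := (8 * s)⁻¹) (by positivity)
  unfold gaussKernel
  rw [integral_const_mul]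
  have e1 : ∀ y : Plane, -(‖y‖ ^ 2 / (8 * s)) = -(8 * s)⁻¹ * ‖y‖ ^ 2 := fun y => by
    rw [div_eq_inv_mul]; ring
  simp_rw [e1, h]
  simp
  field_simp

lemma integrable_gaussKernel {s : ℝ} (hs : 0 < s) : Integrable (gaussKernel s) := by
  -- A function that is not integrable has integral `0` by convention, whereas this integral is
  -- `8π`.
  by_contra h
  have := integral_undef h
  rw [integral_gaussKernel hs] at this
  have := Real.pi_pos
  linarith

lemma integrable_gaussKernel_sub {s : ℝ} (hs : 0 < s) (x : Plane) :
    Integrable (fun y => gaussKernel s (x - y)) :=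
  (integrable_gaussKernel hs).comp_sub_left x

lemma integral_gaussKernel_sub {s : ℝ} (hs : 0 < s) (x : Plane) :
    ∫ y, gaussKernel s (x - y) = 8 * Real.pi := by
  rw [integral_sub_left_eq_self (gaussKernel s) volume x, integral_gaussKernel hs]

lemma norm_sq_plane (y : Plane) : ‖y‖ ^ 2 = y 0 ^ 2 + y 1 ^ 2 := by
  simp [EuclideanSpace.norm_sq_eq, Fin.sum_univ_two]

/-- Completing the square in `z`: the product is a Gaussian about the weighted mean of `x` and `y`,
times a factor free of `z`. Integrating over `z` gives the semigroup property. -/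
lemma gaussKernel_mul {a b : ℝ} (ha : 0 < a) (hb : 0 < b) (x y z : Plane) :
    gaussKernel a (x - z) * gaussKernel b (z - y) =
      gaussKernel (a + b) (x - y) *
        gaussKernel (a * b / (a + b)) ((a + b)⁻¹ • (b • x + a • y) - z) := by
  unfold gaussKernel
  rw [mul_mul_mul_comm, ← Real.exp_add, mul_mul_mul_comm (a + b)⁻¹, ← Real.exp_add]
  congr 1
  · field_simp
  · congr 1
    simp only [norm_sq_plane, PiLp.sub_apply, PiLp.smul_apply, PiLp.add_apply, smul_eq_mul]
    field_simp
    ring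

lemma integral_gaussKernel_mul {a b : ℝ} (ha : 0 < a) (hb : 0 < b) (x y : Plane) :
    ∫ z, gaussKernel a (x - z) * gaussKernel b (z - y) =
      8 * Real.pi * gaussKernel (a + b) (x - y) := by
  simp_rw [gaussKernel_mul ha hb]
  rw [integral_const_mul, integral_gaussKernel_sub (by positivity)]
  ring

lemma integrable_gaussKernel_mul {a b : ℝ} (ha : 0 < a) (hb : 0 < b) (x y : Plane) :
    Integrable fun z => gaussKernel a (x - z) * gaussKernel b (z - y) := by
  simp_rw [gaussKernel_mul ha hb]
  exact (integrable_gaussKernel_sub (by positivity) _).const_mul _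

/-! ### Bounded measurable functions on the disc -/

/-- Measurable and bounded on the unit disc. -/
def BoundedOnDisc (u : Plane → ℝ) : Prop :=
  AEStronglyMeasurable u (volume.restrict disc) ∧ ∃ C, ∀ x ∈ disc, |u x| ≤ C

lemma measurableSet_disc : MeasurableSet disc := Metric.isOpen_ball.measurableSet

lemma BoundedOnDisc.integrableOn {u : Plane → ℝ} (h : BoundedOnDisc u) :
    IntegrableOn u disc := by
  obtain ⟨hm, C, hC⟩ := h
  have : IsFiniteMeasure (volume.restrict disc) :=
    ⟨by rw [Measure.restrict_apply_univ]; exact measure_ball_lt_top⟩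
  exact Integrable.of_bound hm C
    ((ae_restrict_mem measurableSet_disc).mono fun x hx => by simpa using hC x hx)

lemma BoundedOnDisc.mul {u v : Plane → ℝ} (hu : BoundedOnDisc u) (hv : BoundedOnDisc v) :
    BoundedOnDisc (fun x => u x * v x) := by
  obtain ⟨hm, C, hC⟩ := hu
  obtain ⟨hm', C', hC'⟩ := hv
  refine ⟨hm.mul hm', C * C', fun x hx => ?_⟩
  rw [abs_mul]
  exact mul_le_mul (hC x hx) (hC' x hx) (abs_nonneg _) ((abs_nonneg _).trans (hC x hx))

lemma BoundedOnDisc.add {u v : Plane → ℝ} (hu : BoundedOnDisc u) (hv : BoundedOnDisc v) :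
    BoundedOnDisc (fun x => u x + v x) := by
  obtain ⟨hm, C, hC⟩ := hu
  obtain ⟨hm', C', hC'⟩ := hv
  exact ⟨hm.add hm', C + C', fun x hx =>
    (abs_add_le _ _).trans (add_le_add (hC x hx) (hC' x hx))⟩

lemma BoundedOnDisc.const (c : ℝ) : BoundedOnDisc (fun _ => c) :=
  ⟨aestronglyMeasurable_const, |c|, fun _ _ => le_rfl⟩

lemma BoundedOnDisc.const_mul {u : Plane → ℝ} (hu : BoundedOnDisc u) (c : ℝ) :
    BoundedOnDisc (fun x => c * u x) := (BoundedOnDisc.const c).mul hu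

lemma BoundedOnDisc.pow {u : Plane → ℝ} (hu : BoundedOnDisc u) (n : ℕ) :
    BoundedOnDisc (fun x => u x ^ n) := by
  induction n with
  | zero => simpa using BoundedOnDisc.const 1
  | succ n ih => simpa [pow_succ] using ih.mul hu

lemma BoundedOnDisc.sqrt {u : Plane → ℝ} (hu : BoundedOnDisc u) :
    BoundedOnDisc (fun x => √(u x)) := by
  obtain ⟨hm, C, hC⟩ := hu
  refine ⟨Real.continuous_sqrt.comp_aestronglyMeasurable hm, √C, fun x hx => ?_⟩
  rw [abs_of_nonneg (Real.sqrt_nonneg _)]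
  exact Real.sqrt_le_sqrt ((le_abs_self _).trans (hC x hx))

lemma BoundedOnDisc.indicator {u : Plane → ℝ} (hu : BoundedOnDisc u) {s : Set Plane}
    (hs : MeasurableSet s) : BoundedOnDisc (s.indicator u) := by
  obtain ⟨hm, C, hC⟩ := hu
  refine ⟨hm.indicator hs, C, fun x hx => ?_⟩
  by_cases h : x ∈ s
  · simpa [h] using hC x hx
  · simpa [h] using (abs_nonneg _).trans (hC x hx)

lemma _root_.ContinuousOn.boundedOnDisc {u : Plane → ℝ}
    (h : ContinuousOn u (Metric.closedBall 0 1)) : BoundedOnDisc u := by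
  refine ⟨(h.mono Metric.ball_subset_closedBall).aestronglyMeasurable measurableSet_disc, ?_⟩
  obtain ⟨C, hC⟩ := (isCompact_closedBall (0 : Plane) 1).exists_bound_of_continuousOn h
  exact ⟨C, fun x hx => hC x (Metric.ball_subset_closedBall hx)⟩

lemma _root_.Continuous.boundedOnDisc {u : Plane → ℝ} (h : Continuous u) : BoundedOnDisc u :=
  h.continuousOn.boundedOnDisc

lemma boundedOnDisc_gaussKernel (s : ℝ) (x : Plane) :
    BoundedOnDisc (fun y => gaussKernel s (x - y)) :=
  Continuous.boundedOnDisc (by fun_prop)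

lemma setIntegral_gaussKernel_le {s : ℝ} (hs : 0 < s) (x : Plane) :
    ∫ y in disc, gaussKernel s (x - y) ≤ 8 * Real.pi := by
  rw [← integral_gaussKernel_sub hs x]
  exact setIntegral_le_integral (integrable_gaussKernel_sub hs x)
    (Filter.Eventually.of_forall fun y => gaussKernel_nonneg hs.le _)

/-- The Gaussian average of a function on the unit disc. -/
def heatAverage (f : Plane → ℝ) (t : ℝ) (x : Plane) : ℝ :=
  ∫ y in disc, gaussKernel t (x - y) * f y

lemma heatAverage_nonneg {f : Plane → ℝ} (hf : ∀ x ∈ disc, 0 ≤ f x) {t : ℝ} (ht : 0 ≤ t)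
    (x : Plane) : 0 ≤ heatAverage f t x :=
  setIntegral_nonneg measurableSet_disc fun y hy =>
    mul_nonneg (gaussKernel_nonneg ht _) (hf y hy)

lemma heatAverage_mono {f f' : Plane → ℝ} (hf : BoundedOnDisc f) (hf' : BoundedOnDisc f')
    (h : ∀ x ∈ disc, f x ≤ f' x) {t : ℝ} (ht : 0 ≤ t) (x : Plane) :
    heatAverage f t x ≤ heatAverage f' t x :=
  setIntegral_mono_on ((boundedOnDisc_gaussKernel t x).mul hf).integrableOn
    ((boundedOnDisc_gaussKernel t x).mul hf').integrableOn measurableSet_disc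
    fun y hy => mul_le_mul_of_nonneg_left (h y hy) (gaussKernel_nonneg ht _)

lemma heatAverage_add {f f' : Plane → ℝ} (hf : BoundedOnDisc f) (hf' : BoundedOnDisc f')
    (t : ℝ) (x : Plane) :
    heatAverage (fun y => f y + f' y) t x = heatAverage f t x + heatAverage f' t x := by
  unfold heatAverage
  rw [← integral_add ((boundedOnDisc_gaussKernel t x).mul hf).integrableOn
    ((boundedOnDisc_gaussKernel t x).mul hf').integrableOn]
  simp_rw [mul_add]

lemma heatAverage_const_mul (f : Plane → ℝ) (c t : ℝ) (x : Plane) :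
    heatAverage (fun y => c * f y) t x = c * heatAverage f t x := by
  unfold heatAverage
  rw [← integral_const_mul]
  congr 1; ext y; ring

lemma heatAverage_const_le {c t : ℝ} (hc : 0 ≤ c) (ht : 0 < t) (x : Plane) :
    heatAverage (fun _ => c) t x ≤ 8 * Real.pi * c := by
  unfold heatAverage
  rw [integral_mul_const]
  exact mul_le_mul_of_nonneg_right (setIntegral_gaussKernel_le ht x) hc

lemma heatAverage_le {f : Plane → ℝ} (hf : BoundedOnDisc f) (h0 : ∀ x ∈ disc, 0 ≤ f x)
    {t : ℝ} (ht : 0 < t) (x : Plane) : heatAverage f t x ≤ t⁻¹ * ∫ y in disc, f y := by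
  unfold heatAverage
  rw [← integral_const_mul]
  exact setIntegral_mono_on ((boundedOnDisc_gaussKernel t x).mul hf).integrableOn
    (hf.const_mul _).integrableOn measurableSet_disc
    fun y hy => mul_le_mul_of_nonneg_right (gaussKernel_le ht _) (h0 y hy)

/-- Jensen's inequality for Gaussian averages. -/
lemma heatAverage_sq_le {u : Plane → ℝ} (hu : BoundedOnDisc u) {t : ℝ} (ht : 0 < t)
    (x : Plane) : heatAverage u t x ^ 2 ≤ 8 * Real.pi * heatAverage (fun y => u y ^ 2) t x := by
  -- The variance about `c` is nonnegative. The kernel has mass at most `8π` on the disc, not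
  -- exactly `8π`, but this only enters in the term `c²`, where an upper bound suffices.
  set c := heatAverage u t x / (8 * Real.pi) with hc
  have hpi := Real.pi_pos
  have h0 : 0 ≤ heatAverage (fun y => (u y - c) ^ 2) t x :=
    heatAverage_nonneg (fun _ _ => sq_nonneg _) ht.le x
  have e1 : (fun y => (u y - c) ^ 2) = fun y => (u y ^ 2 + (-2 * c) * u y) + c ^ 2 := by
    ext y; ring
  rw [e1, heatAverage_add ((hu.pow 2).add (hu.const_mul _)) (BoundedOnDisc.const _),
    heatAverage_add (hu.pow 2) (hu.const_mul _), heatAverage_const_mul] at h0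
  have h1 := heatAverage_const_le (sq_nonneg c) ht x
  have h2 : heatAverage u t x = c * (8 * Real.pi) := by rw [hc]; field_simp
  rw [h2] at h0 ⊢
  nlinarith

lemma heatAverage_le_sqrt {u : Plane → ℝ} (hu : BoundedOnDisc u) {t : ℝ} (ht : 0 < t)
    (x : Plane) : heatAverage u t x ≤ √(8 * Real.pi * heatAverage (fun y => u y ^ 2) t x) :=
  Real.le_sqrt_of_sq_le (heatAverage_sq_le hu ht x)

lemma continuous_heatAverage_uncurry_kernel (t : ℝ) :
    Continuous fun z : Plane × Plane => gaussKernel t (z.1 - z.2) := by fun_prop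

lemma boundedOnDisc_heatAverage {f : Plane → ℝ} (hf : BoundedOnDisc f)
    {t : ℝ} (ht : 0 < t) : BoundedOnDisc (heatAverage f t) := by
  obtain ⟨C, hC⟩ := hf.2
  refine ⟨?_, t⁻¹ * ∫ y in disc, |f y|, fun x _ => ?_⟩
  · have : AEStronglyMeasurable (fun z : Plane × Plane => gaussKernel t (z.1 - z.2) * f z.2)
        ((volume.restrict disc).prod (volume.restrict disc)) :=
      (continuous_heatAverage_uncurry_kernel t).aestronglyMeasurable.mul hf.1.comp_snd
    exact this.integral_prod_right'
  · have hf' : BoundedOnDisc fun y => |f y| :=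
      ⟨hf.1.norm, C, fun y hy => by simpa using hC y hy⟩
    refine le_trans ?_ (heatAverage_le hf' (fun y _ => abs_nonneg (f y)) ht x)
    refine (abs_integral_le_integral_abs).trans (le_of_eq ?_)
    unfold heatAverage
    congr 1; ext y
    rw [abs_mul, abs_of_nonneg (gaussKernel_nonneg ht.le _)]

lemma integrable_mul_heatAverage {f h : Plane → ℝ} (hf : BoundedOnDisc f)
    (hh : BoundedOnDisc h) (t : ℝ) (ht : 0 < t) :
    Integrable (fun z : Plane × Plane => h z.1 * (gaussKernel t (z.1 - z.2) * f z.2))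
      ((volume.restrict disc).prod (volume.restrict disc)) := by
  obtain ⟨hm, C, hC⟩ := hf
  obtain ⟨hm', C', hC'⟩ := hh
  have : IsFiniteMeasure (volume.restrict disc) :=
    ⟨by rw [Measure.restrict_apply_univ]; exact measure_ball_lt_top⟩
  refine Integrable.of_bound (hm'.comp_fst.mul
    ((continuous_heatAverage_uncurry_kernel t).aestronglyMeasurable.mul hm.comp_snd))
    (C' * (t⁻¹ * C)) ?_
  rw [Measure.prod_restrict]
  filter_upwards [ae_restrict_mem (measurableSet_disc.prod measurableSet_disc)] with z hz
  rw [norm_mul, norm_mul, Real.norm_eq_abs, Real.norm_eq_abs, Real.norm_eq_abs,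
    abs_of_nonneg (gaussKernel_nonneg ht.le _)]
  have h1 := hC' z.1 hz.1
  have h2 := hC z.2 hz.2
  have h3 := gaussKernel_le ht (z.1 - z.2)
  exact mul_le_mul h1 (mul_le_mul h3 h2 (abs_nonneg _) (by positivity))
    (mul_nonneg (gaussKernel_nonneg ht.le _) (abs_nonneg _)) ((abs_nonneg _).trans h1)

/-- The semigroup property, as an inequality on the disc. -/
lemma heatAverage_heatAverage_le {f : Plane → ℝ} (hf : BoundedOnDisc f)
    (h0 : ∀ x ∈ disc, 0 ≤ f x) {s t : ℝ} (hs : 0 < s) (ht : 0 < t) (x : Plane) :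
    heatAverage (heatAverage f t) s x ≤ 8 * Real.pi * heatAverage f (s + t) x := by
  unfold heatAverage
  simp_rw [← integral_const_mul]
  rw [integral_integral_swap (integrable_mul_heatAverage hf (boundedOnDisc_gaussKernel s x) t ht)]
  refine setIntegral_mono_on
    (integrable_mul_heatAverage hf (boundedOnDisc_gaussKernel s x) t ht).integral_prod_right
    (((boundedOnDisc_gaussKernel _ x).mul hf).const_mul _).integrableOn measurableSet_disc
    fun y hy => ?_
  simp_rw [← mul_assoc]
  rw [integral_mul_const]
  refine mul_le_mul_of_nonneg_right ?_ (h0 y hy)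
  rw [← integral_gaussKernel_mul hs ht]
  -- The intermediate point ranges over the disc only; by positivity of the kernels it may range
  -- over the whole plane, where the convolution is exact.
  exact setIntegral_le_integral (integrable_gaussKernel_mul hs ht x y)
    (Filter.Eventually.of_forall fun z =>
      mul_nonneg (gaussKernel_nonneg hs.le _) (gaussKernel_nonneg ht.le _))

/-- Fubini and the symmetry of the kernel: each `f y` is weighted by a mass of at most `8π`. -/
lemma setIntegral_heatAverage_le {f : Plane → ℝ} (hf : BoundedOnDisc f)
    (h0 : ∀ x ∈ disc, 0 ≤ f x) {t : ℝ} (ht : 0 < t) :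
    ∫ x in disc, heatAverage f t x ≤ 8 * Real.pi * ∫ y in disc, f y := by
  have hI := integrable_mul_heatAverage hf (BoundedOnDisc.const 1) t ht
  simp only [one_mul] at hI
  unfold heatAverage
  rw [integral_integral_swap hI, ← integral_const_mul]
  refine setIntegral_mono_on hI.integral_prod_right (hf.const_mul _).integrableOn
    measurableSet_disc fun y hy => ?_
  rw [integral_mul_const]
  refine mul_le_mul_of_nonneg_right ?_ (h0 y hy)
  refine le_trans (le_of_eq ?_) (setIntegral_gaussKernel_le ht y)
  congr 1; ext z
  rw [← gaussKernel_neg, neg_sub]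

/-- On a set of diameter `2` the exponents at times `t` and `t + δ` differ by at most `4 δ / (8
t²)`. A delay `δ ≤ t²` thus costs a bounded factor, which allows the singular time of the test
function to be moved past `t₀`. -/
lemma gaussKernel_add_le {t δ : ℝ} (ht : 0 < t) (hδ : 0 ≤ δ) {y : Plane} (hy : ‖y‖ ≤ 2) :
    gaussKernel (t + δ) y ≤ Real.exp (δ / (2 * t ^ 2)) * gaussKernel t y := by
  unfold gaussKernel
  rw [mul_left_comm, ← Real.exp_add]
  have h1 : (t + δ)⁻¹ ≤ t⁻¹ := by gcongr; linarith
  refine mul_le_mul h1 (Real.exp_le_exp.2 ?_) (Real.exp_pos _).le (by positivity)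
  have h2 : ‖y‖ ^ 2 ≤ 4 := by nlinarith [norm_nonneg y]
  have h3 : ‖y‖ ^ 2 / (8 * t) - ‖y‖ ^ 2 / (8 * (t + δ)) =
      ‖y‖ ^ 2 / 4 * (δ / (2 * (t * (t + δ)))) := by field_simp; ring
  have h4 : δ / (2 * (t * (t + δ))) ≤ δ / (2 * t ^ 2) := by gcongr; nlinarith
  have h5 : 0 ≤ δ / (2 * (t * (t + δ))) := by positivity
  nlinarith

lemma heatAverage_add_time_le {f : Plane → ℝ} (hf : BoundedOnDisc f)
    (h0 : ∀ x ∈ disc, 0 ≤ f x) {t δ : ℝ} (ht : 0 < t) (hδ : 0 ≤ δ) {x : Plane} (hx : x ∈ disc) :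
    heatAverage f (t + δ) x ≤ Real.exp (δ / (2 * t ^ 2)) * heatAverage f t x := by
  unfold heatAverage
  rw [← integral_const_mul]
  refine setIntegral_mono_on ((boundedOnDisc_gaussKernel _ x).mul hf).integrableOn
    (((boundedOnDisc_gaussKernel _ x).mul hf).const_mul _).integrableOn measurableSet_disc
    fun y hy => ?_
  rw [← mul_assoc]
  refine mul_le_mul_of_nonneg_right (gaussKernel_add_le ht hδ ?_) (h0 y hy)
  have := norm_sub_le x y
  simp at hx hy
  linarith

/-! ### Distributional monotonicity on an interval -/

/-- A smooth monotone function which is `0` on `(-∞, α]` and `1` on `[β, ∞)`. -/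
def ramp (α β t : ℝ) : ℝ := Real.smoothTransition ((t - α) / (β - α))

lemma contDiff_ramp (α β : ℝ) : ContDiff ℝ ∞ (ramp α β) :=
  (Real.smoothTransition.contDiff (n := ⊤)).comp (by fun_prop)

lemma ramp_nonneg (α β t : ℝ) : 0 ≤ ramp α β t := Real.smoothTransition.nonneg _

lemma ramp_le_one (α β t : ℝ) : ramp α β t ≤ 1 := Real.smoothTransition.le_one _

lemma ramp_of_le {α β t : ℝ} (h : α < β) (ht : t ≤ α) : ramp α β t = 0 :=
  Real.smoothTransition.zero_of_nonpos (div_nonpos_of_nonpos_of_nonneg (by linarith) (by linarith))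

lemma ramp_of_ge {α β t : ℝ} (h : α < β) (ht : β ≤ t) : ramp α β t = 1 :=
  Real.smoothTransition.one_of_one_le ((one_le_div (by linarith)).2 (by linarith))

lemma monotone_ramp {α β : ℝ} (h : α < β) : Monotone (ramp α β) := fun x y hxy =>
  Real.smoothTransition.monotone (by
    have : 0 < β - α := by linarith
    gcongr)

lemma deriv_ramp_nonneg {α β : ℝ} (h : α < β) (t : ℝ) : 0 ≤ deriv (ramp α β) t :=
  (monotone_ramp h).deriv_nonneg

lemma deriv_ramp_eq_zero {α β : ℝ} (h : α < β) {t : ℝ} (ht : t ∉ Icc α β) :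
    deriv (ramp α β) t = 0 := by
  rcases lt_or_ge t α with h1 | h1
  · have : ramp α β =ᶠ[nhds t] fun _ => 0 :=
      Filter.eventually_of_mem (Iio_mem_nhds h1) fun s hs => ramp_of_le h (le_of_lt hs)
    rw [this.deriv_eq]; simp
  · have h2 : β < t := by
      by_contra h3; exact ht ⟨h1, not_lt.1 h3⟩
    have : ramp α β =ᶠ[nhds t] fun _ => 1 :=
      Filter.eventually_of_mem (Ioi_mem_nhds h2) fun s hs => ramp_of_ge h (le_of_lt hs)
    rw [this.deriv_eq]; simp

lemma continuous_deriv_ramp (α β : ℝ) : Continuous (deriv (ramp α β)) :=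
  (contDiff_ramp α β).continuous_deriv (by simp)

lemma setIntegral_deriv_ramp {α β : ℝ} (h : α < β) : ∫ t in Icc α β, deriv (ramp α β) t = 1 := by
  rw [integral_Icc_eq_integral_Ioc, ← intervalIntegral.integral_of_le h.le,
    intervalIntegral.integral_deriv_eq_sub]
  · rw [ramp_of_le h le_rfl, ramp_of_ge h le_rfl]; simp
  · exact fun t _ => ((contDiff_ramp α β).differentiable (by simp)) t
  · exact (continuous_deriv_ramp α β).intervalIntegrable _ _

lemma integral_deriv_ramp_mul_eq {α β : ℝ} (h : α < β) (H : ℝ → ℝ) :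
    ∫ t, deriv (ramp α β) t * H t = ∫ t in Icc α β, deriv (ramp α β) t * H t :=
  (setIntegral_eq_integral_of_forall_compl_eq_zero fun t ht => by
    rw [deriv_ramp_eq_zero h ht, zero_mul]).symm

/-- The derivative of a ramp is a probability density on `[α, β]`, so the integral is a weighted
mean of `H`. -/
lemma integral_deriv_ramp_mul_le {α β c : ℝ} (h : α < β) {H : ℝ → ℝ} (hH : Continuous H)
    (hc : ∀ t ∈ Icc α β, H t ≤ c) : ∫ t, deriv (ramp α β) t * H t ≤ c := by
  rw [integral_deriv_ramp_mul_eq h]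
  calc ∫ t in Icc α β, deriv (ramp α β) t * H t
      ≤ ∫ t in Icc α β, deriv (ramp α β) t * c := by
        refine setIntegral_mono_on ?_ ?_ measurableSet_Icc
          fun t ht => mul_le_mul_of_nonneg_left (hc t ht) (deriv_ramp_nonneg h t)
        · exact ((continuous_deriv_ramp α β).mul hH).continuousOn.integrableOn_Icc
        · exact ((continuous_deriv_ramp α β).mul continuous_const).continuousOn.integrableOn_Icc
    _ = c := by rw [integral_mul_const, setIntegral_deriv_ramp h, one_mul]

lemma le_integral_deriv_ramp_mul {α β c : ℝ} (h : α < β) {H : ℝ → ℝ} (hH : Continuous H)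
    (hc : ∀ t ∈ Icc α β, c ≤ H t) : c ≤ ∫ t, deriv (ramp α β) t * H t := by
  have := integral_deriv_ramp_mul_le (c := -c) h hH.neg fun t ht => neg_le_neg (hc t ht)
  simp only [Pi.neg_apply, mul_neg, integral_neg] at this
  linarith

lemma integrable_mul_of_tsupport_subset {χ F : ℝ → ℝ} {a b : ℝ} (hχ : Continuous χ)
    (hs : tsupport χ ⊆ Ioo a b) (hF : ContinuousOn F (Icc a b)) :
    Integrable fun t => χ t * F t := by
  refine IntegrableOn.integrable_of_forall_notMem_eq_zero
    ((hχ.continuousOn.mul hF).integrableOn_Icc) fun t ht => ?_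
  rw [image_eq_zero_of_notMem_tsupport fun h => ht (Ioo_subset_Icc_self (hs h)), zero_mul]

/-- A continuous function whose distributional derivative is at most `G` grows by at most the
integral of `G`. -/
lemma sub_le_integral_of_weak {F G : ℝ → ℝ} {a b : ℝ} (hab : a < b)
    (hF : ContinuousOn F (Icc a b)) (hG : ContinuousOn G (Icc a b))
    (h : ∀ χ : ℝ → ℝ, ContDiff ℝ ∞ χ → (∀ t, 0 ≤ χ t) → tsupport χ ⊆ Ioo a b →
      -∫ t, deriv χ t * F t ≤ ∫ t, χ t * G t) :
    F b - F a ≤ ∫ t in a..b, G t := by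
  -- Extension by the boundary values gives functions continuous on all of `ℝ`; integrals against
  -- functions supported in `(a, b)` do not change.
  set F' := IccExtend hab.le (domRestrict (Icc a b) F) with hF'
  set G' := IccExtend hab.le (domRestrict (Icc a b) G) with hG'
  have cF : Continuous F' := continuous_IccExtend_iff.2 hF.domRestrict
  have cG : Continuous G' := continuous_IccExtend_iff.2 hG.domRestrict
  have eF : ∀ t ∈ Icc a b, F' t = F t := fun t ht => by
    rw [hF', IccExtend_of_mem _ _ ht]; rfl
  have eG : ∀ t ∈ Icc a b, G' t = G t := fun t ht => by
    rw [hG', IccExtend_of_mem _ _ ht]; rfl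
  set P : ℝ → ℝ := fun t => ∫ s in a..t, G' s with hP
  have dP : ∀ t, HasDerivAt P (G' t) t := fun t =>
    intervalIntegral.integral_hasDerivAt_right (cG.intervalIntegrable _ _)
      (cG.stronglyMeasurableAtFilter _ _) cG.continuousAt
  have cP : Continuous P := continuous_iff_continuousAt.2 fun t => (dP t).continuousAt
  -- Subtracting a primitive of `G` reduces the claim to a function with nonpositive distributional
  -- derivative.
  have key : ∀ χ : ℝ → ℝ, ContDiff ℝ ∞ χ → (∀ t, 0 ≤ χ t) → tsupport χ ⊆ Ioo a b →
      0 ≤ ∫ t, deriv χ t * (F' t - P t) := by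
    intro χ hχ h0 hs
    have hd : Continuous (deriv χ) := hχ.continuous_deriv (by simp)
    have hds : tsupport (deriv χ) ⊆ Ioo a b := tsupport_deriv_subset.trans hs
    have i1 : Integrable fun t => χ t * G' t :=
      integrable_mul_of_tsupport_subset hχ.continuous hs cG.continuousOn
    have i2 : Integrable fun t => deriv χ t * P t :=
      integrable_mul_of_tsupport_subset hd hds cP.continuousOn
    have i3 : Integrable fun t => χ t * P t :=
      integrable_mul_of_tsupport_subset hχ.continuous hs cP.continuousOn
    have i4 : Integrable fun t => deriv χ t * F' t :=
      integrable_mul_of_tsupport_subset hd hds cF.continuousOn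
    have e := integral_mul_deriv_eq_deriv_mul_of_integrable
      (fun t _ => (hχ.differentiable (by simp) t).hasDerivAt) (fun t _ => dP t) i1 i2 i3
    have h1 := h χ hχ h0 hs
    have e1 : ∫ t, deriv χ t * F t = ∫ t, deriv χ t * F' t := by
      congr 1; ext t
      by_cases ht : t ∈ Icc a b
      · rw [eF t ht]
      · rw [image_eq_zero_of_notMem_tsupport fun h => ht (Ioo_subset_Icc_self (hds h))]; simp
    have e2 : ∫ t, χ t * G t = ∫ t, χ t * G' t := by
      congr 1; ext t
      by_cases ht : t ∈ Icc a b
      · rw [eG t ht]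
      · rw [image_eq_zero_of_notMem_tsupport fun h => ht (Ioo_subset_Icc_self (hs h))]; simp
    simp_rw [mul_sub]
    rw [integral_sub i4 i2]
    linarith
  set H : ℝ → ℝ := fun t => F' t - P t with hH
  have cH : Continuous H := cF.sub cP
  suffices H b ≤ H a by
    have ha : P a = 0 := by simp [hP]
    have hb : P b = ∫ t in a..b, G t := by
      refine intervalIntegral.integral_congr fun t ht => ?_
      rw [uIcc_of_le hab.le] at ht
      exact eG t ht
    simp only [hH, ha, hb, eF a (left_mem_Icc.2 hab.le), eF b (right_mem_Icc.2 hab.le)] at this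
    linarith
  by_contra! hlt
  -- If `H` increased from `a` to `b`, these two levels would separate its values near `a` from
  -- those near `b`.
  set c₁ := (2 * H a + H b) / 3
  set c₂ := (H a + 2 * H b) / 3
  have h1 : ∀ᶠ t in nhds a, H t < c₁ :=
    cH.continuousAt.eventually_lt continuousAt_const (by simp only [c₁]; linarith)
  have h2 : ∀ᶠ t in nhds b, c₂ < H t :=
    ContinuousAt.eventually_lt continuousAt_const cH.continuousAt (by simp only [c₂]; linarith)
  obtain ⟨r₁, hr₁, H1⟩ := Metric.eventually_nhds_iff.1 h1
  obtain ⟨r₂, hr₂, H2⟩ := Metric.eventually_nhds_iff.1 h2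
  set r := min (min r₁ r₂) (b - a) with hr
  have r0 : 0 < r := lt_min (lt_min hr₁ hr₂) (by linarith)
  have rr1 : r ≤ r₁ := (min_le_left _ _).trans (min_le_left _ _)
  have rr2 : r ≤ r₂ := (min_le_left _ _).trans (min_le_right _ _)
  have rr3 : r ≤ b - a := min_le_right _ _
  have o1 : a + r / 8 < a + r / 4 := by linarith
  have o2 : b - r / 4 < b - r / 8 := by linarith
  -- The derivative of this plateau function is a unit mass near `a` minus a unit mass near `b`.
  -- Testing with it compares the two means of `H`.
  set χ : ℝ → ℝ := fun t => ramp (a + r / 8) (a + r / 4) t - ramp (b - r / 4) (b - r / 8) t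
    with hχ
  have hsupp : tsupport χ ⊆ Icc (a + r / 8) (b - r / 8) := by
    refine closure_minimal (fun t ht => ?_) isClosed_Icc
    by_contra hn
    refine ht ?_
    simp only [hχ]
    by_cases h3 : t < a + r / 8
    · rw [ramp_of_le o1 h3.le, ramp_of_le o2 (by linarith)]; simp
    · have h4 : b - r / 8 < t := by
        by_contra h5; exact hn ⟨not_lt.1 h3, not_lt.1 h5⟩
      rw [ramp_of_ge o1 (by linarith), ramp_of_ge o2 h4.le]; simp
  have hk := key χ ((contDiff_ramp _ _).sub (contDiff_ramp _ _)) (fun t => by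
    simp only [hχ, sub_nonneg]
    rcases le_total t (b - r / 4) with h3 | h3
    · rw [ramp_of_le o2 h3]; exact ramp_nonneg _ _ _
    · rw [ramp_of_ge o1 (by linarith)]; exact ramp_le_one _ _ _)
    (hsupp.trans fun t ht => ⟨by linarith [ht.1], by linarith [ht.2]⟩)
  have hdχ : ∀ t, deriv χ t =
      deriv (ramp (a + r / 8) (a + r / 4)) t - deriv (ramp (b - r / 4) (b - r / 8)) t := fun t =>
    deriv_fun_sub ((contDiff_ramp _ _).differentiable (by simp) t)
      ((contDiff_ramp _ _).differentiable (by simp) t)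
  have hint : ∀ {α β : ℝ} (_ : α < β), Integrable fun t => deriv (ramp α β) t * H t := by
    intro α β h3
    refine IntegrableOn.integrable_of_forall_notMem_eq_zero
      (((continuous_deriv_ramp α β).mul cH).continuousOn.integrableOn_Icc (a := α) (b := β))
      fun t ht => ?_
    rw [deriv_ramp_eq_zero h3 ht, zero_mul]
  simp_rw [hdχ, sub_mul] at hk
  rw [integral_sub (hint o1) (hint o2)] at hk
  have k1 := integral_deriv_ramp_mul_le (c := c₁) o1 cH fun t ht => (H1 (by
    rw [Real.dist_eq, abs_lt]; constructor <;> linarith [ht.1, ht.2])).le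
  have k2 := le_integral_deriv_ramp_mul (c := c₂) o2 cH fun t ht => (H2 (by
    rw [Real.dist_eq, abs_lt]; constructor <;> linarith [ht.1, ht.2])).le
  have : c₁ < c₂ := by simp only [c₁, c₂]; linarith
  simp only [hH] at k1 k2
  linarith

/-! ### Subsolutions on the unit disc -/

/-- The partial derivative `∂ⱼ f`. -/
def partialD (j : Fin 2) (f : Plane → ℝ) (x : Plane) : ℝ := fderiv ℝ f x (e j)

/-- The coefficients of a second order elliptic operator: the principal part `a`, its inverse
matrix `q`, the first order part `b` and the density `w` of the reference measure. -/
structure Coefficients where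
  /-- the principal part -/
  a : Fin 2 → Fin 2 → Plane → ℝ
  /-- the inverse of the principal part -/
  q : Fin 2 → Fin 2 → Plane → ℝ
  /-- the first order part -/
  b : Fin 2 → Plane → ℝ
  /-- the density of the reference measure -/
  w : Plane → ℝ

/-- The operator `L f = ∑ aᵢⱼ ∂ᵢ∂ⱼ f + ∑ bⱼ ∂ⱼ f`. -/
def Coefficients.op (𝒞 : Coefficients) (f : Plane → ℝ) (x : Plane) : ℝ :=
  ∑ i, ∑ j, 𝒞.a i j x * partialD i (partialD j f) x + ∑ j, 𝒞.b j x * partialD j f x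

/-- The coefficients are close to those of the Euclidean Laplacian on the closed unit disc, with
first derivatives of size at most `K`. -/
structure Coefficients.NearlyFlat (𝒞 : Coefficients) (K : ℝ) : Prop where
  symm : ∀ i j, ∀ x ∈ Metric.closedBall (0 : Plane) 1, 𝒞.a i j x = 𝒞.a j i x
  symm_q : ∀ i j, ∀ x ∈ Metric.closedBall (0 : Plane) 1, 𝒞.q i j x = 𝒞.q j i x
  inv : ∀ i k, ∀ x ∈ Metric.closedBall (0 : Plane) 1,
    ∑ j, 𝒞.a i j x * 𝒞.q j k x = if i = k then 1 else 0
  a_near : ∀ i j, ∀ x ∈ Metric.closedBall (0 : Plane) 1,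
    |𝒞.a i j x - if i = j then 1 else 0| ≤ 1 / 10
  q_near : ∀ i j, ∀ x ∈ Metric.closedBall (0 : Plane) 1,
    |𝒞.q i j x - if i = j then 1 else 0| ≤ 1 / 10
  lipschitz : ∀ i j, ∀ x ∈ Metric.closedBall (0 : Plane) 1,
    ∀ y ∈ Metric.closedBall (0 : Plane) 1, |𝒞.a i j x - 𝒞.a i j y| ≤ K * ‖x - y‖
  drift : ∀ j, ∀ x ∈ Metric.closedBall (0 : Plane) 1, |𝒞.b j x| ≤ K
  density_ge : ∀ x ∈ Metric.closedBall (0 : Plane) 1, 1 / 2 ≤ 𝒞.w x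
  density_le : ∀ x ∈ Metric.closedBall (0 : Plane) 1, 𝒞.w x ≤ 2
  cont_a : ∀ i j, ContinuousOn (𝒞.a i j) (Metric.closedBall 0 1)
  cont_b : ∀ j, ContinuousOn (𝒞.b j) (Metric.closedBall 0 1)
  cont_w : ContinuousOn 𝒞.w (Metric.closedBall 0 1)

/-- A nonnegative continuous weak solution of `(∂ₜ - L) v ≤ A v³ + B v` on the unit disc, up to
time `T`. -/
structure DiscSubsolution (𝒞 : Coefficients) (A B T : ℝ) (v : Plane → ℝ → ℝ) : Prop where
  continuousOn : ContinuousOn (fun z : Plane × ℝ => v z.1 z.2)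
    (Metric.closedBall 0 1 ×ˢ Icc 0 T)
  nonneg : ∀ x ∈ Metric.closedBall (0 : Plane) 1, ∀ t ∈ Icc 0 T, 0 ≤ v x t
  weak : ∀ φ : Plane → ℝ → ℝ, ContDiff ℝ ∞ (fun z : Plane × ℝ => φ z.1 z.2) →
    HasCompactSupport (fun z : Plane × ℝ => φ z.1 z.2) →
    tsupport (fun z : Plane × ℝ => φ z.1 z.2) ⊆ disc ×ˢ Ioo 0 T → (∀ x t, 0 ≤ φ x t) →
    ∫ t, ∫ x in disc, v x t * (-deriv (φ x) t - 𝒞.op (fun z => φ z t) x) * 𝒞.w x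
      ≤ ∫ t, ∫ x in disc, (A * v x t ^ 3 + B * v x t) * φ x t * 𝒞.w x

lemma partialD_const_mul (j : Fin 2) (c : ℝ) (f : Plane → ℝ) :
    partialD j (fun x => c * f x) = fun x => c * partialD j f x := by
  ext x
  have : (fun x => c * f x) = c • f := rfl
  simp [partialD, this, fderiv_const_smul_field]

lemma Coefficients.op_const_mul (𝒞 : Coefficients) (c : ℝ) (f : Plane → ℝ) (x : Plane) :
    𝒞.op (fun x => c * f x) x = c * 𝒞.op f x := by
  simp only [Coefficients.op, partialD_const_mul, Fin.sum_univ_two]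
  ring

/-! ### Space and time derivatives of smooth functions of `(x, t)`. -/

section Slices

variable {f : Plane → ℝ → ℝ} {b : ℝ}

lemma isOpen_univ_prod_Iio (b : ℝ) : IsOpen ((univ : Set Plane) ×ˢ Iio b) :=
  isOpen_univ.prod isOpen_Iio

lemma partialD_slice (hf : ContDiffOn ℝ ∞ (fun z : Plane × ℝ => f z.1 z.2) (univ ×ˢ Iio b))
    (j : Fin 2) {t : ℝ} (ht : t < b) (x : Plane) :
    partialD j (fun y => f y t) x
      = fderiv ℝ (fun z : Plane × ℝ => f z.1 z.2) (x, t) (e j, 0) := by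
  have h1 : DifferentiableAt ℝ (fun z : Plane × ℝ => f z.1 z.2) (x, t) :=
    (hf.contDiffAt ((isOpen_univ_prod_Iio b).mem_nhds (mk_mem_prod (mem_univ x) ht))).differentiableAt
      (by simp)
  have h2 : HasFDerivAt (fun y : Plane => (y, t)) (ContinuousLinearMap.inl ℝ Plane ℝ) x :=
    hasFDerivAt_prodMk_left x t
  have h3 := (h1.hasFDerivAt (x := (x, t))).comp x h2
  have h4 : HasFDerivAt (fun y => f y t) _ x := h3
  rw [partialD, h4.fderiv]
  simp

lemma deriv_slice (hf : ContDiffOn ℝ ∞ (fun z : Plane × ℝ => f z.1 z.2) (univ ×ˢ Iio b))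
    {t : ℝ} (ht : t < b) (x : Plane) :
    HasDerivAt (f x) (fderiv ℝ (fun z : Plane × ℝ => f z.1 z.2) (x, t) (0, 1)) t := by
  have h1 : DifferentiableAt ℝ (fun z : Plane × ℝ => f z.1 z.2) (x, t) :=
    (hf.contDiffAt ((isOpen_univ_prod_Iio b).mem_nhds (mk_mem_prod (mem_univ x) ht))).differentiableAt
      (by simp)
  have h2 : HasFDerivAt (fun s : ℝ => (x, s)) (ContinuousLinearMap.inr ℝ Plane ℝ) t :=
    hasFDerivAt_prodMk_right x t
  have h3 := (h1.hasFDerivAt (x := (x, t))).comp t h2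
  have h4 : HasFDerivAt (f x) _ t := h3
  simpa using h4.hasDerivAt

lemma contDiffOn_fderiv_apply
    (hf : ContDiffOn ℝ ∞ (fun z : Plane × ℝ => f z.1 z.2) (univ ×ˢ Iio b)) (u : Plane × ℝ) :
    ContDiffOn ℝ ∞ (fun z => fderiv ℝ (fun z : Plane × ℝ => f z.1 z.2) z u)
      (univ ×ˢ Iio b) :=
  (hf.fderiv_of_isOpen (isOpen_univ_prod_Iio b) (by simp)).clm_apply contDiffOn_const

lemma contDiffOn_partialD_slice
    (hf : ContDiffOn ℝ ∞ (fun z : Plane × ℝ => f z.1 z.2) (univ ×ˢ Iio b)) (j : Fin 2) :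
    ContDiffOn ℝ ∞ (fun z : Plane × ℝ => partialD j (fun y => f y z.2) z.1)
      (univ ×ˢ Iio b) :=
  (contDiffOn_fderiv_apply hf (e j, 0)).congr fun z hz => partialD_slice hf j hz.2 z.1

lemma contDiffOn_deriv_slice
    (hf : ContDiffOn ℝ ∞ (fun z : Plane × ℝ => f z.1 z.2) (univ ×ˢ Iio b)) :
    ContDiffOn ℝ ∞ (fun z : Plane × ℝ => deriv (f z.1) z.2) (univ ×ˢ Iio b) :=
  (contDiffOn_fderiv_apply hf (0, 1)).congr fun z hz => (deriv_slice hf hz.2 z.1).deriv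

lemma continuousOn_op_slice {𝒞 : Coefficients} {K : ℝ} (h𝒞 : 𝒞.NearlyFlat K)
    (hf : ContDiffOn ℝ ∞ (fun z : Plane × ℝ => f z.1 z.2) (univ ×ˢ Iio b)) :
    ContinuousOn (fun z : Plane × ℝ => 𝒞.op (fun y => f y z.2) z.1)
      (Metric.closedBall 0 1 ×ˢ Iio b) := by
  have hsub : Metric.closedBall (0 : Plane) 1 ×ˢ Iio b ⊆ univ ×ˢ Iio b :=
    prod_mono_left (subset_univ _)
  unfold Coefficients.op
  refine ContinuousOn.add ?_ ?_
  · refine continuousOn_finsetSum _ fun i _ => continuousOn_finsetSum _ fun j _ => ?_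
    refine ContinuousOn.mul ?_ ?_
    · exact (h𝒞.cont_a i j).comp continuousOn_fst fun z hz => hz.1
    · exact (contDiffOn_partialD_slice (f := fun x t => partialD j (fun y => f y t) x)
        (contDiffOn_partialD_slice hf j) i).continuousOn.mono hsub
  · refine continuousOn_finsetSum _ fun j _ => ContinuousOn.mul ?_ ?_
    · exact (h𝒞.cont_b j).comp continuousOn_fst fun z hz => hz.1
    · exact (contDiffOn_partialD_slice hf j).continuousOn.mono hsub

end Slices

lemma continuousOn_setIntegral_disc {h : Plane × ℝ → ℝ} {a b : ℝ}
    (hh : ContinuousOn h (Metric.closedBall 0 1 ×ˢ Icc a b)) :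
    ContinuousOn (fun t => ∫ x in disc, h (x, t)) (Icc a b) := by
  obtain ⟨C, hC⟩ := ((isCompact_closedBall (0 : Plane) 1).prod
    (isCompact_Icc (a := a) (b := b))).exists_bound_of_continuousOn hh
  have hslice : ∀ t ∈ Icc a b, ContinuousOn (fun x => h (x, t)) (Metric.closedBall 0 1) :=
    fun t ht => hh.comp (by fun_prop) fun x hx => ⟨hx, ht⟩
  refine continuousOn_of_dominated (bound := fun _ => C)
    (fun t ht => (hslice t ht).boundedOnDisc.1) (fun t ht => ?_)
    (BoundedOnDisc.const C).integrableOn ?_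
  · filter_upwards [ae_restrict_mem measurableSet_disc] with x hx
    exact hC (x, t) ⟨Metric.ball_subset_closedBall hx, ht⟩
  · filter_upwards [ae_restrict_mem measurableSet_disc] with x hx
    exact hh.comp (by fun_prop) fun t ht => ⟨Metric.ball_subset_closedBall hx, ht⟩

/-- Testing a weak subsolution with a function that is smooth up to the final time. -/
lemma DiscSubsolution.slice {𝒞 : Coefficients} {K A B T : ℝ} {v : Plane → ℝ → ℝ}
    (h𝒞 : 𝒞.NearlyFlat K) (hv : DiscSubsolution 𝒞 A B T v) {f : Plane → ℝ → ℝ} {a b b' : ℝ}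
    (ha : 0 ≤ a) (hab : a < b) (hbT : b ≤ T) (hb' : b < b')
    (hf : ContDiffOn ℝ ∞ (fun z : Plane × ℝ => f z.1 z.2) (univ ×ˢ Iio b'))
    {S : Set Plane} (hS : IsCompact S) (hSd : S ⊆ disc) (hfS : ∀ x ∉ S, ∀ t, f x t = 0)
    (hf0 : ∀ x, ∀ t < b', 0 ≤ f x t) :
    IntervalIntegrable (fun t => ∫ x in disc, (v x t * (deriv (f x) t + 𝒞.op (fun y => f y t) x)
        + (A * v x t ^ 3 + B * v x t) * f x t) * 𝒞.w x) volume a b ∧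
    (∫ x in disc, v x b * f x b * 𝒞.w x) - (∫ x in disc, v x a * f x a * 𝒞.w x) ≤
      ∫ t in a..b, ∫ x in disc, (v x t * (deriv (f x) t + 𝒞.op (fun y => f y t) x)
        + (A * v x t ^ 3 + B * v x t) * f x t) * 𝒞.w x := by
  have hsubv : Metric.closedBall (0 : Plane) 1 ×ˢ Icc a b ⊆ Metric.closedBall 0 1 ×ˢ Icc 0 T :=
    prod_mono_right (Icc_subset_Icc ha hbT)
  have hsubf : Metric.closedBall (0 : Plane) 1 ×ˢ Icc a b ⊆ univ ×ˢ Iio b' :=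
    prod_mono (subset_univ _) fun t ht => lt_of_le_of_lt ht.2 hb'
  have hsubo : Metric.closedBall (0 : Plane) 1 ×ˢ Icc a b ⊆ Metric.closedBall 0 1 ×ˢ Iio b' :=
    prod_mono_right fun t ht => lt_of_le_of_lt ht.2 hb'
  have cv := hv.continuousOn.mono hsubv
  have cf := hf.continuousOn.mono hsubf
  have cd := (contDiffOn_deriv_slice hf).continuousOn.mono hsubf
  have co := (continuousOn_op_slice h𝒞 hf).mono hsubo
  have cw : ContinuousOn (fun z : Plane × ℝ => 𝒞.w z.1)
      (Metric.closedBall (0 : Plane) 1 ×ˢ Icc a b) :=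
    h𝒞.cont_w.comp continuousOn_fst fun z hz => hz.1
  have c1 : ContinuousOn (fun z : Plane × ℝ => v z.1 z.2 * f z.1 z.2 * 𝒞.w z.1)
      (Metric.closedBall (0 : Plane) 1 ×ˢ Icc a b) := (cv.mul cf).mul cw
  have c2 : ContinuousOn (fun z : Plane × ℝ =>
      v z.1 z.2 * (deriv (f z.1) z.2 + 𝒞.op (fun y => f y z.2) z.1) * 𝒞.w z.1)
      (Metric.closedBall (0 : Plane) 1 ×ˢ Icc a b) := (cv.mul (cd.add co)).mul cw
  have c3 : ContinuousOn (fun z : Plane × ℝ =>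
      (A * v z.1 z.2 ^ 3 + B * v z.1 z.2) * f z.1 z.2 * 𝒞.w z.1)
      (Metric.closedBall (0 : Plane) 1 ×ˢ Icc a b) :=
    (((continuousOn_const.mul (cv.pow 3)).add (continuousOn_const.mul cv)).mul cf).mul cw
  have slice : ∀ {h : Plane × ℝ → ℝ},
      ContinuousOn h (Metric.closedBall (0 : Plane) 1 ×ˢ Icc a b) → ∀ t ∈ Icc a b,
      IntegrableOn (fun x => h (x, t)) disc := fun {h} hh t ht =>
    (ContinuousOn.boundedOnDisc
      (hh.comp (by fun_prop) fun x hx => ⟨hx, ht⟩ : ContinuousOn (fun x => h (x, t)) _)).integrableOn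
  have I1 := continuousOn_setIntegral_disc c1
  have I2 := continuousOn_setIntegral_disc c2
  have I3 := continuousOn_setIntegral_disc c3
  have esum : ∀ t ∈ Icc a b, (∫ x in disc, (v x t * (deriv (f x) t + 𝒞.op (fun y => f y t) x)
        + (A * v x t ^ 3 + B * v x t) * f x t) * 𝒞.w x) =
      (∫ x in disc, v x t * (deriv (f x) t + 𝒞.op (fun y => f y t) x) * 𝒞.w x) +
      ∫ x in disc, (A * v x t ^ 3 + B * v x t) * f x t * 𝒞.w x := fun t ht => by
    rw [← integral_add (slice c2 t ht) (slice c3 t ht)]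
    simp_rw [add_mul]
  have Isum : ContinuousOn (fun t => ∫ x in disc,
      (v x t * (deriv (f x) t + 𝒞.op (fun y => f y t) x)
        + (A * v x t ^ 3 + B * v x t) * f x t) * 𝒞.w x) (Icc a b) :=
    (I2.add I3).congr esum
  refine ⟨Isum.intervalIntegrable_of_Icc hab.le,
    sub_le_integral_of_weak hab I1 Isum fun χ hχ hχ0 hχs => ?_⟩
  have hχz : ∀ t ∉ Icc a b, χ t = 0 := fun t ht =>
    image_eq_zero_of_notMem_tsupport fun h => ht (Ioo_subset_Icc_self (hχs h))
  have hχ' : tsupport (deriv χ) ⊆ Ioo a b := tsupport_deriv_subset.trans hχs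
  have hdχz : ∀ t ∉ Icc a b, deriv χ t = 0 := fun t ht =>
    image_eq_zero_of_notMem_tsupport fun h => ht (Ioo_subset_Icc_self (hχ' h))
  have cdχ : Continuous (deriv χ) := hχ.continuous_deriv (by simp)
  have hcs : tsupport (fun z : Plane × ℝ => χ z.2 * f z.1 z.2) ⊆ S ×ˢ tsupport χ := by
    refine closure_minimal (fun z hz => ?_) (hS.isClosed.prod (isClosed_tsupport _))
    refine ⟨?_, subset_tsupport _ (left_ne_zero_of_mul hz)⟩
    by_contra hn
    exact hz (by simp [hfS z.1 hn])
  have hcomp : IsCompact (tsupport χ) :=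
    isCompact_Icc.of_isClosed_subset (isClosed_tsupport _) (hχs.trans Ioo_subset_Icc_self)
  -- The factor `χ` provides compact support in time. The product rule leaves `χ' f`, which exhibits
  -- the distributional derivative of `t ↦ ∫ v f w`.
  have hweak := hv.weak (fun x t => χ t * f x t) ?_ ?_ ?_ ?_
  · have e1 : ∀ t, (∫ x in disc, v x t * (-deriv (fun s => χ s * f x s) t
        - 𝒞.op (fun z => χ t * f z t) x) * 𝒞.w x) =
        -((deriv χ t * ∫ x in disc, v x t * f x t * 𝒞.w x) +
        χ t * ∫ x in disc, v x t * (deriv (f x) t + 𝒞.op (fun y => f y t) x) * 𝒞.w x) := by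
      intro t
      by_cases ht : t ∈ Icc a b
      · rw [← integral_const_mul, ← integral_const_mul,
          ← integral_add ((slice c1 t ht).const_mul _) ((slice c2 t ht).const_mul _),
          ← integral_neg]
        congr 1; ext x
        have h1 := ((hχ.differentiable (by simp) t).hasDerivAt).mul
          (deriv_slice hf (lt_of_le_of_lt ht.2 hb') x)
        have h2 : HasDerivAt (fun s => χ s * f x s) _ t := h1
        rw [h2.deriv, 𝒞.op_const_mul, (deriv_slice hf (lt_of_le_of_lt ht.2 hb') x).deriv]
        ring
      · have h1 : ∀ x, deriv (fun s => χ s * f x s) t = 0 := fun x => by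
          have : (fun s => χ s * f x s) =ᶠ[nhds t] fun _ => 0 :=
            Filter.eventually_of_mem (isClosed_Icc.isOpen_compl.mem_nhds ht)
              fun s hs => by
                show χ s * f x s = 0
                rw [hχz s hs, zero_mul]
          rw [this.deriv_eq]; simp
        simp only [h1, 𝒞.op_const_mul, hχz t ht, hdχz t ht]
        simp
    have e2 : ∀ t, (∫ x in disc, (A * v x t ^ 3 + B * v x t) * (χ t * f x t) * 𝒞.w x) =
        χ t * ∫ x in disc, (A * v x t ^ 3 + B * v x t) * f x t * 𝒞.w x := by
      intro t
      rw [← integral_const_mul]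
      congr 1; ext x; ring
    simp_rw [e1, e2] at hweak
    have j1 := integrable_mul_of_tsupport_subset cdχ hχ' I1
    have j2 := integrable_mul_of_tsupport_subset hχ.continuous hχs I2
    have j3 := integrable_mul_of_tsupport_subset hχ.continuous hχs I3
    have e3 : ∫ t, χ t * ∫ x in disc, (v x t * (deriv (f x) t + 𝒞.op (fun y => f y t) x)
        + (A * v x t ^ 3 + B * v x t) * f x t) * 𝒞.w x =
        (∫ t, χ t * ∫ x in disc, v x t * (deriv (f x) t + 𝒞.op (fun y => f y t) x) * 𝒞.w x)
        + ∫ t, χ t * ∫ x in disc, (A * v x t ^ 3 + B * v x t) * f x t * 𝒞.w x := by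
      rw [← integral_add j2 j3]
      congr 1; ext t
      by_cases ht : t ∈ Icc a b
      · rw [esum t ht]; ring
      · simp [hχz t ht]
    rw [integral_neg, integral_add j1 j2] at hweak
    rw [e3]
    linarith
  · refine contDiff_iff_contDiffAt.2 fun z => ?_
    by_cases hz : z.2 < b'
    · exact (hχ.contDiffAt.comp z contDiffAt_snd).mul
        (hf.contDiffAt ((isOpen_univ_prod_Iio b').mem_nhds ⟨mem_univ _, hz⟩))
    -- Nothing is known about `f` from time `b'` on, but `χ` vanishes after `b < b'`.
    · have : (fun z : Plane × ℝ => χ z.2 * f z.1 z.2) =ᶠ[nhds z] fun _ => 0 := by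
        have ho : IsOpen {z : Plane × ℝ | b < z.2} := isOpen_lt continuous_const continuous_snd
        refine Filter.eventually_of_mem (ho.mem_nhds (by simp only [mem_ofPred_eq]; linarith))
          fun y hy => ?_
        simp only [mem_ofPred_eq] at hy
        show χ y.2 * f y.1 y.2 = 0
        rw [hχz y.2 fun h => by linarith [h.2], zero_mul]
      exact contDiffAt_const.congr_of_eventuallyEq this
  · exact (hS.prod hcomp).of_isClosed_subset (isClosed_tsupport _) hcs
  · exact hcs.trans (prod_mono hSd (hχs.trans (Ioo_subset_Ioo ha hbT)))
  · intro x t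
    by_cases ht : t ∈ Icc a b
    · exact mul_nonneg (hχ0 t) (hf0 x t (lt_of_le_of_lt ht.2 hb'))
    · rw [hχz t ht, zero_mul]

/-! ### The test function: a frozen Gaussian with a radial cutoff -/

/-! ### Calculus of partial derivatives. -/

section PartialDerivatives

variable {f g : Plane → ℝ} {x : Plane}

lemma partialD_mul (hf : DifferentiableAt ℝ f x) (hg : DifferentiableAt ℝ g x) (j : Fin 2) :
    partialD j (fun y => f y * g y) x = partialD j f x * g x + f x * partialD j g x := by
  simp only [partialD]
  rw [fderiv_fun_mul hf hg]
  simp; ring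

lemma partialD_add (hf : DifferentiableAt ℝ f x) (hg : DifferentiableAt ℝ g x) (j : Fin 2) :
    partialD j (fun y => f y + g y) x = partialD j f x + partialD j g x := by
  simp only [partialD]
  rw [fderiv_fun_add hf hg]
  simp

lemma partialD_comp {H : ℝ → ℝ} (hH : DifferentiableAt ℝ H (f x)) (hf : DifferentiableAt ℝ f x)
    (j : Fin 2) : partialD j (fun y => H (f y)) x = deriv H (f x) * partialD j f x := by
  have h := hH.hasDerivAt.comp_hasFDerivAt x hf.hasFDerivAt
  have h' : HasFDerivAt (fun y => H (f y)) _ x := h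
  simp [partialD, h'.fderiv]

lemma contDiff_top_partialD (hf : ContDiff ℝ ∞ f) (j : Fin 2) : ContDiff ℝ ∞ (partialD j f) :=
  (hf.fderiv_right (m := ∞) (by simp)).clm_apply contDiff_const

lemma partialD_partialD_mul (hf : ContDiff ℝ ∞ f) (hg : ContDiff ℝ ∞ g) (i j : Fin 2) :
    partialD i (partialD j fun y => f y * g y) x =
      partialD i (partialD j f) x * g x + partialD j f x * partialD i g x
        + (partialD i f x * partialD j g x + f x * partialD i (partialD j g) x) := by
  have d : ∀ {h : Plane → ℝ}, ContDiff ℝ ∞ h → ∀ y, DifferentiableAt ℝ h y :=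
    fun hh y => hh.differentiable (by simp) y
  have e1 : (partialD j fun y => f y * g y) =
      fun y => partialD j f y * g y + f y * partialD j g y :=
    funext fun y => partialD_mul (d hf y) (d hg y) j
  rw [e1, partialD_add (f := fun y => partialD j f y * g y) (g := fun y => f y * partialD j g y)
    ((d (contDiff_top_partialD hf j) x).mul (d hg x))
    ((d hf x).mul (d (contDiff_top_partialD hg j) x)),
    partialD_mul (d (contDiff_top_partialD hf j) x) (d hg x),
    partialD_mul (d hf x) (d (contDiff_top_partialD hg j) x)]

lemma hasFDerivAt_coord (i : Fin 2) (x : Plane) :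
    HasFDerivAt (fun y : Plane => y i) (EuclideanSpace.proj i : Plane →L[ℝ] ℝ) x :=
  (EuclideanSpace.proj i : Plane →L[ℝ] ℝ).hasFDerivAt

lemma contDiff_coord (i : Fin 2) : ContDiff ℝ ∞ (fun y : Plane => y i) :=
  (EuclideanSpace.proj i : Plane →L[ℝ] ℝ).contDiff

lemma differentiableAt_coord (i : Fin 2) : DifferentiableAt ℝ (fun y : Plane => y i) x :=
  (hasFDerivAt_coord i x).differentiableAt

lemma partialD_coord (i j : Fin 2) : partialD j (fun y : Plane => y i) x = if i = j then 1 else 0 := by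
  rw [partialD, (hasFDerivAt_coord i x).fderiv]
  simp [e]

end PartialDerivatives

/-- The quadratic form with matrix `q`. -/
def quadForm (q : Fin 2 → Fin 2 → ℝ) (y : Plane) : ℝ :=
  q 0 0 * y 0 ^ 2 + (q 0 1 + q 1 0) * (y 0 * y 1) + q 1 1 * y 1 ^ 2

/-- The fundamental solution of the heat equation with constant coefficients, up to a factor. -/
def frozenGauss (q : Fin 2 → Fin 2 → ℝ) (s : ℝ) (y : Plane) : ℝ :=
  s⁻¹ * Real.exp (-(quadForm q y / (4 * s)))

/-- The linear form `q y`. -/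
def quadGrad (q : Fin 2 → Fin 2 → ℝ) (j : Fin 2) (y : Plane) : ℝ := q j 0 * y 0 + q j 1 * y 1

@[fun_prop]
lemma contDiff_quadForm_sub (q : Fin 2 → Fin 2 → ℝ) (x₀ : Plane) :
    ContDiff ℝ ∞ (fun x => quadForm q (x - x₀)) := by
  have h : ∀ i, ContDiff ℝ ∞ (fun y : Plane => (y - x₀) i) := fun i => by
    simpa using (contDiff_coord i).sub contDiff_const
  unfold quadForm
  exact ((contDiff_const.mul ((h 0).pow 2)).add (contDiff_const.mul ((h 0).mul (h 1)))).add
    (contDiff_const.mul ((h 1).pow 2))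

lemma contDiff_frozenGauss_sub (q : Fin 2 → Fin 2 → ℝ) (s : ℝ) (x₀ : Plane) :
    ContDiff ℝ ∞ (fun x => frozenGauss q s (x - x₀)) :=
  contDiff_const.mul (((contDiff_quadForm_sub q x₀).div_const _).neg.exp)

lemma partialD_quadForm {q : Fin 2 → Fin 2 → ℝ} (hq : q 0 1 = q 1 0) (x₀ x : Plane) (j : Fin 2) :
    partialD j (fun x => quadForm q (x - x₀)) x = 2 * quadGrad q j (x - x₀) := by
  have h : ∀ i, HasFDerivAt (fun y : Plane => (y - x₀) i) (EuclideanSpace.proj i : Plane →L[ℝ] ℝ) x :=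
    fun i => by simpa using (hasFDerivAt_coord i x).sub_const (x₀ i)
  have h2 := ((((h 0).pow 2).const_mul (q 0 0)).add
    (((h 0).mul (h 1)).const_mul (q 0 1 + q 1 0))).add (((h 1).pow 2).const_mul (q 1 1))
  have h3 : HasFDerivAt (fun x => quadForm q (x - x₀)) _ x := h2
  rw [partialD, h3.fderiv, quadGrad]
  fin_cases j <;> simp [e, hq] <;> ring

lemma partialD_quadGrad (q : Fin 2 → Fin 2 → ℝ) (x₀ x : Plane) (i j : Fin 2) :
    partialD i (fun x => quadGrad q j (x - x₀)) x = q j i := by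
  have h : ∀ i, HasFDerivAt (fun y : Plane => (y - x₀) i) (EuclideanSpace.proj i : Plane →L[ℝ] ℝ) x :=
    fun i => by simpa using (hasFDerivAt_coord i x).sub_const (x₀ i)
  have h2 := ((h 0).const_mul (q j 0)).add ((h 1).const_mul (q j 1))
  have h3 : HasFDerivAt (fun x => quadGrad q j (x - x₀)) _ x := h2
  rw [partialD, h3.fderiv]
  fin_cases i <;> simp [e]

lemma differentiable_quadGrad_sub (q : Fin 2 → Fin 2 → ℝ) (x₀ : Plane) (j : Fin 2) :
    Differentiable ℝ (fun x => quadGrad q j (x - x₀)) := by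
  have h : ∀ i, Differentiable ℝ (fun y : Plane => (y - x₀) i) := fun i x => by
    simpa using ((hasFDerivAt_coord i x).sub_const (x₀ i)).differentiableAt
  unfold quadGrad
  exact ((h 0).const_mul _).add ((h 1).const_mul _)

lemma partialD_frozenGauss {q : Fin 2 → Fin 2 → ℝ} (hq : q 0 1 = q 1 0) (s : ℝ) (x₀ : Plane)
    (j : Fin 2) : partialD j (fun x => frozenGauss q s (x - x₀)) =
      fun x => (-(1 / (2 * s)) * quadGrad q j (x - x₀)) * frozenGauss q s (x - x₀) := by
  ext x
  have hd := (contDiff_quadForm_sub q x₀).differentiable (by simp) x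
  have h1 : HasFDerivAt (fun x => frozenGauss q s (x - x₀)) _ x :=
    ((hd.hasFDerivAt.mul_const (4 * s)⁻¹).neg.exp).const_mul s⁻¹
  have h2 := partialD_quadForm hq x₀ x j
  rw [partialD] at h2
  rw [partialD, h1.fderiv]
  simp only [smul_apply, neg_apply, smul_eq_mul, h2,
    frozenGauss, div_eq_mul_inv, Pi.neg_apply]
  rw [mul_inv, mul_inv]
  ring

lemma partialD_partialD_frozenGauss {q : Fin 2 → Fin 2 → ℝ} (hq : q 0 1 = q 1 0) (s : ℝ)
    (x₀ x : Plane) (i j : Fin 2) :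
    partialD i (partialD j (fun x => frozenGauss q s (x - x₀))) x =
      (-(q j i / (2 * s)) + quadGrad q i (x - x₀) * quadGrad q j (x - x₀) / (4 * s ^ 2))
        * frozenGauss q s (x - x₀) := by
  rw [partialD_frozenGauss hq, partialD_mul
    ((differentiable_quadGrad_sub q x₀ j x).const_mul _)
    ((contDiff_frozenGauss_sub q s x₀).differentiable (by simp) x), partialD_const_mul,
    partialD_frozenGauss hq]
  simp only [partialD_quadGrad, div_eq_mul_inv, mul_inv, inv_pow]
  ring

lemma hasDerivAt_frozenGauss (q : Fin 2 → Fin 2 → ℝ) (y : Plane) {s : ℝ} (hs : s ≠ 0) :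
    HasDerivAt (fun s => frozenGauss q s y)
      ((-(1 / s) + quadForm q y / (4 * s ^ 2)) * frozenGauss q s y) s := by
  have h1 := hasDerivAt_inv hs
  have h2 : HasDerivAt (fun s : ℝ => -(quadForm q y / 4 * s⁻¹)) _ s :=
    (h1.const_mul (quadForm q y / 4)).neg
  have h3 := h1.mul h2.exp
  have e1 : (fun s => frozenGauss q s y) =
      fun s => s⁻¹ * Real.exp (-(quadForm q y / 4 * s⁻¹)) := by
    ext s
    rw [frozenGauss, div_mul_eq_div_div, ← div_eq_mul_inv]
  rw [e1]
  refine h3.congr_deriv ?_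
  rw [congr_fun e1 s]
  field_simp

/-- The radial cutoff which is `1` where `1 - |x|² ≥ d / 2` and `0` where `1 - |x|² ≤ d / 4`. -/
def cutoff (d : ℝ) (x : Plane) : ℝ := ramp (1 / 4) (1 / 2) ((1 - ‖x‖ ^ 2) / d)

/-- The region in which the cutoff is not locally constant. -/
def transition (d : ℝ) : Set Plane := {x | d / 4 ≤ 1 - ‖x‖ ^ 2 ∧ 1 - ‖x‖ ^ 2 ≤ d / 2}

lemma measurableSet_transition (d : ℝ) : MeasurableSet (transition d) :=
  ((isClosed_le (by fun_prop) (by fun_prop)).inter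
    (isClosed_le (by fun_prop) (by fun_prop)) :
      IsClosed ({x : Plane | d / 4 ≤ 1 - ‖x‖ ^ 2} ∩ {x | 1 - ‖x‖ ^ 2 ≤ d / 2})).measurableSet

lemma contDiff_cutoffArg (d : ℝ) : ContDiff ℝ ∞ (fun x : Plane => (1 - ‖x‖ ^ 2) / d) :=
  (contDiff_const.sub (contDiff_norm_sq ℝ)).div_const _

lemma contDiff_cutoff (d : ℝ) : ContDiff ℝ ∞ (cutoff d) :=
  (contDiff_ramp _ _).comp (contDiff_cutoffArg d)

lemma cutoff_nonneg (d : ℝ) (x : Plane) : 0 ≤ cutoff d x := ramp_nonneg _ _ _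

lemma cutoff_le_one (d : ℝ) (x : Plane) : cutoff d x ≤ 1 := ramp_le_one _ _ _

lemma cutoff_eq_zero {d : ℝ} (hd : 0 < d) {x : Plane} (hx : 1 - ‖x‖ ^ 2 ≤ d / 4) :
    cutoff d x = 0 :=
  ramp_of_le (by norm_num) (by rw [div_le_iff₀ hd]; linarith)

lemma cutoff_eq_one {d : ℝ} (hd : 0 < d) {x : Plane} (hx : d / 2 ≤ 1 - ‖x‖ ^ 2) :
    cutoff d x = 1 :=
  ramp_of_ge (by norm_num) (by rw [le_div_iff₀ hd]; linarith)

lemma partialD_cutoffArg (d : ℝ) (j : Fin 2) (x : Plane) :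
    partialD j (fun x : Plane => (1 - ‖x‖ ^ 2) / d) x = (-(2 / d)) * x j := by
  have h2 := ((((hasFDerivAt_coord 0 x).pow 2).add ((hasFDerivAt_coord 1 x).pow 2)).const_sub
    1).mul_const d⁻¹
  have e1 : (fun x : Plane => (1 - ‖x‖ ^ 2) / d) = fun x => (1 - (x 0 ^ 2 + x 1 ^ 2)) * d⁻¹ := by
    ext x; rw [norm_sq_plane, div_eq_mul_inv]
  have h3 : HasFDerivAt (fun x : Plane => (1 - (x 0 ^ 2 + x 1 ^ 2)) * d⁻¹) _ x := h2
  rw [e1, partialD, h3.fderiv]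
  fin_cases j <;> simp [e] <;> ring

lemma partialD_cutoff (d : ℝ) (j : Fin 2) :
    partialD j (cutoff d) = fun x => deriv (ramp (1 / 4) (1 / 2)) ((1 - ‖x‖ ^ 2) / d) *
      ((-(2 / d)) * x j) := by
  ext x
  unfold cutoff
  rw [partialD_comp ((contDiff_ramp _ _).differentiable (by simp) _)
    ((contDiff_cutoffArg d).differentiable (by simp) x), partialD_cutoffArg]

lemma contDiff_deriv_ramp (α β : ℝ) : ContDiff ℝ ∞ (deriv (ramp α β)) := by
  have h : ContDiff ℝ ((∞ : ℕ∞ω) + 1) (ramp α β) := by simpa using contDiff_ramp α β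
  exact (contDiff_succ_iff_deriv.1 h).2.2

lemma partialD_partialD_cutoff (d : ℝ) (i j : Fin 2) (x : Plane) :
    partialD i (partialD j (cutoff d)) x =
      deriv (deriv (ramp (1 / 4) (1 / 2))) ((1 - ‖x‖ ^ 2) / d) * (4 / d ^ 2 * (x i * x j)) -
      deriv (ramp (1 / 4) (1 / 2)) ((1 - ‖x‖ ^ 2) / d) * (2 / d * if j = i then 1 else 0) := by
  rw [partialD_cutoff, partialD_mul, partialD_comp, partialD_cutoffArg, partialD_const_mul]
  · simp only [partialD_coord, div_eq_mul_inv, inv_pow]; ring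
  · exact (contDiff_deriv_ramp _ _).differentiable (by simp) _
  · exact (contDiff_cutoffArg d).differentiable (by simp) x
  · exact ((contDiff_deriv_ramp _ _).comp (contDiff_cutoffArg d)).differentiable (by simp) x
  · exact (differentiableAt_coord j).const_mul _

/-- Bounds for the first two derivatives of the cutoff profile. -/
lemma exists_bound_deriv_ramp : ∃ Z : ℝ, 0 < Z ∧ ∀ u,
    |deriv (ramp (1 / 4) (1 / 2)) u| ≤ Z ∧ |deriv (deriv (ramp (1 / 4) (1 / 2))) u| ≤ Z := by
  have h1 : HasCompactSupport (deriv (ramp (1 / 4) (1 / 2))) :=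
    HasCompactSupport.intro isCompact_Icc fun t ht => deriv_ramp_eq_zero (by norm_num) ht
  obtain ⟨Z₁, hZ₁⟩ := h1.exists_bound_of_continuous (contDiff_deriv_ramp _ _).continuous
  obtain ⟨Z₂, hZ₂⟩ := h1.deriv.exists_bound_of_continuous
    ((contDiff_deriv_ramp _ _).continuous_deriv (by simp))
  refine ⟨max 1 (max Z₁ Z₂), by positivity, fun u => ⟨?_, ?_⟩⟩
  · exact (hZ₁ u).trans ((le_max_left _ _).trans (le_max_right _ _))
  · exact (hZ₂ u).trans ((le_max_right _ _).trans (le_max_right _ _))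

lemma deriv_deriv_ramp_eq_zero {α β : ℝ} (h : α < β) {t : ℝ} (ht : t ∉ Icc α β) :
    deriv (deriv (ramp α β)) t = 0 := by
  have : deriv (ramp α β) =ᶠ[nhds t] fun _ => 0 :=
    Filter.eventually_of_mem (isClosed_Icc.isOpen_compl.mem_nhds ht)
      fun s hs => deriv_ramp_eq_zero h hs
  rw [this.deriv_eq]; simp

lemma mem_transition_iff {d : ℝ} (hd : 0 < d) (x : Plane) :
    x ∈ transition d ↔ (1 - ‖x‖ ^ 2) / d ∈ Icc (1 / 4 : ℝ) (1 / 2) := by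
  rw [transition, mem_ofPred_eq, mem_Icc, le_div_iff₀ hd, div_le_iff₀ hd]
  constructor <;> rintro ⟨h1, h2⟩ <;> constructor <;> linarith

/-- The test function. -/
def testFn (𝒞 : Coefficients) (x₀ : Plane) (t₀ : ℝ) (x : Plane) (t : ℝ) : ℝ :=
  cutoff (1 - ‖x₀‖ ^ 2) x * frozenGauss (fun i j => 𝒞.q i j x₀) (t₀ - t) (x - x₀)

lemma contDiffOn_testFn (𝒞 : Coefficients) (x₀ : Plane) (t₀ : ℝ) :
    ContDiffOn ℝ ∞ (fun z : Plane × ℝ => testFn 𝒞 x₀ t₀ z.1 z.2) (univ ×ˢ Iio t₀) := by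
  have h0 : ∀ z ∈ (univ : Set Plane) ×ˢ Iio t₀, t₀ - z.2 ≠ 0 := fun z hz => by
    have : z.2 < t₀ := hz.2
    intro h; linarith
  have h1 : ContDiffOn ℝ ∞ (fun z : Plane × ℝ => t₀ - z.2) (univ ×ˢ Iio t₀) := by fun_prop
  have h2 : ContDiffOn ℝ ∞ (fun z : Plane × ℝ => (t₀ - z.2)⁻¹) (univ ×ˢ Iio t₀) := h1.inv h0
  unfold testFn frozenGauss
  refine ((contDiff_cutoff _).comp contDiff_fst).contDiffOn.mul (h2.mul ?_)
  have h3 : ContDiffOn ℝ ∞ (fun z : Plane × ℝ => quadForm (fun i j => 𝒞.q i j x₀) (z.1 - x₀))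
      (univ ×ˢ Iio t₀) :=
    ((contDiff_quadForm_sub (fun i j => 𝒞.q i j x₀) x₀).comp contDiff_fst).contDiffOn
  exact ((h3.div (contDiffOn_const.mul h1) fun z hz => mul_ne_zero (by norm_num) (h0 z hz)).neg).exp

lemma abs_coord_le (y : Plane) (i : Fin 2) : |y i| ≤ ‖y‖ := by
  simpa using PiLp.norm_apply_le y i

/-! ### Frozen Gaussians for quadratic forms close to the identity. -/

section NearIdentity

variable {q : Fin 2 → Fin 2 → ℝ}

lemma le_quadForm (hq : ∀ i j, |q i j - if i = j then 1 else 0| ≤ 1 / 10) (y : Plane) :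
    4 / 5 * ‖y‖ ^ 2 ≤ quadForm q y := by
  have h00 := abs_le.1 (hq 0 0)
  have h01 := abs_le.1 (hq 0 1)
  have h10 := abs_le.1 (hq 1 0)
  have h11 := abs_le.1 (hq 1 1)
  simp at h00 h01 h10 h11
  rw [norm_sq_plane, quadForm]
  nlinarith [sq_nonneg (y 0 + y 1), sq_nonneg (y 0 - y 1), sq_nonneg (y 0), sq_nonneg (y 1)]

lemma quadForm_le (hq : ∀ i j, |q i j - if i = j then 1 else 0| ≤ 1 / 10) (y : Plane) :
    quadForm q y ≤ 6 / 5 * ‖y‖ ^ 2 := by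
  have h00 := abs_le.1 (hq 0 0)
  have h01 := abs_le.1 (hq 0 1)
  have h10 := abs_le.1 (hq 1 0)
  have h11 := abs_le.1 (hq 1 1)
  simp at h00 h01 h10 h11
  rw [norm_sq_plane, quadForm]
  nlinarith [sq_nonneg (y 0 + y 1), sq_nonneg (y 0 - y 1), sq_nonneg (y 0), sq_nonneg (y 1)]

lemma abs_quadGrad_le (hq : ∀ i j, |q i j - if i = j then 1 else 0| ≤ 1 / 10) (j : Fin 2)
    (y : Plane) : |quadGrad q j y| ≤ 2 * ‖y‖ := by
  have h0 := abs_coord_le y 0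
  have h1 := abs_coord_le y 1
  have hn := norm_nonneg y
  have key : ∀ {c d : ℝ}, |c - 1| ≤ 1 / 10 → |d| ≤ 1 / 10 → |c * y 0 + d * y 1| ≤ 2 * ‖y‖ ∧
      |d * y 0 + c * y 1| ≤ 2 * ‖y‖ := by
    intro c d hc hd
    have hc' : |c| ≤ 11 / 10 := by rw [abs_le] at hc ⊢; constructor <;> linarith
    constructor
    all_goals
      refine (abs_add_le _ _).trans ?_
      rw [abs_mul, abs_mul]
      nlinarith [abs_nonneg c, abs_nonneg d, abs_nonneg (y 0), abs_nonneg (y 1)]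
  have h00 := hq 0 0
  have h01 := hq 0 1
  have h10 := hq 1 0
  have h11 := hq 1 1
  simp only [if_true, Fin.isValue, zero_ne_one, one_ne_zero, if_false, sub_zero] at h00 h01 h10 h11
  unfold quadGrad
  fin_cases j
  · exact (key h00 h01).1
  · exact (key h11 h10).2

lemma frozenGauss_nonneg (q : Fin 2 → Fin 2 → ℝ) {s : ℝ} (hs : 0 ≤ s) (y : Plane) :
    0 ≤ frozenGauss q s y := by
  unfold frozenGauss; positivity

/-- The form is at least `4/5 |y|²`, so the exponent is at least `|y|² / (5 s)`, and `1/5 - 1/8 =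
3/40`. The wider kernel thus leaves a spare Gaussian factor, and it no longer depends on the frozen
matrix, so that one semigroup serves all `x₀`. -/
lemma frozenGauss_le (hq : ∀ i j, |q i j - if i = j then 1 else 0| ≤ 1 / 10) {s : ℝ}
    (hs : 0 < s) (y : Plane) :
    frozenGauss q s y ≤ gaussKernel s y * Real.exp (-(3 / 40 * (‖y‖ ^ 2 / s))) := by
  unfold frozenGauss gaussKernel
  rw [mul_assoc, ← Real.exp_add]
  refine mul_le_mul_of_nonneg_left (Real.exp_le_exp.2 ?_) (by positivity)
  have h := div_le_div_of_nonneg_right (le_quadForm hq y) (by positivity : 0 ≤ 4 * s)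
  have e : 4 / 5 * ‖y‖ ^ 2 / (4 * s) = ‖y‖ ^ 2 / (8 * s) + 3 / 40 * (‖y‖ ^ 2 / s) := by
    field_simp; ring
  linarith

lemma frozenGauss_le_gaussKernel (hq : ∀ i j, |q i j - if i = j then 1 else 0| ≤ 1 / 10)
    {s : ℝ} (hs : 0 < s) (y : Plane) : frozenGauss q s y ≤ gaussKernel s y := by
  refine (frozenGauss_le hq hs y).trans (mul_le_of_le_one_right (gaussKernel_nonneg hs.le _)
    (Real.exp_le_one_iff.2 ?_))
  have : 0 ≤ 3 / 40 * (‖y‖ ^ 2 / s) := by positivity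
  linarith

/-- The spare factor pays for any polynomial weight in `|y| / √s`. -/
lemma mul_frozenGauss_le (hq : ∀ i j, |q i j - if i = j then 1 else 0| ≤ 1 / 10)
    {s : ℝ} (hs : 0 < s) (y : Plane) {p C : ℝ} (hp : 0 ≤ p)
    (h : p ≤ C * Real.exp (3 / 40 * (‖y‖ ^ 2 / s))) :
    p * frozenGauss q s y ≤ C * gaussKernel s y := by
  calc p * frozenGauss q s y
      ≤ p * (gaussKernel s y * Real.exp (-(3 / 40 * (‖y‖ ^ 2 / s)))) :=
        mul_le_mul_of_nonneg_left (frozenGauss_le hq hs y) hp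
    _ ≤ (C * Real.exp (3 / 40 * (‖y‖ ^ 2 / s))) *
        (gaussKernel s y * Real.exp (-(3 / 40 * (‖y‖ ^ 2 / s)))) :=
        mul_le_mul_of_nonneg_right h
          (mul_nonneg (gaussKernel_nonneg hs.le _) (Real.exp_pos _).le)
    _ = C * gaussKernel s y := by
        rw [Real.exp_neg]
        field_simp

lemma cubic_mul_frozenGauss_le (hq : ∀ i j, |q i j - if i = j then 1 else 0| ≤ 1 / 10)
    {s : ℝ} (hs : 0 < s) (y : Plane) :
    (5 * (‖y‖ / s) + 4 * (‖y‖ ^ 3 / s ^ 2)) * frozenGauss q s y ≤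
      3200 * (√s)⁻¹ * gaussKernel s y := by
  refine mul_frozenGauss_le hq hs y (by positivity) ?_
  set σ := √s with hσ
  have hσ0 : 0 < σ := Real.sqrt_pos.2 hs
  have e : s = σ ^ 2 := (Real.sq_sqrt hs.le).symm
  -- In the parabolic variable `r = |y| / √s` the weight is `(5 r + 4 r³) / √s`, and the quadratic
  -- Taylor polynomial of the exponential dominates the bracket.
  set r := ‖y‖ / σ with hr
  have hr0 : 0 ≤ r := by positivity
  have e1 : 5 * (‖y‖ / s) + 4 * (‖y‖ ^ 3 / s ^ 2) = (5 * r + 4 * r ^ 3) * σ⁻¹ := by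
    rw [e, hr]; field_simp
  have e2 : ‖y‖ ^ 2 / s = r ^ 2 := by rw [e, hr, div_pow]
  rw [e1, e2, mul_right_comm]
  refine mul_le_mul_of_nonneg_right ?_ (by positivity)
  have h := Real.quadratic_le_exp_of_nonneg (x := 3 / 40 * r ^ 2) (by positivity)
  have h2 : 0 ≤ r * (r - 1) ^ 2 := by positivity
  nlinarith [sq_nonneg (r ^ 2 - r), sq_nonneg (r - 1), sq_nonneg (r ^ 2), sq_nonneg r]

lemma quadratic_mul_frozenGauss_le (hq : ∀ i j, |q i j - if i = j then 1 else 0| ≤ 1 / 10)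
    {s : ℝ} (hs : 0 < s) (y : Plane) :
    (1 + ‖y‖ ^ 2 / s) * frozenGauss q s y ≤ 14 * gaussKernel s y := by
  refine mul_frozenGauss_le hq hs y (by positivity) ?_
  have h0 : 0 ≤ ‖y‖ ^ 2 / s := by positivity
  have h := Real.add_one_le_exp (3 / 40 * (‖y‖ ^ 2 / s))
  linarith

end NearIdentity

lemma deriv_testFn (𝒞 : Coefficients) (x₀ x : Plane) {t₀ t : ℝ} (ht : t < t₀) :
    deriv (testFn 𝒞 x₀ t₀ x) t = -(cutoff (1 - ‖x₀‖ ^ 2) x *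
      ((-(1 / (t₀ - t)) + quadForm (fun i j => 𝒞.q i j x₀) (x - x₀) / (4 * (t₀ - t) ^ 2)) *
        frozenGauss (fun i j => 𝒞.q i j x₀) (t₀ - t) (x - x₀))) := by
  have h1 := hasDerivAt_frozenGauss (fun i j => 𝒞.q i j x₀) (x - x₀) (s := t₀ - t)
    (by intro h; linarith)
  have h2 : HasDerivAt (fun t => t₀ - t) (-1) t := by
    simpa using (hasDerivAt_id t).const_sub t₀
  have h3 := (h1.comp t h2).const_mul (cutoff (1 - ‖x₀‖ ^ 2) x)
  have h4 : HasDerivAt (testFn 𝒞 x₀ t₀ x) _ t := h3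
  rw [h4.deriv]
  ring

/-- The terms of `L (η Φ)` in which the cutoff `η` is differentiated. -/
def cutoffTerms (𝒞 : Coefficients) (η Φ : Plane → ℝ) (x : Plane) : ℝ :=
  ∑ i, ∑ j, 𝒞.a i j x * (partialD i (partialD j η) x * Φ x + partialD j η x * partialD i Φ x
    + partialD i η x * partialD j Φ x) + ∑ j, 𝒞.b j x * (partialD j η x * Φ x)

lemma Coefficients.op_mul (𝒞 : Coefficients) {η Φ : Plane → ℝ} (hη : ContDiff ℝ ∞ η)
    (hΦ : ContDiff ℝ ∞ Φ) (x : Plane) :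
    𝒞.op (fun y => η y * Φ y) x = η x * 𝒞.op Φ x + cutoffTerms 𝒞 η Φ x := by
  simp only [Coefficients.op, cutoffTerms, partialD_partialD_mul hη hΦ,
    partialD_mul (hη.differentiable (by simp) x) (hΦ.differentiable (by simp) x),
    Fin.sum_univ_two]
  ring

/-- The Gaussian solves the heat equation with coefficients frozen at `x₀` exactly. The remainder
contains `a(x) - a(x₀)`, of size `K |y|`, against second derivatives of order `1/s + |y|²/s²`, and
the drift against first derivatives of order `|y|/s`. In terms of the wider kernel both are of order
`K s^(-1/2)`, an integrable singularity. -/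
lemma op_frozenGauss_sub_le {𝒞 : Coefficients} {K : ℝ} (h𝒞 : 𝒞.NearlyFlat K)
    {x₀ x : Plane} (hx₀ : x₀ ∈ Metric.closedBall (0 : Plane) 1)
    (hx : x ∈ Metric.closedBall (0 : Plane) 1) {s : ℝ} (hs : 0 < s) :
    |𝒞.op (fun x => frozenGauss (fun i j => 𝒞.q i j x₀) s (x - x₀)) x -
      (-(1 / s) + quadForm (fun i j => 𝒞.q i j x₀) (x - x₀) / (4 * s ^ 2)) *
        frozenGauss (fun i j => 𝒞.q i j x₀) s (x - x₀)| ≤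
      3200 * K * (√s)⁻¹ * gaussKernel s (x - x₀) := by
  set q : Fin 2 → Fin 2 → ℝ := fun i j => 𝒞.q i j x₀ with hq
  have hq1 : ∀ i j, |q i j - if i = j then 1 else 0| ≤ 1 / 10 := fun i j => h𝒞.q_near i j x₀ hx₀
  have hqs : q 0 1 = q 1 0 := h𝒞.symm_q 0 1 x₀ hx₀
  set y := x - x₀ with hy
  set Φ := frozenGauss q s y with hΦ
  have hΦ0 : 0 ≤ Φ := frozenGauss_nonneg q hs.le y
  have hK : 0 ≤ K := (abs_nonneg _).trans (h𝒞.drift 0 x hx)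
  set G : Fin 2 → ℝ := fun j => quadGrad q j y with hG
  have hG1 : ∀ j, |G j| ≤ 2 * ‖y‖ := fun j => abs_quadGrad_le hq1 j y
  have i00 : 𝒞.a 0 0 x₀ * q 0 0 + 𝒞.a 0 1 x₀ * q 1 0 = 1 := by
    simpa [Fin.sum_univ_two] using h𝒞.inv 0 0 x₀ hx₀
  have i01 : 𝒞.a 0 0 x₀ * q 0 1 + 𝒞.a 0 1 x₀ * q 1 1 = 0 := by
    simpa [Fin.sum_univ_two] using h𝒞.inv 0 1 x₀ hx₀
  have i10 : 𝒞.a 1 0 x₀ * q 0 0 + 𝒞.a 1 1 x₀ * q 1 0 = 0 := by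
    simpa [Fin.sum_univ_two] using h𝒞.inv 1 0 x₀ hx₀
  have i11 : 𝒞.a 1 0 x₀ * q 0 1 + 𝒞.a 1 1 x₀ * q 1 1 = 1 := by
    simpa [Fin.sum_univ_two] using h𝒞.inv 1 1 x₀ hx₀
  have g0 : 𝒞.a 0 0 x₀ * G 0 + 𝒞.a 0 1 x₀ * G 1 = y 0 := by
    simp only [hG, quadGrad]; linear_combination y 0 * i00 + y 1 * i01
  have g1 : 𝒞.a 1 0 x₀ * G 0 + 𝒞.a 1 1 x₀ * G 1 = y 1 := by
    simp only [hG, quadGrad]; linear_combination y 0 * i10 + y 1 * i11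
  have hQ : quadForm q y = G 0 * y 0 + G 1 * y 1 := by
    simp only [hG, quadGrad, quadForm]; ring
  set P : Fin 2 → Fin 2 → ℝ := fun i j => -(q j i / (2 * s)) + G i * G j / (4 * s ^ 2) with hP
  -- Contracting `P` with `a(x₀)` gives the subtracted factor: `a(x₀) q = 1` has trace `2`, which
  -- yields `-1/s`, and `a(x₀) q y = y` yields the quadratic form.
  have key : 𝒞.op (fun x => frozenGauss q s (x - x₀)) x -
      (-(1 / s) + quadForm q y / (4 * s ^ 2)) * Φ =
      (∑ i, ∑ j, (𝒞.a i j x - 𝒞.a i j x₀) * P i j + ∑ j, 𝒞.b j x * (-(1 / (2 * s)) * G j)) * Φ := by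
    simp only [Coefficients.op, partialD_partialD_frozenGauss hqs]
    simp only [partialD_frozenGauss hqs, Fin.sum_univ_two, hP, ← hy]
    rw [hQ]
    have e1 : -(1 / s) = -((𝒞.a 0 0 x₀ * q 0 0 + 𝒞.a 0 1 x₀ * q 1 0) +
      (𝒞.a 1 0 x₀ * q 0 1 + 𝒞.a 1 1 x₀ * q 1 1)) / (2 * s) := by
      rw [i00, i11]; field_simp; norm_num
    rw [e1, ← g0, ← g1]
    ring
  have hPb : ∀ i j, |P i j| ≤ 11 / 20 / s + ‖y‖ ^ 2 / s ^ 2 := by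
    intro i j
    have h1 : |q j i| ≤ 11 / 10 := by
      have := abs_le.1 (hq1 j i)
      rw [abs_le]
      split_ifs at this <;> constructor <;> linarith
    refine (abs_add_le _ _).trans (add_le_add ?_ ?_)
    · rw [abs_neg, abs_div, abs_of_pos (by positivity : 0 < 2 * s), div_le_div_iff₀ (by positivity)
        hs]
      nlinarith
    · rw [abs_div, abs_of_pos (by positivity : 0 < 4 * s ^ 2), abs_mul,
        div_le_div_iff₀ (by positivity) (by positivity)]
      have h2 : |G i| * |G j| ≤ (2 * ‖y‖) * (2 * ‖y‖) :=
        mul_le_mul (hG1 i) (hG1 j) (abs_nonneg _) (by positivity)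
      nlinarith [sq_nonneg s]
  have hterm : ∀ i j, |(𝒞.a i j x - 𝒞.a i j x₀) * P i j| ≤
      K * ‖y‖ * (11 / 20 / s + ‖y‖ ^ 2 / s ^ 2) := fun i j => by
    rw [abs_mul]
    exact mul_le_mul (h𝒞.lipschitz i j x hx x₀ hx₀) (hPb i j) (abs_nonneg _) (by positivity)
  have hbterm : ∀ j, |𝒞.b j x * (-(1 / (2 * s)) * G j)| ≤ K * (‖y‖ / s) := fun j => by
    rw [abs_mul]
    refine mul_le_mul (h𝒞.drift j x hx) ?_ (abs_nonneg _) hK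
    rw [abs_mul, abs_neg, abs_of_pos (by positivity : 0 < 1 / (2 * s))]
    have := hG1 j
    rw [one_div_mul_eq_div, div_le_div_iff₀ (by positivity) hs]
    nlinarith
  have hsum : |∑ i, ∑ j, (𝒞.a i j x - 𝒞.a i j x₀) * P i j +
      ∑ j, 𝒞.b j x * (-(1 / (2 * s)) * G j)| ≤
      K * (5 * (‖y‖ / s) + 4 * (‖y‖ ^ 3 / s ^ 2)) := by
    simp only [Fin.sum_univ_two]
    have e1 : K * ‖y‖ * (11 / 20 / s + ‖y‖ ^ 2 / s ^ 2) =
      11 / 20 * (K * (‖y‖ / s)) + K * (‖y‖ ^ 3 / s ^ 2) := by ring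
    have hn : 0 ≤ K * (‖y‖ / s) := by positivity
    have t00 := abs_le.1 (hterm 0 0)
    have t01 := abs_le.1 (hterm 0 1)
    have t10 := abs_le.1 (hterm 1 0)
    have t11 := abs_le.1 (hterm 1 1)
    have b0 := abs_le.1 (hbterm 0)
    have b1 := abs_le.1 (hbterm 1)
    rw [e1] at t00 t01 t10 t11
    rw [abs_le]
    constructor <;> linarith [t00.1, t00.2, t01.1, t01.2, t10.1, t10.2, t11.1, t11.2,
      b0.1, b0.2, b1.1, b1.2]
  rw [key, abs_mul, abs_of_nonneg hΦ0]
  refine (mul_le_mul_of_nonneg_right hsum hΦ0).trans ?_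
  have := mul_le_mul_of_nonneg_left (cubic_mul_frozenGauss_le hq1 hs y) hK
  calc _ = K * ((5 * (‖y‖ / s) + 4 * (‖y‖ ^ 3 / s ^ 2)) * frozenGauss q s y) := by
        rw [hΦ]; ring
    _ ≤ _ := this
    _ = _ := by ring

lemma cutoffTerms_eq_zero (𝒞 : Coefficients) {d : ℝ} (hd : 0 < d) (Φ : Plane → ℝ) {x : Plane}
    (hx : x ∉ transition d) : cutoffTerms 𝒞 (cutoff d) Φ x = 0 := by
  rw [mem_transition_iff hd] at hx
  simp only [cutoffTerms, partialD_partialD_cutoff]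
  simp [partialD_cutoff, -one_div,
    deriv_ramp_eq_zero (by norm_num : (1 / 4 : ℝ) < 1 / 2) hx,
    deriv_deriv_ramp_eq_zero (by norm_num : (1 / 4 : ℝ) < 1 / 2) hx]

/-- There `|x|² - |x₀|² ≥ d/2` with `d = 1 - |x₀|²`, and `|x| + |x₀| ≤ 2`. -/
lemma le_norm_sub_of_mem_transition {x₀ x : Plane} (hx₀ : x₀ ∈ disc)
    (hx : x ∈ transition (1 - ‖x₀‖ ^ 2)) (hx1 : ‖x‖ ≤ 1) : (1 - ‖x₀‖ ^ 2) / 4 ≤ ‖x - x₀‖ := by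
  have h0 : ‖x₀‖ < 1 := by simpa using hx₀
  have h1 := hx.2
  have h2 : ‖x‖ ≤ ‖x₀‖ + ‖x - x₀‖ := by
    calc ‖x‖ = ‖x₀ + (x - x₀)‖ := by congr 1; abel
      _ ≤ _ := norm_add_le _ _
  nlinarith [norm_nonneg x, norm_nonneg x₀, norm_nonneg (x - x₀)]

/-- The cutoff lives at scale `d`, so two derivatives on it cost `d⁻²`. The point is that no
negative power of `s` appears: a derivative of the Gaussian is paid for by the distance between `x₀`
and the transition region. -/
lemma exists_cutoffTerms_le : ∃ C : ℝ, 0 < C ∧ ∀ (𝒞 : Coefficients) (K : ℝ), 𝒞.NearlyFlat K →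
    K ≤ 1 → ∀ x₀ ∈ disc, ∀ x ∈ disc, ∀ s : ℝ, 0 < s → x ∈ transition (1 - ‖x₀‖ ^ 2) →
    |cutoffTerms 𝒞 (cutoff (1 - ‖x₀‖ ^ 2))
      (fun x => frozenGauss (fun i j => 𝒞.q i j x₀) s (x - x₀)) x| ≤
      C * ((1 - ‖x₀‖ ^ 2) ^ 2)⁻¹ * gaussKernel s (x - x₀) := by
  obtain ⟨Z, hZ, hZb⟩ := exists_bound_deriv_ramp
  refine ⟨100 * Z * 14, by positivity, fun 𝒞 K h𝒞 hK1 x₀ hx₀ x hx s hs htr => ?_⟩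
  have hx₀' := Metric.ball_subset_closedBall hx₀
  have hx' := Metric.ball_subset_closedBall hx
  set q : Fin 2 → Fin 2 → ℝ := fun i j => 𝒞.q i j x₀ with hq
  have hq1 : ∀ i j, |q i j - if i = j then 1 else 0| ≤ 1 / 10 := fun i j => h𝒞.q_near i j x₀ hx₀'
  have hqs : q 0 1 = q 1 0 := h𝒞.symm_q 0 1 x₀ hx₀'
  have hn0 : ‖x₀‖ < 1 := by simpa using hx₀
  have hn : ‖x‖ ≤ 1 := by simpa using hx'
  have hdist := le_norm_sub_of_mem_transition hx₀ htr hn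
  set d := 1 - ‖x₀‖ ^ 2 with hd
  have hd0 : 0 < d := by nlinarith [norm_nonneg x₀]
  have hd1 : d ≤ 1 := by nlinarith [norm_nonneg x₀]
  set y := x - x₀ with hy
  have hdi : 1 ≤ d⁻¹ := (one_le_inv₀ hd0).2 hd1
  set D := d⁻¹ with hD
  have hDd : D * d = 1 := inv_mul_cancel₀ hd0.ne'
  set η1 : Fin 2 → ℝ := fun j => partialD j (cutoff d) x with hη1
  set η2 : Fin 2 → Fin 2 → ℝ := fun i j => partialD i (partialD j (cutoff d)) x with hη2
  have hc : ∀ i, |x i| ≤ 1 := fun i => (abs_coord_le x i).trans hn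
  have b1 : ∀ j, |η1 j| ≤ 2 * Z * D := fun j => by
    simp only [hη1, partialD_cutoff]
    rw [abs_mul, abs_mul, abs_neg, abs_of_pos (by positivity : 0 < 2 / d), div_eq_mul_inv 2 d, ← hD]
    have h1 := (hZb ((1 - ‖x‖ ^ 2) / d)).1
    calc _ ≤ Z * (2 * D * 1) := by
          refine mul_le_mul h1 (mul_le_mul_of_nonneg_left (hc j) (by positivity)) (by positivity)
            hZ.le
      _ = _ := by ring
  have b2 : ∀ i j, |η2 i j| ≤ 6 * Z * D ^ 2 := fun i j => by
    simp only [hη2, partialD_partialD_cutoff]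
    have h1 := (hZb ((1 - ‖x‖ ^ 2) / d)).1
    have h2 := (hZb ((1 - ‖x‖ ^ 2) / d)).2
    have h3 : |4 / d ^ 2 * (x i * x j)| ≤ 4 * D ^ 2 := by
      rw [abs_mul, abs_mul, abs_of_pos (by positivity : 0 < 4 / d ^ 2), div_eq_mul_inv, ← inv_pow,
        ← hD]
      exact mul_le_of_le_one_right (by positivity) (mul_le_one₀ (hc i) (abs_nonneg _) (hc j))
    have h4 : |2 / d * if j = i then (1 : ℝ) else 0| ≤ 2 * D ^ 2 := by
      rw [div_eq_mul_inv, ← hD]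
      split_ifs
      · rw [mul_one, abs_of_pos (by positivity)]; nlinarith
      · simp; positivity
    calc _ ≤ Z * (4 * D ^ 2) + Z * (2 * D ^ 2) := by
          refine (abs_sub _ _).trans (add_le_add ?_ ?_) <;> rw [abs_mul]
          · exact mul_le_mul h2 h3 (abs_nonneg _) hZ.le
          · exact mul_le_mul h1 h4 (abs_nonneg _) hZ.le
      _ = _ := by ring
  set Φ := frozenGauss q s y with hΦ
  have hΦ0 : 0 ≤ Φ := frozenGauss_nonneg q hs.le y
  set Φ1 : Fin 2 → ℝ := fun j => partialD j (fun x => frozenGauss q s (x - x₀)) x with hΦ1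
  -- The gradient of the Gaussian is of order `(|y| / s) Φ`. Since `1 ≤ 4 D |y|` in the transition
  -- region, one more factor `D |y|` turns `|y| / s` into the scale-invariant `|y|² / s`.
  have b3 : ∀ j, D * |Φ1 j| ≤ 4 * D ^ 2 * (‖y‖ ^ 2 / s) * Φ := fun j => by
    simp only [hΦ1, partialD_frozenGauss hqs]
    rw [abs_mul, abs_mul, abs_neg, abs_of_pos (by positivity : 0 < 1 / (2 * s)), ← hy, ← hΦ,
      abs_of_nonneg hΦ0, ← mul_assoc]
    refine mul_le_mul_of_nonneg_right ?_ hΦ0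
    have h1 := abs_quadGrad_le hq1 j y
    calc D * (1 / (2 * s) * |quadGrad q j y|) ≤ D * (1 / (2 * s) * (2 * ‖y‖)) := by gcongr
      _ = D * (‖y‖ / s) * 1 := by field_simp
      _ ≤ D * (‖y‖ / s) * (4 * (D * ‖y‖)) := by
          refine mul_le_mul_of_nonneg_left ?_ (by positivity)
          have : D * (d / 4) ≤ D * ‖y‖ := mul_le_mul_of_nonneg_left hdist (by positivity)
          nlinarith
      _ = _ := by ring
  have ha : ∀ i j, |𝒞.a i j x| ≤ 11 / 10 := fun i j => by
    have := abs_le.1 (h𝒞.a_near i j x hx')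
    rw [abs_le]
    split_ifs at this <;> constructor <;> linarith
  set r := ‖y‖ ^ 2 / s with hr
  have hr0 : 0 ≤ r := by positivity
  have t1 : ∀ i j, |𝒞.a i j x * (η2 i j * Φ + η1 j * Φ1 i + η1 i * Φ1 j)| ≤
      11 / 10 * (Z * D ^ 2 * (6 + 16 * r) * Φ) := fun i j => by
    rw [abs_mul]
    refine mul_le_mul (ha i j) ?_ (abs_nonneg _) (by norm_num)
    have h1 : |η2 i j * Φ| ≤ 6 * Z * D ^ 2 * Φ := by
      rw [abs_mul, abs_of_nonneg hΦ0]; exact mul_le_mul_of_nonneg_right (b2 i j) hΦ0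
    have h2 : ∀ i j, |η1 j * Φ1 i| ≤ 8 * Z * D ^ 2 * r * Φ := fun i j => by
      rw [abs_mul]
      calc |η1 j| * |Φ1 i| ≤ 2 * Z * D * |Φ1 i| :=
            mul_le_mul_of_nonneg_right (b1 j) (abs_nonneg _)
        _ = 2 * Z * (D * |Φ1 i|) := by ring
        _ ≤ 2 * Z * (4 * D ^ 2 * r * Φ) := mul_le_mul_of_nonneg_left (b3 i) (by positivity)
        _ = _ := by ring
    calc _ ≤ |η2 i j * Φ| + |η1 j * Φ1 i| + |η1 i * Φ1 j| := abs_add_three _ _ _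
      _ ≤ 6 * Z * D ^ 2 * Φ + 8 * Z * D ^ 2 * r * Φ + 8 * Z * D ^ 2 * r * Φ :=
          add_le_add (add_le_add h1 (h2 i j)) (h2 j i)
      _ = _ := by ring
  have t2 : ∀ j, |𝒞.b j x * (η1 j * Φ)| ≤ 2 * (Z * D ^ 2 * Φ) := fun j => by
    rw [abs_mul, abs_mul, abs_of_nonneg hΦ0]
    calc |𝒞.b j x| * (|η1 j| * Φ) ≤ 1 * (2 * Z * D * Φ) :=
          mul_le_mul ((h𝒞.drift j x hx').trans hK1) (mul_le_mul_of_nonneg_right (b1 j) hΦ0)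
            (by positivity) (by norm_num)
      _ = 2 * (Z * Φ) * D := by ring
      _ ≤ 2 * (Z * Φ) * D ^ 2 := by
          refine mul_le_mul_of_nonneg_left ?_ (by positivity)
          nlinarith
      _ = _ := by ring
  have hsum : |cutoffTerms 𝒞 (cutoff d) (fun x => frozenGauss q s (x - x₀)) x| ≤
      100 * Z * D ^ 2 * ((1 + r) * Φ) := by
    simp only [cutoffTerms, Fin.sum_univ_two]
    have hpos1 : 0 ≤ Z * D ^ 2 * Φ := by positivity
    have hpos2 : 0 ≤ Z * D ^ 2 * Φ * r := by positivity
    have s00 := abs_le.1 (t1 0 0)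
    have s01 := abs_le.1 (t1 0 1)
    have s10 := abs_le.1 (t1 1 0)
    have s11 := abs_le.1 (t1 1 1)
    have u0 := abs_le.1 (t2 0)
    have u1 := abs_le.1 (t2 1)
    simp only [hη1, hη2, hΦ1] at s00 s01 s10 s11 u0 u1
    rw [abs_le]
    constructor <;> linarith [s00.1, s00.2, s01.1, s01.2, s10.1, s10.2, s11.1, s11.2, u0.1, u0.2,
      u1.1, u1.2]
  refine hsum.trans ?_
  calc _ ≤ 100 * Z * D ^ 2 * (14 * gaussKernel s y) :=
        mul_le_mul_of_nonneg_left (quadratic_mul_frozenGauss_le hq1 hs y) (by positivity)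
    _ = _ := by rw [hD, inv_pow]; ring

/-- The test function solves the adjoint equation up to a small error and a term supported in the
transition region of the cutoff. -/
lemma exists_testFn_error_le : ∃ C : ℝ, 0 < C ∧ ∀ (𝒞 : Coefficients) (K : ℝ), 𝒞.NearlyFlat K →
    K ≤ 1 → ∀ x₀ ∈ disc, ∀ x ∈ disc, ∀ t₀ t : ℝ, t < t₀ →
    |deriv (testFn 𝒞 x₀ t₀ x) t + 𝒞.op (fun y => testFn 𝒞 x₀ t₀ y t) x| ≤
      C * (K * (√(t₀ - t))⁻¹ * cutoff (1 - ‖x₀‖ ^ 2) x + ((1 - ‖x₀‖ ^ 2) ^ 2)⁻¹ *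
        (transition (1 - ‖x₀‖ ^ 2)).indicator 1 x) * gaussKernel (t₀ - t) (x₀ - x) := by
  obtain ⟨C, hC, h⟩ := exists_cutoffTerms_le
  refine ⟨3200 + C, by positivity, fun 𝒞 K h𝒞 hK1 x₀ hx₀ x hx t₀ t ht => ?_⟩
  have hs : 0 < t₀ - t := by linarith
  have hn0 : ‖x₀‖ < 1 := by simpa using hx₀
  have hd0 : 0 < 1 - ‖x₀‖ ^ 2 := by nlinarith [norm_nonneg x₀]
  have hK : 0 ≤ K := (abs_nonneg _).trans (h𝒞.drift 0 x (Metric.ball_subset_closedBall hx))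
  have h1 := op_frozenGauss_sub_le h𝒞 (Metric.ball_subset_closedBall hx₀)
    (Metric.ball_subset_closedBall hx) hs
  rw [← neg_sub x x₀, gaussKernel_neg]
  have e1 : 𝒞.op (fun y => testFn 𝒞 x₀ t₀ y t) x = _ := 𝒞.op_mul (contDiff_cutoff (1 - ‖x₀‖ ^ 2))
    (contDiff_frozenGauss_sub (fun i j => 𝒞.q i j x₀) (t₀ - t) x₀) x
  rw [deriv_testFn 𝒞 x₀ x ht, e1]
  set η := cutoff (1 - ‖x₀‖ ^ 2) x
  have hη : 0 ≤ η := cutoff_nonneg _ _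
  set k := gaussKernel (t₀ - t) (x - x₀)
  have hk : 0 ≤ k := gaussKernel_nonneg hs.le _
  have h2 : |cutoffTerms 𝒞 (cutoff (1 - ‖x₀‖ ^ 2))
      (fun x => frozenGauss (fun i j => 𝒞.q i j x₀) (t₀ - t) (x - x₀)) x| ≤
      C * ((1 - ‖x₀‖ ^ 2) ^ 2)⁻¹ * (transition (1 - ‖x₀‖ ^ 2)).indicator 1 x * k := by
    by_cases htr : x ∈ transition (1 - ‖x₀‖ ^ 2)
    · simpa [htr] using h 𝒞 K h𝒞 hK1 x₀ hx₀ x hx _ hs htr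
    · simp [htr, cutoffTerms_eq_zero 𝒞 hd0 _ htr]
  have hi : 0 ≤ (transition (1 - ‖x₀‖ ^ 2)).indicator (1 : Plane → ℝ) x :=
    indicator_nonneg (fun _ _ => zero_le_one) x
  have e2 : ∀ p r c : ℝ, -(η * p) + (η * r + c) = η * (r - p) + c := fun p r c => by ring
  rw [e2]
  refine (abs_add_le _ _).trans ((add_le_add (b := η * (3200 * K * (√(t₀ - t))⁻¹ * k)) ?_ h2).trans ?_)
  · rw [abs_mul, abs_of_nonneg hη]
    exact mul_le_mul_of_nonneg_left h1 hη
  · have p1 : 0 ≤ K * (√(t₀ - t))⁻¹ * η * k := by positivity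
    have p2 : 0 ≤ ((1 - ‖x₀‖ ^ 2) ^ 2)⁻¹ * (transition (1 - ‖x₀‖ ^ 2)).indicator 1 x * k := by
      positivity
    nlinarith

section

/-! ### The representation inequality -/

lemma one_sub_norm_sq_pos {x : Plane} (hx : x ∈ disc) : 0 < 1 - ‖x‖ ^ 2 := by
  have h0 : ‖x‖ < 1 := by simpa using hx
  nlinarith [norm_nonneg x]

lemma testFn_nonneg (𝒞 : Coefficients) (x₀ x : Plane) {t₀ t : ℝ} (ht : t ≤ t₀) :
    0 ≤ testFn 𝒞 x₀ t₀ x t :=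
  mul_nonneg (cutoff_nonneg _ _) (frozenGauss_nonneg _ (by linarith) _)

lemma testFn_le {𝒞 : Coefficients} {K : ℝ} (h𝒞 : 𝒞.NearlyFlat K) {x₀ : Plane} (hx₀ : x₀ ∈ disc)
    (x : Plane) {t₀ t : ℝ} (ht : t < t₀) :
    testFn 𝒞 x₀ t₀ x t ≤ cutoff (1 - ‖x₀‖ ^ 2) x * gaussKernel (t₀ - t) (x₀ - x) := by
  rw [← neg_sub x x₀, gaussKernel_neg]
  exact mul_le_mul_of_nonneg_left (frozenGauss_le_gaussKernel
    (fun i j => h𝒞.q_near i j x₀ (Metric.ball_subset_closedBall hx₀)) (by linarith) _)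
    (cutoff_nonneg _ _)

lemma testFn_eq_zero (𝒞 : Coefficients) {x₀ : Plane} (hx₀ : x₀ ∈ disc) {x : Plane}
    (hx : x ∉ {x : Plane | ‖x‖ ^ 2 ≤ 1 - (1 - ‖x₀‖ ^ 2) / 4}) (t₀ t : ℝ) :
    testFn 𝒞 x₀ t₀ x t = 0 := by
  rw [mem_ofPred_eq, not_le] at hx
  rw [testFn, cutoff_eq_zero (one_sub_norm_sq_pos hx₀) (by linarith), zero_mul]

lemma isCompact_norm_sq_le (c : ℝ) : IsCompact {x : Plane | ‖x‖ ^ 2 ≤ c} := by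
  refine Metric.isCompact_of_isClosed_isBounded (isClosed_le (by fun_prop) (by fun_prop)) ?_
  refine (Metric.isBounded_closedBall (x := (0 : Plane)) (r := 1 + |c|)).subset fun x hx => ?_
  rw [mem_ofPred_eq] at hx
  simp only [Metric.mem_closedBall, dist_zero_right]
  nlinarith [norm_nonneg x, le_abs_self c, abs_nonneg c]

namespace DiscSubsolution

variable {𝒞 : Coefficients} {K A B T : ℝ} {v : Plane → ℝ → ℝ}

lemma continuousOn_slice (hv : DiscSubsolution 𝒞 A B T v) {t : ℝ} (ht : t ∈ Icc 0 T) :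
    ContinuousOn (fun x => v x t) (Metric.closedBall 0 1) :=
  hv.continuousOn.comp (f := fun x : Plane => (x, t)) (by fun_prop) fun _ hx => ⟨hx, ht⟩

lemma boundedOnDisc (hv : DiscSubsolution 𝒞 A B T v) {t : ℝ} (ht : t ∈ Icc 0 T) :
    BoundedOnDisc (fun x => v x t) :=
  (hv.continuousOn_slice ht).boundedOnDisc

lemma boundedOnDisc_cutoff (d : ℝ) : BoundedOnDisc (cutoff d) :=
  (contDiff_cutoff d).continuous.boundedOnDisc

lemma boundedOnDisc_w (h𝒞 : 𝒞.NearlyFlat K) : BoundedOnDisc 𝒞.w := h𝒞.cont_w.boundedOnDisc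

lemma boundedOnDisc_testFn {x₀ : Plane} {t₀ t : ℝ} :
    BoundedOnDisc fun x => testFn 𝒞 x₀ t₀ x t :=
  ((contDiff_cutoff _).mul (contDiff_frozenGauss_sub _ _ x₀)).continuous.boundedOnDisc

/-- The value of a continuous function is recovered by testing with narrow Gaussians. -/
lemma exists_le_integral_testFn (hv : DiscSubsolution 𝒞 A B T v) (h𝒞 : 𝒞.NearlyFlat K)
    {x₀ : Plane} (hx₀ : x₀ ∈ disc) {t₀ : ℝ} (ht₀ : t₀ ∈ Icc 0 T) {θ : ℝ} (hθ : 0 < θ) :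
    ∃ δ₀ : ℝ, 0 < δ₀ ∧ ∀ δ, 0 < δ → δ ≤ δ₀ →
      v x₀ t₀ - θ ≤ ∫ x in disc, v x t₀ * testFn 𝒞 x₀ (t₀ + δ) x t₀ * 𝒞.w x := by
  have hd0 := one_sub_norm_sq_pos hx₀
  have hcont : ContinuousAt (fun x => v x t₀) x₀ :=
    (hv.continuousOn_slice ht₀).continuousAt
      (Filter.mem_of_superset (Metric.isOpen_ball.mem_nhds hx₀) Metric.ball_subset_closedBall)
  have e1 : ∀ᶠ x in nhds x₀, v x₀ t₀ - θ < v x t₀ :=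
    ContinuousAt.eventually_lt continuousAt_const hcont (by linarith)
  have e2 : ∀ᶠ x in nhds x₀, (1 - ‖x₀‖ ^ 2) / 2 < 1 - ‖x‖ ^ 2 :=
    ContinuousAt.eventually_lt continuousAt_const (by fun_prop) (by linarith)
  have e3 : ∀ᶠ x in nhds x₀, x ∈ disc := Metric.isOpen_ball.mem_nhds hx₀
  obtain ⟨r, hr, H⟩ := Metric.eventually_nhds_iff.1 (e1.and (e2.and e3))
  refine ⟨r ^ 2, by positivity, fun δ hδ hδr => ?_⟩
  have hw0 : ∀ x ∈ disc, 0 ≤ 𝒞.w x := fun x hx => by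
    linarith [h𝒞.density_ge x (Metric.ball_subset_closedBall hx)]
  have hnn : ∀ x ∈ disc, 0 ≤ v x t₀ * testFn 𝒞 x₀ (t₀ + δ) x t₀ * 𝒞.w x := fun x hx =>
    mul_nonneg (mul_nonneg (hv.nonneg x (Metric.ball_subset_closedBall hx) t₀ ht₀)
      (testFn_nonneg 𝒞 x₀ x (by linarith))) (hw0 x hx)
  have hint : IntegrableOn (fun x => v x t₀ * testFn 𝒞 x₀ (t₀ + δ) x t₀ * 𝒞.w x) disc :=
    (((hv.boundedOnDisc ht₀).mul boundedOnDisc_testFn).mul (boundedOnDisc_w h𝒞)).integrableOn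
  rcases le_or_gt (v x₀ t₀ - θ) 0 with hneg | hpos
  · exact hneg.trans (setIntegral_nonneg measurableSet_disc hnn)
  have hσr : √δ ≤ r := by
    rw [Real.sqrt_le_left hr.le]; exact hδr
  have hsub : Metric.ball x₀ (√δ) ⊆ disc := fun x hx => (H (lt_of_lt_of_le hx hσr)).2.2
  have hvol : volume.real (Metric.ball x₀ (√δ)) = δ * Real.pi := by
    rw [measureReal_def, EuclideanSpace.volume_ball_fin_two, ENNReal.toReal_mul,
      ENNReal.toReal_pow, ENNReal.toReal_ofReal (Real.sqrt_nonneg _), Real.sq_sqrt hδ.le,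
      ENNReal.toReal_ofReal Real.pi_pos.le]
  -- On the ball of radius `√δ` the Gaussian is at least `δ⁻¹ (1 - 3/10)` and the density at least
  -- `1/2`. The area is `π δ`, and `π · 7/20 > 1`.
  calc v x₀ t₀ - θ
      ≤ ∫ x in Metric.ball x₀ (√δ), (v x₀ t₀ - θ) * (δ⁻¹ * (7 / 10)) * (1 / 2) := by
        rw [setIntegral_const, hvol, smul_eq_mul]
        have hpi := Real.pi_gt_three
        have : δ * Real.pi * ((v x₀ t₀ - θ) * (δ⁻¹ * (7 / 10)) * (1 / 2)) =
          (v x₀ t₀ - θ) * (Real.pi * (7 / 20)) := by field_simp; ring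
        rw [this]
        nlinarith
    _ ≤ ∫ x in Metric.ball x₀ (√δ), v x t₀ * testFn 𝒞 x₀ (t₀ + δ) x t₀ * 𝒞.w x := by
        refine setIntegral_mono_on ?_ (hint.mono_set hsub) Metric.isOpen_ball.measurableSet
          fun x hx => ?_
        · exact integrableOn_const (by exact measure_ball_lt_top.ne)
        · obtain ⟨h1, h2, h3⟩ := H (lt_of_lt_of_le hx hσr)
          have h4 := h𝒞.density_ge x (Metric.ball_subset_closedBall h3)
          have h5 : δ⁻¹ * (7 / 10) ≤ testFn 𝒞 x₀ (t₀ + δ) x t₀ := by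
            rw [testFn, cutoff_eq_one hd0 h2.le, one_mul, add_sub_cancel_left, frozenGauss]
            refine mul_le_mul_of_nonneg_left ?_ (by positivity)
            have h6 := quadForm_le (fun i j =>
              h𝒞.q_near i j x₀ (Metric.ball_subset_closedBall hx₀)) (x - x₀)
            have h7 : ‖x - x₀‖ ^ 2 ≤ δ := by
              have h8 : ‖x - x₀‖ < √δ := by simpa [dist_eq_norm] using hx
              calc ‖x - x₀‖ ^ 2 ≤ √δ ^ 2 := by gcongr
                _ = δ := Real.sq_sqrt hδ.le
            have h9 := Real.add_one_le_exp
              (-(quadForm (fun i j => 𝒞.q i j x₀) (x - x₀) / (4 * δ)))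
            have h10 : quadForm (fun i j => 𝒞.q i j x₀) (x - x₀) / (4 * δ) ≤ 3 / 10 := by
              rw [div_le_iff₀ (by positivity)]; linarith
            linarith
          exact mul_le_mul (mul_le_mul h1.le h5 (by positivity) (by linarith)) h4 (by norm_num)
            (mul_nonneg (by linarith) (testFn_nonneg 𝒞 x₀ x (by linarith)))
    _ ≤ _ := setIntegral_mono_set hint
        ((ae_restrict_mem measurableSet_disc).mono fun x hx => hnn x hx) hsub.eventuallyLE

end DiscSubsolution

/-- The representation inequality: `C` is universal, `U` is any integrable upper bound for the
time density of the source terms. -/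
lemma exists_representation : ∃ C : ℝ, 0 < C ∧ ∀ (𝒞 : Coefficients) (K A B T : ℝ)
    (v : Plane → ℝ → ℝ), 𝒞.NearlyFlat K → K ≤ 1 → DiscSubsolution 𝒞 A B T v →
    ∀ x₀ ∈ disc, ∀ t₁ t₀ δ : ℝ, 0 ≤ t₁ → t₁ < t₀ → t₀ ≤ T → 0 < δ → ∀ U : ℝ → ℝ,
    IntervalIntegrable U volume t₁ t₀ →
    (∀ t ∈ Ioo t₁ t₀,
      C * K * (√(t₀ + δ - t))⁻¹ *
        heatAverage (fun x => cutoff (1 - ‖x₀‖ ^ 2) x * v x t) (t₀ + δ - t) x₀ +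
      C * ((1 - ‖x₀‖ ^ 2) ^ 2)⁻¹ *
        heatAverage ((transition (1 - ‖x₀‖ ^ 2)).indicator fun x => v x t) (t₀ + δ - t) x₀ +
      C * |A| * heatAverage (fun x => cutoff (1 - ‖x₀‖ ^ 2) x * v x t ^ 3) (t₀ + δ - t) x₀ +
      C * |B| * heatAverage (fun x => cutoff (1 - ‖x₀‖ ^ 2) x * v x t) (t₀ + δ - t) x₀ ≤ U t) →
    ∫ x in disc, v x t₀ * testFn 𝒞 x₀ (t₀ + δ) x t₀ * 𝒞.w x ≤
      C * heatAverage (fun x => cutoff (1 - ‖x₀‖ ^ 2) x * v x t₁) (t₀ + δ - t₁) x₀ +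
        ∫ t in t₁..t₀, U t := by
  obtain ⟨C, hC, herr⟩ := exists_testFn_error_le
  -- The factor `2` bounds the density; `C` belongs to the adjoint error, and `1` to the comparison
  -- of the test function with the wider kernel.
  refine ⟨2 * C + 2, by positivity, fun 𝒞 K A B T v h𝒞 hK hv x₀ hx₀ t₁ t₀ δ ht₁ ht ht₀ hδ U hU
    hUb => ?_⟩
  have hd0 := one_sub_norm_sq_pos hx₀
  have hK0 : 0 ≤ K :=
    (abs_nonneg _).trans (h𝒞.drift 0 x₀ (Metric.ball_subset_closedBall hx₀))
  obtain ⟨hG, hmain⟩ := hv.slice h𝒞 (f := testFn 𝒞 x₀ (t₀ + δ)) ht₁ ht ht₀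
    (b' := t₀ + δ) (by linarith) (contDiffOn_testFn 𝒞 x₀ (t₀ + δ))
    (isCompact_norm_sq_le (1 - (1 - ‖x₀‖ ^ 2) / 4))
    (fun x hx => by
      rw [mem_ofPred_eq] at hx
      rw [Metric.mem_ball, dist_zero_right]
      nlinarith [norm_nonneg x])
    (fun x hx t => testFn_eq_zero 𝒞 hx₀ hx _ _)
    (fun x t ht' => testFn_nonneg 𝒞 x₀ x ht'.le)
  set η := cutoff (1 - ‖x₀‖ ^ 2) with hη
  have hη0 : ∀ x, 0 ≤ η x := cutoff_nonneg _
  have bη : BoundedOnDisc η := DiscSubsolution.boundedOnDisc_cutoff _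
  set Tr := transition (1 - ‖x₀‖ ^ 2) with hTr
  have hw : ∀ x ∈ disc, 0 ≤ 𝒞.w x ∧ 𝒞.w x ≤ 2 := fun x hx =>
    ⟨by linarith [h𝒞.density_ge x (Metric.ball_subset_closedBall hx)],
      h𝒞.density_le x (Metric.ball_subset_closedBall hx)⟩
  have hGU : ∫ t in t₁..t₀, (∫ x in disc, (v x t * (deriv (testFn 𝒞 x₀ (t₀ + δ) x) t +
      𝒞.op (fun y => testFn 𝒞 x₀ (t₀ + δ) y t) x)
        + (A * v x t ^ 3 + B * v x t) * testFn 𝒞 x₀ (t₀ + δ) x t) * 𝒞.w x) ≤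
      ∫ t in t₁..t₀, U t := by
    refine intervalIntegral.integral_mono_on_of_le_Ioo ht.le hG hU fun t htt => ?_
    refine le_trans ?_ (hUb t htt)
    have hs : 0 < t₀ + δ - t := by linarith [htt.2]
    have htT : t ∈ Icc 0 T := ⟨by linarith [htt.1], by linarith [htt.2]⟩
    have bv := hv.boundedOnDisc htT
    set s := t₀ + δ - t with hsdef
    have bk := boundedOnDisc_gaussKernel s x₀
    have b1 : BoundedOnDisc fun x => η x * v x t := bη.mul bv
    have b2 : BoundedOnDisc (Tr.indicator fun x => v x t) :=
      bv.indicator (measurableSet_transition _)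
    have b3 : BoundedOnDisc fun x => η x * v x t ^ 3 := bη.mul (bv.pow 3)
    unfold heatAverage
    rw [← integral_const_mul, ← integral_const_mul, ← integral_const_mul, ← integral_const_mul,
      ← integral_add ((bk.mul b1).const_mul _).integrableOn ((bk.mul b2).const_mul _).integrableOn,
      ← integral_add (((bk.mul b1).const_mul _).add ((bk.mul b2).const_mul _)).integrableOn
        ((bk.mul b3).const_mul _).integrableOn,
      ← integral_add ((((bk.mul b1).const_mul _).add ((bk.mul b2).const_mul _)).add
        ((bk.mul b3).const_mul _)).integrableOn ((bk.mul b1).const_mul _).integrableOn]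
    -- Without integrability the left integral is `0` by convention, and the right side is
    -- nonnegative.
    by_cases hint : IntegrableOn (fun x => (v x t * (deriv (testFn 𝒞 x₀ (t₀ + δ) x) t +
      𝒞.op (fun y => testFn 𝒞 x₀ (t₀ + δ) y t) x)
        + (A * v x t ^ 3 + B * v x t) * testFn 𝒞 x₀ (t₀ + δ) x t) * 𝒞.w x) disc
    swap
    · rw [integral_undef hint]
      refine setIntegral_nonneg measurableSet_disc fun x hx => ?_
      have h1 := hv.nonneg x (Metric.ball_subset_closedBall hx) t htT
      have h2 : 0 ≤ Tr.indicator (fun x => v x t) x := indicator_apply_nonneg fun _ => h1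
      have h3 := gaussKernel_nonneg hs.le (x₀ - x)
      have h4 := hη0 x
      positivity
    refine setIntegral_mono_on hint (((((bk.mul b1).const_mul _).add
      ((bk.mul b2).const_mul _)).add ((bk.mul b3).const_mul _)).add
      ((bk.mul b1).const_mul _)).integrableOn measurableSet_disc fun x hx => ?_
    have h1 := hv.nonneg x (Metric.ball_subset_closedBall hx) t htT
    have h2 : Tr.indicator (fun x => v x t) x = v x t * Tr.indicator 1 x := by
      by_cases h : x ∈ Tr <;> simp [h]
    have h2' : 0 ≤ Tr.indicator (1 : Plane → ℝ) x := indicator_nonneg (fun _ _ => zero_le_one) x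
    have h3 := gaussKernel_nonneg hs.le (x₀ - x)
    have h4 := hη0 x
    have h5 := herr 𝒞 K h𝒞 hK x₀ hx₀ x hx (t₀ + δ) t (by linarith)
    have h6 := testFn_nonneg 𝒞 x₀ x (by linarith : t ≤ t₀ + δ)
    have h7 := testFn_le h𝒞 hx₀ x (by linarith : t < t₀ + δ)
    rw [← hη, ← hsdef] at h7
    rw [← hη, ← hTr, ← hsdef] at h5
    rw [h2]
    set k := gaussKernel s (x₀ - x)
    set f := testFn 𝒞 x₀ (t₀ + δ) x t
    set u := v x t
    have s1 : u * (deriv (testFn 𝒞 x₀ (t₀ + δ) x) t + 𝒞.op (fun y => testFn 𝒞 x₀ (t₀ + δ) y t) x) ≤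
        u * (C * (K * (√s)⁻¹ * η x + ((1 - ‖x₀‖ ^ 2) ^ 2)⁻¹ * Tr.indicator 1 x) * k) :=
      mul_le_mul_of_nonneg_left ((le_abs_self _).trans h5) h1
    have s2 : (A * u ^ 3 + B * u) * f ≤ (|A| * u ^ 3 + |B| * u) * (η x * k) := by
      refine mul_le_mul ?_ h7 h6 (by positivity)
      gcongr <;> exact le_abs_self _
    have P1 : 0 ≤ u * (C * (K * (√s)⁻¹ * η x + ((1 - ‖x₀‖ ^ 2) ^ 2)⁻¹ * Tr.indicator 1 x) * k) := by
      positivity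
    have P2 : 0 ≤ (|A| * u ^ 3 + |B| * u) * (η x * k) := by positivity
    have P3 : 0 ≤ u * ((K * (√s)⁻¹ * η x + ((1 - ‖x₀‖ ^ 2) ^ 2)⁻¹ * Tr.indicator 1 x) * k) := by
      positivity
    have hC2 : 0 ≤ C * ((|A| * u ^ 3 + |B| * u) * (η x * k)) := by positivity
    obtain ⟨hw0, hw2⟩ := hw x hx
    calc _ ≤ (u * (C * (K * (√s)⁻¹ * η x + ((1 - ‖x₀‖ ^ 2) ^ 2)⁻¹ * Tr.indicator 1 x) * k) +
            (|A| * u ^ 3 + |B| * u) * (η x * k)) * 𝒞.w x :=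
          mul_le_mul_of_nonneg_right (add_le_add s1 s2) hw0
      _ ≤ (u * (C * (K * (√s)⁻¹ * η x + ((1 - ‖x₀‖ ^ 2) ^ 2)⁻¹ * Tr.indicator 1 x) * k) +
            (|A| * u ^ 3 + |B| * u) * (η x * k)) * 2 :=
          mul_le_mul_of_nonneg_left hw2 (add_nonneg P1 P2)
      _ ≤ _ := by linarith
  have hinit : ∫ x in disc, v x t₁ * testFn 𝒞 x₀ (t₀ + δ) x t₁ * 𝒞.w x ≤
      (2 * C + 2) * heatAverage (fun x => η x * v x t₁) (t₀ + δ - t₁) x₀ := by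
    have ht₁T : t₁ ∈ Icc 0 T := ⟨ht₁, by linarith⟩
    have bv := hv.boundedOnDisc ht₁T
    unfold heatAverage
    rw [← integral_const_mul]
    refine setIntegral_mono_on
      ((bv.mul DiscSubsolution.boundedOnDisc_testFn).mul
        (DiscSubsolution.boundedOnDisc_w h𝒞)).integrableOn
      (((boundedOnDisc_gaussKernel _ x₀).mul (bη.mul bv)).const_mul _).integrableOn
      measurableSet_disc fun x hx => ?_
    have h1 := hv.nonneg x (Metric.ball_subset_closedBall hx) t₁ ht₁T
    have h6 := testFn_nonneg 𝒞 x₀ x (by linarith : t₁ ≤ t₀ + δ)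
    have h7 := testFn_le h𝒞 hx₀ x (by linarith : t₁ < t₀ + δ)
    obtain ⟨hw0, hw2⟩ := hw x hx
    have h3 := gaussKernel_nonneg (by linarith : 0 ≤ t₀ + δ - t₁) (x₀ - x)
    have h4 := hη0 x
    have P : 0 ≤ C * (gaussKernel (t₀ + δ - t₁) (x₀ - x) * (η x * v x t₁)) := by positivity
    calc _ ≤ v x t₁ * (η x * gaussKernel (t₀ + δ - t₁) (x₀ - x)) * 2 :=
          mul_le_mul (mul_le_mul_of_nonneg_left h7 h1) hw2 hw0 (by positivity)
      _ ≤ _ := by linarith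
  linarith

end

/-! ### The bootstrap -/

lemma inv_sqrt_eq_rpow {t : ℝ} (ht : 0 ≤ t) : (√t)⁻¹ = t ^ (-(1 / 2) : ℝ) := by
  rw [Real.sqrt_eq_rpow, Real.rpow_neg ht]

lemma intervalIntegrable_inv_sqrt {a b : ℝ} (ha : 0 ≤ a) (hb : 0 ≤ b) :
    IntervalIntegrable (fun t => (√t)⁻¹) volume a b :=
  (intervalIntegral.intervalIntegrable_rpow' (r := -(1 / 2)) (by norm_num)).congr
    fun t ht => (inv_sqrt_eq_rpow ((le_min ha hb).trans ht.1.le)).symm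

lemma integral_inv_sqrt {a b : ℝ} (ha : 0 ≤ a) (hb : 0 ≤ b) :
    ∫ t in a..b, (√t)⁻¹ = 2 * (√b - √a) := by
  have h1 : ∫ t in a..b, (√t)⁻¹ = ∫ t in a..b, t ^ (-(1 / 2) : ℝ) :=
    intervalIntegral.integral_congr fun t ht => inv_sqrt_eq_rpow ((le_min ha hb).trans ht.1)
  rw [h1, integral_rpow (Or.inl (by norm_num))]
  norm_num [Real.sqrt_eq_rpow]
  ring

lemma intervalIntegrable_inv_sqrt_sub {a c : ℝ} (h : a ≤ c) :
    IntervalIntegrable (fun t => (√(c - t))⁻¹) volume a c := by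
  have := (intervalIntegrable_inv_sqrt (a := c - a) (b := 0) (by linarith) le_rfl).comp_sub_left c
  simpa using this

lemma integral_inv_sqrt_sub {a c : ℝ} (h : a ≤ c) :
    ∫ t in a..c, (√(c - t))⁻¹ = 2 * √(c - a) := by
  rw [intervalIntegral.integral_comp_sub_left (fun t => (√t)⁻¹) c,
    integral_inv_sqrt (by linarith) (by linarith)]
  simp

lemma intervalIntegrable_indicator_Ioi (a V t₁ t₀ : ℝ) :
    IntervalIntegrable ((Ioi a).indicator fun _ => V) volume t₁ t₀ :=
  ⟨(integrableOn_const (by simp)).indicator measurableSet_Ioi,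
    (integrableOn_const (by simp)).indicator measurableSet_Ioi⟩

lemma integral_indicator_Ioi_le {a V t₁ t₀ h : ℝ} (hV : 0 ≤ V) (ht : t₁ ≤ t₀) (hh : 0 ≤ h)
    (hah : t₀ ≤ a + h) : ∫ t in t₁..t₀, (Ioi a).indicator (fun _ => V) t ≤ V * h := by
  rw [intervalIntegral.integral_of_le ht, setIntegral_indicator measurableSet_Ioi,
    setIntegral_const, smul_eq_mul, mul_comm]
  refine mul_le_mul_of_nonneg_left ?_ hV
  refine ENNReal.toReal_le_of_le_ofReal hh ?_
  calc volume (Ioc t₁ t₀ ∩ Ioi a) ≤ volume (Ioc a (a + h)) :=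
        measure_mono fun t ht => ⟨ht.2, ht.1.2.trans hah⟩
    _ = ENNReal.ofReal h := by rw [Real.volume_Ioc]; simp

/-- The annular part of the disc. -/
def outerAnnulus : Set Plane := disc \ Metric.closedBall 0 (3 / 5)

lemma measurableSet_outerAnnulus : MeasurableSet outerAnnulus :=
  measurableSet_disc.diff Metric.isClosed_closedBall.measurableSet

/-- The function which controls subsolutions: the square root of a caloric function with initial
values `v²`, and a multiple of the inverse distance to the boundary. -/
def majorant (v : Plane → ℝ → ℝ) (ε : ℝ) (x : Plane) (t : ℝ) : ℝ :=
  √(heatAverage (fun y => v y 0 ^ 2) t x) + √ε / (1 - ‖x‖ ^ 2)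

/-- Because of this positive floor every bounded function lies below some multiple of the majorant,
so the bootstrap has a starting point. -/
lemma sqrt_le_majorant (v : Plane → ℝ → ℝ) {ε : ℝ} {x : Plane} (hx : x ∈ disc) (t : ℝ) :
    √ε ≤ majorant v ε x t := by
  have h := one_sub_norm_sq_pos hx
  have h1 : √ε ≤ √ε / (1 - ‖x‖ ^ 2) :=
    le_div_self (Real.sqrt_nonneg _) h (by nlinarith [norm_nonneg x])
  have := Real.sqrt_nonneg (heatAverage (fun y => v y 0 ^ 2) t x)
  unfold majorant
  linarith

/-- From `1 - |x₀|² ≤ 1` follows `|x|² ≥ 1/2 > (3/5)²`. The cutoff error therefore involves only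
values of `v` where the energy is small at all times. -/
lemma mem_outerAnnulus_of_mem_transition {x₀ x : Plane} (hx₀ : x₀ ∈ disc)
    (hx : x ∈ transition (1 - ‖x₀‖ ^ 2)) : x ∈ outerAnnulus := by
  have h := one_sub_norm_sq_pos hx₀
  obtain ⟨h1, h2⟩ := hx
  have h3 : 0 ≤ ‖x₀‖ ^ 2 := by positivity
  refine ⟨?_, ?_⟩
  · rw [Metric.mem_ball, dist_zero_right]; nlinarith [norm_nonneg x]
  · rw [Metric.mem_closedBall, dist_zero_right, not_le]; nlinarith [norm_nonneg x]

/-- A bound for averages by the energy. -/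
lemma heatAverage_le_sqrt_energy {u : Plane → ℝ} (hu : BoundedOnDisc u) {s E : ℝ} (hs : 0 < s)
    (hE : ∫ x in disc, u x ^ 2 ≤ E) (x : Plane) : heatAverage u s x ≤ √(8 * Real.pi * E / s) := by
  refine (heatAverage_le_sqrt hu hs x).trans (Real.sqrt_le_sqrt ?_)
  have h := heatAverage_le (hu.pow 2) (fun x _ => sq_nonneg _) hs x
  have h2 : s⁻¹ * ∫ x in disc, u x ^ 2 ≤ s⁻¹ * E := mul_le_mul_of_nonneg_left hE (by positivity)
  calc _ ≤ 8 * Real.pi * (s⁻¹ * E) :=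
        mul_le_mul_of_nonneg_left (h.trans h2) (by positivity)
    _ = _ := by rw [div_eq_mul_inv]; ring

/-! ### Averages of powers of the square root of a caloric function. -/

section Averages

variable {f : Plane → ℝ} {ε : ℝ}

/-- Averages of the square root of a caloric function. -/
lemma heatAverage_sqrt_heatAverage_le (hf : BoundedOnDisc f) (h0 : ∀ x ∈ disc, 0 ≤ f x)
    {s t : ℝ} (hs : 0 < s) (ht : 0 < t) (x : Plane) :
    heatAverage (fun y => √(heatAverage f t y)) s x ≤
      8 * Real.pi * √(heatAverage f (s + t) x) := by
  have b := boundedOnDisc_heatAverage hf ht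
  have e : heatAverage (fun y => √(heatAverage f t y) ^ 2) s x =
      heatAverage (heatAverage f t) s x := by
    congr 1; ext y; rw [Real.sq_sqrt (heatAverage_nonneg h0 ht.le y)]
  refine (heatAverage_le_sqrt b.sqrt hs x).trans ?_
  rw [e]
  calc √(8 * Real.pi * heatAverage (heatAverage f t) s x)
      ≤ √((8 * Real.pi) ^ 2 * heatAverage f (s + t) x) := by
        refine Real.sqrt_le_sqrt ?_
        have := mul_le_mul_of_nonneg_left (heatAverage_heatAverage_le hf h0 hs ht x)
          (by positivity : 0 ≤ 8 * Real.pi)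
        linarith
    _ = _ := by rw [Real.sqrt_mul (by positivity), Real.sqrt_sq (by positivity)]

/-- The kernel is at most `t⁻¹`. This is the smoothing bound from `L¹` to `L^∞` in the plane, and
the only place from which the cubic term obtains its small factor `ε` in the caloric part. -/
lemma sqrt_heatAverage_le (hf : BoundedOnDisc f) (h0 : ∀ x ∈ disc, 0 ≤ f x)
    (hE : ∫ x in disc, f x ≤ ε) {t : ℝ} (ht : 0 < t) (x : Plane) :
    √(heatAverage f t x) ≤ √ε * (√t)⁻¹ := by
  rw [← div_eq_mul_inv, ← Real.sqrt_div' _ ht.le]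
  refine Real.sqrt_le_sqrt ((heatAverage_le hf h0 ht x).trans ?_)
  rw [inv_mul_eq_div]
  gcongr

/-- Averages of the third power of the square root of a caloric function. -/
lemma heatAverage_cube_le (hf : BoundedOnDisc f) (h0 : ∀ x ∈ disc, 0 ≤ f x)
    (hE : ∫ x in disc, f x ≤ ε) {s t : ℝ} (hs : 0 < s) (ht : 0 < t) (x : Plane) :
    heatAverage (fun y => √(heatAverage f t y) ^ 3) s x ≤
      8 * Real.pi * (√ε * (√t)⁻¹ * heatAverage f (s + t) x) := by
  have b := boundedOnDisc_heatAverage hf ht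
  have h1 : heatAverage (fun y => √(heatAverage f t y) ^ 3) s x ≤
      heatAverage (fun y => √ε * (√t)⁻¹ * heatAverage f t y) s x := by
    refine heatAverage_mono (b.sqrt.pow 3) (b.const_mul _) (fun y _ => ?_) hs.le x
    have h2 := sqrt_heatAverage_le hf h0 hE ht y
    have h3 := Real.sq_sqrt (heatAverage_nonneg h0 ht.le y)
    rw [pow_succ, h3, mul_comm]
    exact mul_le_mul_of_nonneg_right h2 (heatAverage_nonneg h0 ht.le y)
  refine h1.trans ?_
  rw [heatAverage_const_mul]
  have := mul_le_mul_of_nonneg_left (heatAverage_heatAverage_le hf h0 hs ht x)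
    (by positivity : 0 ≤ √ε * (√t)⁻¹)
  linarith

/-- Averages of `√g + D`. -/
lemma heatAverage_sqrt_add_le (hf : BoundedOnDisc f) (h0 : ∀ x ∈ disc, 0 ≤ f x)
    {s t D : ℝ} (hs : 0 < s) (ht : 0 < t) (hD : 0 ≤ D) (x : Plane) :
    heatAverage (fun y => √(heatAverage f t y) + D) s x ≤
      8 * Real.pi * (√(heatAverage f (s + t) x) + D) := by
  have b := boundedOnDisc_heatAverage hf ht
  rw [heatAverage_add b.sqrt (BoundedOnDisc.const D), mul_add]
  exact add_le_add (heatAverage_sqrt_heatAverage_le hf h0 hs ht x) (heatAverage_const_le hD hs x)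

/-- Averages of `(√g + D)³`. -/
lemma heatAverage_sqrt_add_cube_le (hf : BoundedOnDisc f) (h0 : ∀ x ∈ disc, 0 ≤ f x)
    (hE : ∫ x in disc, f x ≤ ε) {s t D t₀ : ℝ} (hs : 0 < s) (ht : 0 < t) (hD : 0 ≤ D)
    (ht₀ : 0 < t₀) (hst : t₀ ≤ s + t) (x : Plane) :
    heatAverage (fun y => (√(heatAverage f t y) + D) ^ 3) s x ≤
      32 * Real.pi * (ε * (√t)⁻¹ * (√t₀)⁻¹ * √(heatAverage f (s + t) x) + D ^ 3) := by
  have b := boundedOnDisc_heatAverage hf ht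
  have hε : 0 ≤ ε := (setIntegral_nonneg measurableSet_disc h0).trans hE
  have h1 : heatAverage (fun y => (√(heatAverage f t y) + D) ^ 3) s x ≤
      heatAverage (fun y => 4 * √(heatAverage f t y) ^ 3 + 4 * D ^ 3) s x := by
    refine heatAverage_mono ((b.sqrt.add (BoundedOnDisc.const D)).pow 3)
      (((b.sqrt.pow 3).const_mul 4).add (BoundedOnDisc.const _)) (fun y _ => ?_) hs.le x
    have hr := Real.sqrt_nonneg (heatAverage f t y)
    -- `4 a³ + 4 b³ - (a + b)³ = 3 (a + b) (a - b)²`.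
    nlinarith [mul_nonneg (add_nonneg hr hD) (sq_nonneg (√(heatAverage f t y) - D))]
  refine h1.trans ?_
  rw [heatAverage_add ((b.sqrt.pow 3).const_mul 4) (BoundedOnDisc.const _), heatAverage_const_mul]
  have h2 := heatAverage_cube_le hf h0 hE hs ht x
  have h3 := heatAverage_const_le (by positivity : 0 ≤ 4 * D ^ 3) hs x
  have hg := heatAverage_nonneg h0 (by linarith : 0 ≤ s + t) x
  -- One of the two factors `√g` at time `s + t` is sacrificed for `√ε / √t₀`. The other is kept, so
  -- that the result is again linear in the majorant.
  have h4 : √(heatAverage f (s + t) x) ≤ √ε * (√t₀)⁻¹ := by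
    refine (sqrt_heatAverage_le hf h0 hE (by linarith) x).trans ?_
    have := Real.sqrt_le_sqrt hst
    have := Real.sqrt_pos.2 ht₀
    gcongr
  have h5 : heatAverage f (s + t) x ≤ √ε * (√t₀)⁻¹ * √(heatAverage f (s + t) x) := by
    nth_rewrite 1 [← Real.mul_self_sqrt hg]
    exact mul_le_mul_of_nonneg_right h4 (Real.sqrt_nonneg _)
  have h6 : √ε * (√t)⁻¹ * heatAverage f (s + t) x ≤
      ε * (√t)⁻¹ * (√t₀)⁻¹ * √(heatAverage f (s + t) x) := by
    calc _ ≤ √ε * (√t)⁻¹ * (√ε * (√t₀)⁻¹ * √(heatAverage f (s + t) x)) :=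
          mul_le_mul_of_nonneg_left h5 (by positivity)
      _ = (√ε * √ε) * (√t)⁻¹ * (√t₀)⁻¹ * √(heatAverage f (s + t) x) := by ring
      _ = _ := by rw [Real.mul_self_sqrt hε]
  have hpi := Real.pi_pos
  have h7 := mul_le_mul_of_nonneg_left h6 (by positivity : 0 ≤ 32 * Real.pi)
  linarith

end Averages

/-- A subsolution on the disc with small initial energy and small energy on the outer annulus. -/
structure SmallEnergy (T : ℝ) (v : Plane → ℝ → ℝ) (ε : ℝ) : Prop where
  pos : 0 < ε
  init : ∫ x in disc, v x 0 ^ 2 ≤ ε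
  outer : ∀ t ∈ Icc 0 T, ∫ x in outerAnnulus, v x t ^ 2 ≤ ε

/-! ### Energy of functions below the majorant. -/

section Step

variable {𝒞 : Coefficients} {K A B T ε : ℝ} {v : Plane → ℝ → ℝ}

/-- The majorant on the support of the cutoff. -/
lemma cutoff_mul_majorant_le {x₀ x : Plane} (hx₀ : x₀ ∈ disc) (ε t : ℝ) :
    cutoff (1 - ‖x₀‖ ^ 2) x * majorant v ε x t ≤
      cutoff (1 - ‖x₀‖ ^ 2) x * (√(heatAverage (fun y => v y 0 ^ 2) t x) +
        4 * √ε / (1 - ‖x₀‖ ^ 2)) := by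
  have hd := one_sub_norm_sq_pos hx₀
  rcases le_or_gt (1 - ‖x‖ ^ 2) ((1 - ‖x₀‖ ^ 2) / 4) with h | h
  · rw [cutoff_eq_zero hd h]; simp
  · refine mul_le_mul_of_nonneg_left ?_ (cutoff_nonneg _ _)
    refine add_le_add_right ?_ _
    rw [div_le_div_iff₀ (by linarith) hd]
    nlinarith [Real.sqrt_nonneg ε]

lemma majorant_nonneg (v : Plane → ℝ → ℝ) (ε : ℝ) {x : Plane} (hx : x ∈ disc) (t : ℝ) :
    0 ≤ majorant v ε x t := (Real.sqrt_nonneg _).trans (sqrt_le_majorant v hx t)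

/-- If `v` is bounded by `N` times the majorant then so is its energy. -/
lemma setIntegral_sq_le (hv : DiscSubsolution 𝒞 A B T v) (hE : SmallEnergy T v ε) {t N : ℝ}
    (ht : t ∈ Ioc 0 T) (hN : ∀ x ∈ disc, v x t ≤ N * majorant v ε x t) :
    ∫ x in disc, v x t ^ 2 ≤ ε * (1 + 84 * N ^ 2) := by
  have htT : t ∈ Icc 0 T := ⟨ht.1.le, ht.2⟩
  have bv := (hv.boundedOnDisc htT).pow 2
  have b0 := (hv.boundedOnDisc ⟨le_rfl, ht.1.le.trans ht.2⟩).pow 2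
  have bg := boundedOnDisc_heatAverage b0 ht.1
  have hg0 : ∀ x, 0 ≤ heatAverage (fun y => v y 0 ^ 2) t x :=
    heatAverage_nonneg (fun _ _ => sq_nonneg _) ht.1.le
  -- The annulus is controlled by hypothesis. Inside it `1 - |x|² ≥ 16/25`, so the square of the
  -- majorant is at most `2 g + 2 (25/16)² ε ≤ 2 g + 5 ε`.
  have h1 : ∫ x in disc, v x t ^ 2 ≤ ∫ x in disc, (outerAnnulus.indicator (fun x => v x t ^ 2) x +
      N ^ 2 * (2 * heatAverage (fun y => v y 0 ^ 2) t x + 5 * ε)) := by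
    refine setIntegral_mono_on bv.integrableOn
      ((bv.indicator measurableSet_outerAnnulus).add
        (((bg.const_mul 2).add (BoundedOnDisc.const (5 * ε))).const_mul _)).integrableOn
      measurableSet_disc fun x hx => ?_
    have hnn : 0 ≤ N ^ 2 * (2 * heatAverage (fun y => v y 0 ^ 2) t x + 5 * ε) := by
      have := hg0 x
      have := hE.pos
      positivity
    by_cases ho : x ∈ outerAnnulus
    · rw [indicator_of_mem ho]; linarith
    · rw [indicator_of_notMem ho, zero_add]
      have hx35 : ‖x‖ ≤ 3 / 5 := by
        by_contra h
        exact ho ⟨hx, by simpa using h⟩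
      have h2 := hN x hx
      have h3 := hv.nonneg x (Metric.ball_subset_closedBall hx) t htT
      have h4 : v x t ^ 2 ≤ N ^ 2 * majorant v ε x t ^ 2 := by rw [← mul_pow]; gcongr
      refine h4.trans (mul_le_mul_of_nonneg_left ?_ (sq_nonneg _))
      unfold majorant
      have h5 : √ε / (1 - ‖x‖ ^ 2) ≤ √ε * (25 / 16) := by
        have h16 : 16 / 25 ≤ 1 - ‖x‖ ^ 2 := by nlinarith [norm_nonneg x]
        rw [div_le_iff₀ (by linarith)]
        nlinarith [Real.sqrt_nonneg ε]
      have h6 : 0 ≤ √ε / (1 - ‖x‖ ^ 2) :=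
        div_nonneg (Real.sqrt_nonneg _) (by nlinarith [norm_nonneg x])
      have h7 : (√ε / (1 - ‖x‖ ^ 2)) ^ 2 ≤ (√ε * (25 / 16)) ^ 2 := by gcongr
      rw [mul_pow, Real.sq_sqrt hE.pos.le] at h7
      have h8 := Real.sq_sqrt (hg0 x)
      nlinarith [sq_nonneg (√(heatAverage (fun y => v y 0 ^ 2) t x) - √ε / (1 - ‖x‖ ^ 2)), hE.pos]
  refine h1.trans ?_
  rw [integral_add (bv.indicator measurableSet_outerAnnulus).integrableOn
    (((bg.const_mul 2).add (BoundedOnDisc.const (5 * ε))).const_mul _).integrableOn,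
    integral_const_mul, integral_add (bg.const_mul 2).integrableOn
      (BoundedOnDisc.const (5 * ε)).integrableOn, integral_const_mul,
    setIntegral_indicator measurableSet_outerAnnulus, setIntegral_const, smul_eq_mul]
  have h2 : disc ∩ outerAnnulus = outerAnnulus := inter_eq_right.2 sdiff_subset
  have h3 : volume.real disc = Real.pi := by
    rw [measureReal_def, EuclideanSpace.volume_ball_fin_two]
    simp [Real.pi_pos.le]
  rw [h2, h3]
  have h4 := hE.outer t htT
  have h5 := (setIntegral_heatAverage_le b0 (fun _ _ => sq_nonneg _) ht.1).trans
    (mul_le_mul_of_nonneg_left hE.init (by positivity : 0 ≤ 8 * Real.pi))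
  have h6 := Real.pi_le_four
  -- From `8π ≤ 32`; together with `5π ≤ 20` this gives `84 = 64 + 20`.
  have h7 : 2 * ∫ x in disc, heatAverage (fun y => v y 0 ^ 2) t x ≤ 64 * ε := by
    nlinarith [hE.pos]
  have h8 : Real.pi * (5 * ε) ≤ 20 * ε := by nlinarith [hE.pos]
  nlinarith [sq_nonneg N]

end Step

/-! ### Gaussian averages of the terms in the representation inequality. -/

section Averages

variable {𝒞 : Coefficients} {K A B T ε : ℝ} {v : Plane → ℝ → ℝ} {x₀ : Plane}

lemma cutoff_eq_zero_or_majorant_le {x : Plane} (hx₀ : x₀ ∈ disc) (v : Plane → ℝ → ℝ) (ε t : ℝ) :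
    cutoff (1 - ‖x₀‖ ^ 2) x = 0 ∨
      majorant v ε x t ≤ √(heatAverage (fun y => v y 0 ^ 2) t x) + 4 * √ε / (1 - ‖x₀‖ ^ 2) := by
  rcases (cutoff_nonneg (1 - ‖x₀‖ ^ 2) x).eq_or_lt with h | h
  · exact Or.inl h.symm
  · exact Or.inr (le_of_mul_le_mul_left (cutoff_mul_majorant_le hx₀ ε t) h)

lemma DiscSubsolution.boundedOnDisc_init (hv : DiscSubsolution 𝒞 A B T v) {t : ℝ}
    (ht : t ∈ Ioc 0 T) : BoundedOnDisc fun x => v x 0 ^ 2 :=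
  (hv.boundedOnDisc ⟨le_rfl, ht.1.le.trans ht.2⟩).pow 2

lemma eight_pi_le : 8 * Real.pi ≤ 32 := by linarith [Real.pi_le_four]

lemma sqrt_eight_pi_mul_le (E : ℝ) : √(8 * Real.pi * E) ≤ 6 * √E := by
  rw [Real.sqrt_mul (by positivity)]
  refine mul_le_mul_of_nonneg_right ?_ (Real.sqrt_nonneg _)
  rw [Real.sqrt_le_left (by norm_num)]
  linarith [Real.pi_le_four]

/-- On the support of the cutoff the boundary part of the majorant is at most the constant `4 √ε /
d`, and the caloric part moves from time `t` to time `s + t`. With `s = t₀ + δ - t` the bound does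
not depend on `t`. -/
lemma heatAverage_cutoff_mul_le (hv : DiscSubsolution 𝒞 A B T v)
    (hx₀ : x₀ ∈ disc) {s t N : ℝ} (ht : t ∈ Ioc 0 T) (hs : 0 < s) (hN0 : 0 ≤ N)
    (hN : ∀ x ∈ disc, v x t ≤ N * majorant v ε x t) :
    heatAverage (fun x => cutoff (1 - ‖x₀‖ ^ 2) x * v x t) s x₀ ≤
      32 * N * (√(heatAverage (fun y => v y 0 ^ 2) (s + t) x₀) + 4 * √ε / (1 - ‖x₀‖ ^ 2)) := by
  have hd := one_sub_norm_sq_pos hx₀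
  have b0 := hv.boundedOnDisc_init ht
  have bg := (boundedOnDisc_heatAverage b0 ht.1).sqrt
  have hD : 0 ≤ 4 * √ε / (1 - ‖x₀‖ ^ 2) := by positivity
  have htT : t ∈ Icc 0 T := ⟨ht.1.le, ht.2⟩
  set D := 4 * √ε / (1 - ‖x₀‖ ^ 2) with hDdef
  have h1 : heatAverage (fun x => cutoff (1 - ‖x₀‖ ^ 2) x * v x t) s x₀ ≤
      heatAverage (fun x => N * (√(heatAverage (fun y => v y 0 ^ 2) t x) + D)) s x₀ := by
    refine heatAverage_mono ((DiscSubsolution.boundedOnDisc_cutoff _).mul (hv.boundedOnDisc htT))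
      ((bg.add (BoundedOnDisc.const D)).const_mul N) (fun x hx => ?_) hs.le x₀
    rcases cutoff_eq_zero_or_majorant_le (x := x) hx₀ v ε t with h | h
    · rw [h, zero_mul]; positivity
    · calc _ ≤ 1 * v x t := mul_le_mul_of_nonneg_right (cutoff_le_one _ _)
            (hv.nonneg x (Metric.ball_subset_closedBall hx) t htT)
        _ ≤ _ := by rw [one_mul]; exact (hN x hx).trans (mul_le_mul_of_nonneg_left h hN0)
  refine h1.trans ?_
  rw [heatAverage_const_mul]
  have h2 := heatAverage_sqrt_add_le b0 (fun _ _ => sq_nonneg _) hs ht.1 hD x₀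
  have h3 : 0 ≤ √(heatAverage (fun y => v y 0 ^ 2) (s + t) x₀) + D := by positivity
  calc _ ≤ N * (32 * (√(heatAverage (fun y => v y 0 ^ 2) (s + t) x₀) + D)) := by
        refine mul_le_mul_of_nonneg_left (h2.trans ?_) hN0
        exact mul_le_mul_of_nonneg_right eight_pi_le h3
    _ = _ := by ring

/-- The transition region lies in the outer annulus, so the energy there is at most `ε` without any
bound on `v`. This is why the cutoff error does not carry a factor `N`. -/
lemma heatAverage_transition_le (hv : DiscSubsolution 𝒞 A B T v) (hE : SmallEnergy T v ε)
    (hx₀ : x₀ ∈ disc) {s t : ℝ} (ht : t ∈ Icc 0 T) (hs : 0 < s) :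
    heatAverage ((transition (1 - ‖x₀‖ ^ 2)).indicator fun x => v x t) s x₀ ≤
      6 * √ε * (√s)⁻¹ := by
  have bv := hv.boundedOnDisc ht
  have hm := measurableSet_transition (1 - ‖x₀‖ ^ 2)
  have h1 : ∫ x in disc, (transition (1 - ‖x₀‖ ^ 2)).indicator (fun x => v x t) x ^ 2 ≤ ε := by
    refine le_trans ?_ (hE.outer t ht)
    have e : ∫ x in outerAnnulus, v x t ^ 2 =
        ∫ x in disc, outerAnnulus.indicator (fun x => v x t ^ 2) x := by
      rw [setIntegral_indicator measurableSet_outerAnnulus,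
        show disc ∩ outerAnnulus = outerAnnulus from inter_eq_right.2 sdiff_subset]
    rw [e]
    refine setIntegral_mono_on ((bv.indicator hm).pow 2).integrableOn
      ((bv.pow 2).indicator measurableSet_outerAnnulus).integrableOn measurableSet_disc
      fun x _ => ?_
    by_cases hx : x ∈ transition (1 - ‖x₀‖ ^ 2)
    · rw [indicator_of_mem hx, indicator_of_mem (mem_outerAnnulus_of_mem_transition hx₀ hx)]
    · rw [indicator_of_notMem hx]
      exact (zero_pow two_ne_zero).trans_le (indicator_nonneg (fun _ _ => sq_nonneg _) _)
  refine (heatAverage_le_sqrt_energy (bv.indicator hm) hs h1 x₀).trans ?_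
  rw [Real.sqrt_div' _ hs.le, div_eq_mul_inv]
  exact mul_le_mul_of_nonneg_right (sqrt_eight_pi_mul_le ε) (by positivity)

/-- Writing `v³ = v · v²`, one factor is bounded through `N` and the other two through the separate
constants `κ` and `W`. The outcome is linear in `N`, as the iteration requires. -/
lemma heatAverage_cutoff_mul_cube_le (hv : DiscSubsolution 𝒞 A B T v) (hE : SmallEnergy T v ε)
    (hx₀ : x₀ ∈ disc) {s t t₀ N κ W : ℝ} (ht : t ∈ Ioc 0 T) (hs : 0 < s) (ht₀ : 0 < t₀)
    (hst : t₀ ≤ s + t) (hN0 : 0 ≤ N) (hW : 0 ≤ W)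
    (hN : ∀ x ∈ disc, v x t ≤ N * majorant v ε x t)
    (hκ : ∀ x ∈ disc, v x t ^ 2 ≤ κ ^ 2 * majorant v ε x t ^ 2 + W) :
    heatAverage (fun x => cutoff (1 - ‖x₀‖ ^ 2) x * v x t ^ 3) s x₀ ≤
      128 * N * κ ^ 2 * (ε * (√t)⁻¹ * (√t₀)⁻¹ * √(heatAverage (fun y => v y 0 ^ 2) (s + t) x₀) +
        (4 * √ε / (1 - ‖x₀‖ ^ 2)) ^ 3) +
      32 * N * W *
        (√(heatAverage (fun y => v y 0 ^ 2) (s + t) x₀) + 4 * √ε / (1 - ‖x₀‖ ^ 2)) := by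
  have hd := one_sub_norm_sq_pos hx₀
  have b0 := hv.boundedOnDisc_init ht
  have bg := (boundedOnDisc_heatAverage b0 ht.1).sqrt
  have hD : 0 ≤ 4 * √ε / (1 - ‖x₀‖ ^ 2) := by positivity
  have htT : t ∈ Icc 0 T := ⟨ht.1.le, ht.2⟩
  have hε := hE.pos
  set D := 4 * √ε / (1 - ‖x₀‖ ^ 2) with hDdef
  have bgD := bg.add (BoundedOnDisc.const D)
  have h1 : heatAverage (fun x => cutoff (1 - ‖x₀‖ ^ 2) x * v x t ^ 3) s x₀ ≤
      heatAverage (fun x => N * κ ^ 2 * (√(heatAverage (fun y => v y 0 ^ 2) t x) + D) ^ 3 +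
        N * W * (√(heatAverage (fun y => v y 0 ^ 2) t x) + D)) s x₀ := by
    refine heatAverage_mono ((DiscSubsolution.boundedOnDisc_cutoff _).mul ((hv.boundedOnDisc htT).pow 3))
      (((bgD.pow 3).const_mul _).add (bgD.const_mul _)) (fun x hx => ?_) hs.le x₀
    have hr := Real.sqrt_nonneg (heatAverage (fun y => v y 0 ^ 2) t x)
    have hv0 := hv.nonneg x (Metric.ball_subset_closedBall hx) t htT
    rcases cutoff_eq_zero_or_majorant_le (x := x) hx₀ v ε t with h | h
    · rw [h, zero_mul]; positivity
    · have hm0 := majorant_nonneg v ε hx t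
      set m := majorant v ε x t
      set r := √(heatAverage (fun y => v y 0 ^ 2) t x) + D
      calc _ ≤ 1 * v x t ^ 3 := mul_le_mul_of_nonneg_right (cutoff_le_one _ _) (by positivity)
        _ = v x t * v x t ^ 2 := by ring
        _ ≤ (N * m) * (κ ^ 2 * m ^ 2 + W) :=
          mul_le_mul (hN x hx) (hκ x hx) (sq_nonneg _) (by positivity)
        _ ≤ (N * r) * (κ ^ 2 * r ^ 2 + W) := by gcongr
        _ = _ := by ring
  refine h1.trans ?_
  rw [heatAverage_add ((bgD.pow 3).const_mul _) (bgD.const_mul _), heatAverage_const_mul,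
    heatAverage_const_mul]
  have h2 := heatAverage_sqrt_add_le b0 (fun _ _ => sq_nonneg _) hs ht.1 hD x₀
  have h3 := heatAverage_sqrt_add_cube_le b0 (fun _ _ => sq_nonneg _) hE.init hs ht.1 hD ht₀ hst x₀
  set r := √(heatAverage (fun y => v y 0 ^ 2) (s + t) x₀)
  have h4 : 0 ≤ r + D := by positivity
  have h5 : 0 ≤ ε * (√t)⁻¹ * (√t₀)⁻¹ * r + D ^ 3 := by positivity
  have h6 : 32 * Real.pi ≤ 128 := by linarith [Real.pi_le_four]
  refine add_le_add ?_ ?_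
  · calc _ ≤ N * κ ^ 2 * (128 * (ε * (√t)⁻¹ * (√t₀)⁻¹ * r + D ^ 3)) :=
          mul_le_mul_of_nonneg_left (h3.trans (mul_le_mul_of_nonneg_right h6 h5)) (by positivity)
      _ = _ := by ring
  · calc _ ≤ N * W * (32 * (r + D)) :=
          mul_le_mul_of_nonneg_left (h2.trans (mul_le_mul_of_nonneg_right eight_pi_le h4))
            (by positivity)
      _ = _ := by ring

/-- Jensen's inequality bounds the average of `v(0)` by the root of the average of `v(0)²`: this is
the reason for the caloric part of the majorant. -/
lemma heatAverage_cutoff_mul_init_le (hv : DiscSubsolution 𝒞 A B T v) (hT : 0 ≤ T)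
    (hx₀ : x₀ ∈ disc) {s : ℝ} (hs : 0 < s) (ε : ℝ) :
    heatAverage (fun x => cutoff (1 - ‖x₀‖ ^ 2) x * v x 0) s x₀ ≤
      6 * (√(heatAverage (fun y => v y 0 ^ 2) s x₀) + 4 * √ε / (1 - ‖x₀‖ ^ 2)) := by
  have hd := one_sub_norm_sq_pos hx₀
  have h0T : (0 : ℝ) ∈ Icc 0 T := ⟨le_rfl, hT⟩
  have b := (DiscSubsolution.boundedOnDisc_cutoff (1 - ‖x₀‖ ^ 2)).mul (hv.boundedOnDisc h0T)
  have h1 : heatAverage (fun x => (cutoff (1 - ‖x₀‖ ^ 2) x * v x 0) ^ 2) s x₀ ≤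
      heatAverage (fun y => v y 0 ^ 2) s x₀ := by
    refine heatAverage_mono (b.pow 2) ((hv.boundedOnDisc h0T).pow 2) (fun x _ => ?_) hs.le x₀
    rw [mul_pow]
    exact mul_le_of_le_one_left (sq_nonneg _)
      (pow_le_one₀ (cutoff_nonneg _ _) (cutoff_le_one _ _))
  have h2 := (heatAverage_le_sqrt b hs x₀).trans (sqrt_eight_pi_mul_le _)
  have h3 := Real.sqrt_le_sqrt h1
  have : 0 ≤ 4 * √ε / (1 - ‖x₀‖ ^ 2) := by positivity
  linarith

/-- The energy at time `t` is at most `ε (1 + 84 N²)`, and an average over time `s ≥ τ d²` is at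
most `√(8π E / s)`. Hence the coefficient of `N` decays like `1 / √τ`, relative to the boundary part
`√ε / d` of the majorant. -/
lemma heatAverage_cutoff_mul_late_le (hv : DiscSubsolution 𝒞 A B T v) (hE : SmallEnergy T v ε)
    (hx₀ : x₀ ∈ disc) {s t τ N : ℝ} (ht : t ∈ Ioc 0 T) (hτ : 1 ≤ τ)
    (hs : τ * (1 - ‖x₀‖ ^ 2) ^ 2 ≤ s) (hN0 : 0 ≤ N)
    (hN : ∀ x ∈ disc, v x t ≤ N * majorant v ε x t) :
    heatAverage (fun x => cutoff (1 - ‖x₀‖ ^ 2) x * v x t) s x₀ ≤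
      (2 + 15 * N / √τ) * (4 * √ε / (1 - ‖x₀‖ ^ 2)) := by
  have hd := one_sub_norm_sq_pos hx₀
  set d := 1 - ‖x₀‖ ^ 2
  have htT : t ∈ Icc 0 T := ⟨ht.1.le, ht.2⟩
  have hs0 : 0 < s := lt_of_lt_of_le (by positivity) hs
  have bv := hv.boundedOnDisc htT
  have b := (DiscSubsolution.boundedOnDisc_cutoff d).mul bv
  have h1 : ∫ x in disc, (cutoff d x * v x t) ^ 2 ≤ ε * (1 + 84 * N ^ 2) := by
    refine le_trans ?_ (setIntegral_sq_le hv hE ht hN)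
    refine setIntegral_mono_on (b.pow 2).integrableOn (bv.pow 2).integrableOn measurableSet_disc
      fun x _ => ?_
    rw [mul_pow]
    exact mul_le_of_le_one_left (sq_nonneg _)
      (pow_le_one₀ (cutoff_nonneg _ _) (cutoff_le_one _ _))
  have hε := hE.pos
  have h2 : √(ε * (1 + 84 * N ^ 2)) ≤ √ε * (1 + 10 * N) := by
    rw [Real.sqrt_mul hε.le]
    refine mul_le_mul_of_nonneg_left ?_ (Real.sqrt_nonneg _)
    rw [Real.sqrt_le_left (by positivity)]
    nlinarith
  have h3 : √τ * d ≤ √s := by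
    refine Real.le_sqrt_of_sq_le ?_
    rwa [mul_pow, Real.sq_sqrt (by linarith)]
  have hτ1 : 1 ≤ √τ := Real.one_le_sqrt.2 hτ
  refine (heatAverage_le_sqrt_energy b hs0 h1 x₀).trans ?_
  rw [Real.sqrt_div' _ hs0.le]
  calc √(8 * Real.pi * (ε * (1 + 84 * N ^ 2))) / √s
      ≤ 6 * (√ε * (1 + 10 * N)) / (√τ * d) := by
        gcongr
        exact (sqrt_eight_pi_mul_le _).trans (by linarith)
    -- The `6` bounds `√(8π)` and the `10` bounds `√84`; the division by `4` comes from the factor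
    -- in `4 √ε / d`.
    _ = (6 / 4 * (1 / √τ) + 15 * N / √τ) * (4 * √ε / d) := by
        field_simp; ring
    _ ≤ _ := by
        gcongr
        have : 1 / √τ ≤ 1 := by rw [div_le_one (by linarith)]; exact hτ1
        linarith

end Averages

/-- The amplification factor of one step of the bootstrap. -/
def stepFactor (K A B τ ε κ V h : ℝ) : ℝ :=
  15 / √τ + 64 * K * √τ + 2048 * |A| * κ ^ 2 * ε * τ + 32 * |A| * V ^ 2 * h + 32 * |B| * τ

/-! ### One step of the bootstrap. -/

section Step

variable {𝒞 : Coefficients} {K A B T ε : ℝ} {v : Plane → ℝ → ℝ} {x₀ : Plane}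

/-- The time integral of the four source bounds. All singularities in time are inverse square roots,
hence integrable, and the window length `τ d²` compensates the negative powers of `d`. Only the
cutoff term, of size `3 √τ D`, comes without the factor `N`. -/
lemma integral_step_le {C K A B τ ε κ V h N d a t₁ t₀ r D : ℝ} (hC : 0 < C) (hK : 0 ≤ K)
    (hτ : 1 ≤ τ) (hε : 0 < ε) (hN : 0 ≤ N) (hd : 0 < d) (hd1 : d ≤ 1) (ht₁ : 0 ≤ t₁)
    (ht : t₁ < t₀) (hτd : t₀ - t₁ ≤ τ * d ^ 2) (hah : t₀ ≤ a + h) (hh : 0 ≤ h) (hr : 0 ≤ r)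
    (hD : D = 4 * √ε / d) :
    ∃ U : ℝ → ℝ, IntervalIntegrable U volume t₁ t₀ ∧
      (∀ t, U t = C * K * (√(t₀ - t))⁻¹ * (32 * N * (r + D)) +
        C * (d ^ 2)⁻¹ * (6 * √ε * (√(t₀ - t))⁻¹) +
        C * |A| * (128 * N * κ ^ 2 * (ε * (√t)⁻¹ * (√t₀)⁻¹ * r + D ^ 3) +
          32 * N * (Ioi a).indicator (fun _ => V ^ 2) t * (r + D)) +
        C * |B| * (32 * N * (r + D))) ∧
      ∫ t in t₁..t₀, U t ≤
        C * (3 * √τ * D + N * (64 * K * √τ + 2048 * |A| * κ ^ 2 * ε * τ + 32 * |A| * V ^ 2 * h +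
          32 * |B| * τ) * (r + D)) := by
  have ht₀ : 0 < t₀ := lt_of_le_of_lt ht₁ ht
  have hD0 : 0 ≤ D := by rw [hD]; positivity
  set c₁ := C * K * (32 * N * (r + D)) + C * (d ^ 2)⁻¹ * (6 * √ε) with hc₁
  set c₂ := C * |A| * (128 * N * κ ^ 2 * (ε * (√t₀)⁻¹ * r)) with hc₂
  set c₃ := C * |A| * (32 * N * (r + D)) with hc₃
  set c₄ := C * |A| * (128 * N * κ ^ 2 * D ^ 3) + C * |B| * (32 * N * (r + D)) with hc₄
  have i₁ := (intervalIntegrable_inv_sqrt_sub ht.le).const_mul c₁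
  have i₂ := (intervalIntegrable_inv_sqrt ht₁ ht₀.le).const_mul c₂
  have i₃ := (intervalIntegrable_indicator_Ioi a (V ^ 2) t₁ t₀).const_mul c₃
  have i₄ : IntervalIntegrable (fun _ : ℝ => c₄) volume t₁ t₀ := intervalIntegrable_const
  refine ⟨fun t => c₁ * (√(t₀ - t))⁻¹ + c₂ * (√t)⁻¹ +
    c₃ * (Ioi a).indicator (fun _ => V ^ 2) t + c₄, ((i₁.add i₂).add i₃).add i₄,
    fun t => by simp only [hc₁, hc₂, hc₃, hc₄]; ring, ?_⟩
  rw [intervalIntegral.integral_add ((i₁.add i₂).add i₃) i₄,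
    intervalIntegral.integral_add (i₁.add i₂) i₃, intervalIntegral.integral_add i₁ i₂,
    intervalIntegral.integral_const_mul, intervalIntegral.integral_const_mul,
    intervalIntegral.integral_const_mul, intervalIntegral.integral_const,
    integral_inv_sqrt_sub ht.le, integral_inv_sqrt ht₁ ht₀.le, smul_eq_mul]
  have j₃ := integral_indicator_Ioi_le (V := V ^ 2) (sq_nonneg V) ht.le hh hah
  have hsτ : √(t₀ - t₁) ≤ √τ * d := by
    rw [Real.sqrt_le_left (by positivity), mul_pow, Real.sq_sqrt (by linarith)]
    exact hτd
  have hτ0 : 0 ≤ √τ := Real.sqrt_nonneg _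
  have hM : 0 ≤ r + D := by positivity
  have e₁ : c₁ * (2 * √(t₀ - t₁)) ≤ C * (N * (64 * K * √τ) * (r + D)) + C * (3 * √τ * D) := by
    have hc : 0 ≤ c₁ := by positivity
    calc c₁ * (2 * √(t₀ - t₁)) ≤ c₁ * (2 * (√τ * d)) := by gcongr
      _ = C * (N * (64 * K * √τ) * (r + D)) * d + C * (3 * √τ * D) := by
          rw [hc₁, hD]; field_simp; ring
      _ ≤ C * (N * (64 * K * √τ) * (r + D)) * 1 + C * (3 * √τ * D) := by gcongr
      _ = _ := by ring
  -- The integral of `t^(-1/2)` cancels the factor `t₀^(-1/2)` in `c₂`: the caloric part of the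
  -- cubic term is scale invariant and uses no bound on the window length.
  have e₂ : c₂ * (2 * (√t₀ - √t₁)) ≤ C * (N * (256 * |A| * κ ^ 2 * ε) * r) := by
    have hc : 0 ≤ c₂ := by positivity
    have hs : 0 < √t₀ := Real.sqrt_pos.2 ht₀
    calc c₂ * (2 * (√t₀ - √t₁)) ≤ c₂ * (2 * √t₀) := by
          gcongr; linarith [Real.sqrt_nonneg t₁]
      _ = _ := by rw [hc₂]; field_simp; ring
  have e₃ : c₃ * ∫ t in t₁..t₀, (Ioi a).indicator (fun _ => V ^ 2) t ≤
      C * (N * (32 * |A| * V ^ 2 * h) * (r + D)) := by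
    have hc : 0 ≤ c₃ := by positivity
    calc _ ≤ c₃ * (V ^ 2 * h) := by gcongr
      _ = _ := by rw [hc₃]; ring
  have e₄ : (t₀ - t₁) * c₄ ≤ C * (N * (2048 * |A| * κ ^ 2 * ε * τ) * D) +
      C * (N * (32 * |B| * τ) * (r + D)) := by
    have hc : 0 ≤ c₄ := by positivity
    -- Two of the three factors `D` in the cubic boundary term are consumed by the length `τ d²` of
    -- the window and leave a multiple of `ε`.
    have hD2 : D ^ 2 * d ^ 2 = 16 * ε := by
      rw [hD, div_pow, mul_pow, Real.sq_sqrt hε.le]; field_simp; ring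
    have hdd : d ^ 2 ≤ 1 := pow_le_one₀ hd.le hd1
    calc (t₀ - t₁) * c₄ ≤ τ * d ^ 2 * c₄ := by gcongr
      _ = C * (N * (128 * |A| * κ ^ 2 * (D ^ 2 * d ^ 2) * τ) * D) +
          C * (N * (32 * |B| * τ) * (r + D)) * d ^ 2 := by rw [hc₄]; ring
      _ ≤ C * (N * (128 * |A| * κ ^ 2 * (D ^ 2 * d ^ 2) * τ) * D) +
          C * (N * (32 * |B| * τ) * (r + D)) * 1 := by gcongr
      _ = _ := by rw [hD2]; ring
  have e₅ : C * (N * (256 * |A| * κ ^ 2 * ε) * r) ≤ C * (N * (2048 * |A| * κ ^ 2 * ε * τ) * r) := by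
    have h1 : 256 * |A| * κ ^ 2 * ε ≤ 2048 * |A| * κ ^ 2 * ε * τ := by
      have : 0 ≤ |A| * κ ^ 2 * ε := by positivity
      nlinarith
    gcongr
  linarith

/-- The gain: every contribution that uses the hypothesis on `N` carries a term of `stepFactor`, all
of which can be made small. The initial data and the cutoff contribute only the fixed amount `6 + 3
√τ`. -/
lemma exists_linear_step : ∃ C : ℝ, 0 < C ∧ ∀ (𝒞 : Coefficients) (K A B T ε : ℝ)
    (v : Plane → ℝ → ℝ), 𝒞.NearlyFlat K → K ≤ 1 → DiscSubsolution 𝒞 A B T v →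
    SmallEnergy T v ε → ∀ τ N κ V a h : ℝ, 1 ≤ τ → 0 ≤ N → 0 ≤ h → ∀ x₀ ∈ disc, ∀ t₀ ∈ Ioc 0 T,
    t₀ ≤ a + h → (∀ t ∈ Ioc 0 t₀, ∀ x ∈ disc, v x t ≤ N * majorant v ε x t) →
    (∀ t ∈ Ioc 0 t₀, ∀ x ∈ disc,
      v x t ^ 2 ≤ κ ^ 2 * majorant v ε x t ^ 2 + (Ioi a).indicator (fun _ => V ^ 2) t) →
    v x₀ t₀ ≤ C * (6 + 3 * √τ + N * stepFactor K A B τ ε κ V h) * majorant v ε x₀ t₀ := by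
  obtain ⟨C, hC, hrep⟩ := exists_representation
  refine ⟨4 * C, by positivity, fun 𝒞 K A B T ε v h𝒞 hK hv hE τ N κ V a h hτ hN0 hh x₀ hx₀ t₀ ht₀
    hah hN hκ => ?_⟩
  have hd := one_sub_norm_sq_pos hx₀
  have hd1 : 1 - ‖x₀‖ ^ 2 ≤ 1 := by linarith [sq_nonneg ‖x₀‖]
  have hK0 : 0 ≤ K :=
    (abs_nonneg _).trans (h𝒞.drift 0 x₀ (Metric.ball_subset_closedBall hx₀))
  have hε := hE.pos
  have hτ0 : 0 ≤ √τ := Real.sqrt_nonneg _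
  have b0 := hv.boundedOnDisc_init ht₀
  have hF0 : 0 ≤ stepFactor K A B τ ε κ V h := by unfold stepFactor; positivity
  refine le_of_forall_pos_le_add fun θ hθ => ?_
  obtain ⟨δ₀, hδ₀, hδ⟩ := hv.exists_le_integral_testFn h𝒞 hx₀ ⟨ht₀.1.le, ht₀.2⟩ hθ
  -- The delay keeps the test Gaussian smooth up to time `t₀`. The restriction `δ ≤ t₀²` keeps the
  -- caloric part at `t₀ + δ` comparable to that at `t₀`.
  set δ := min δ₀ (t₀ ^ 2) with hδdef
  have hδ0 : 0 < δ := lt_min hδ₀ (by have := ht₀.1; positivity)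
  set d := 1 - ‖x₀‖ ^ 2 with hddef
  -- The window has the parabolic length `τ d²` unless it is cut off at time `0`; the two cases use
  -- the late and the initial estimate respectively.
  set t₁ := max 0 (t₀ - τ * d ^ 2) with ht₁def
  have ht₁ : 0 ≤ t₁ := le_max_left _ _
  have htt : t₁ < t₀ := max_lt ht₀.1 (by have : 0 < τ * d ^ 2 := by positivity
                                         linarith)
  have hτd : t₀ - t₁ ≤ τ * d ^ 2 := by linarith [le_max_right 0 (t₀ - τ * d ^ 2)]
  set r := √(heatAverage (fun y => v y 0 ^ 2) (t₀ + δ) x₀) with hrdef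
  have hr : 0 ≤ r := Real.sqrt_nonneg _
  set D := 4 * √ε / d with hDdef
  have hD0 : 0 ≤ D := by positivity
  obtain ⟨U, hU, hUeq, hUint⟩ := integral_step_le (A := A) (B := B) (κ := κ) (V := V) hC hK0 hτ hε
    hN0 hd hd1 ht₁ htt hτd hah hh hr hDdef
  have hinit : heatAverage (fun x => cutoff d x * v x t₁) (t₀ + δ - t₁) x₀ ≤
      (6 + N * (15 / √τ)) * (r + D) := by
    rcases le_or_gt (t₀ - τ * d ^ 2) 0 with h0 | h0
    · have e : t₁ = 0 := max_eq_left h0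
      rw [e, sub_zero]
      refine (heatAverage_cutoff_mul_init_le hv (ht₀.1.le.trans ht₀.2) hx₀ (by linarith [ht₀.1])
        ε).trans ?_
      have : 0 ≤ N * (15 / √τ) * (r + D) := by positivity
      linarith
    · have e : t₁ = t₀ - τ * d ^ 2 := max_eq_right h0.le
      have ht₁0 : 0 < t₁ := e ▸ h0
      refine (heatAverage_cutoff_mul_late_le hv hE hx₀ ⟨ht₁0, htt.le.trans ht₀.2⟩ hτ
        (by rw [e]; linarith) hN0 (hN t₁ ⟨ht₁0, htt.le⟩)).trans ?_
      rw [← hDdef]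
      have h1 : 0 ≤ 15 * N / √τ := by positivity
      have h2 : N * (15 / √τ) = 15 * N / √τ := by ring
      rw [h2]
      exact mul_le_mul (by linarith) (by linarith) hD0 (by linarith)
  have hmain := hrep 𝒞 K A B T v h𝒞 hK hv x₀ hx₀ t₁ t₀ δ ht₁ htt ht₀.2 hδ0 U hU fun t ht => by
    have htT : t ∈ Ioc 0 T := ⟨ht₁.trans_lt ht.1, ht.2.le.trans ht₀.2⟩
    have htt₀ : t ∈ Ioc 0 t₀ := ⟨htT.1, ht.2.le⟩
    have hs : 0 < t₀ + δ - t := by linarith [ht.2]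
    have hst : t₀ + δ - t + t = t₀ + δ := by ring
    have h1 := heatAverage_cutoff_mul_le hv hx₀ htT hs hN0 (hN t htt₀)
    have h2 := heatAverage_transition_le hv hE hx₀ ⟨htT.1.le, htT.2⟩ hs
    have h3 := heatAverage_cutoff_mul_cube_le hv hE hx₀ htT hs ht₀.1 (by linarith) hN0
      (indicator_nonneg (fun _ _ => sq_nonneg V) t) (hN t htt₀) (hκ t htt₀)
    rw [hst, ← hrdef] at h1 h3
    have h4 : (√(t₀ + δ - t))⁻¹ ≤ (√(t₀ - t))⁻¹ := by
      have : 0 < √(t₀ - t) := Real.sqrt_pos.2 (by linarith [ht.2])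
      gcongr
      linarith
    rw [hUeq]
    have hnn : 0 ≤ 32 * N * (r + D) := by positivity
    refine add_le_add (add_le_add (add_le_add ?_ ?_) ?_) ?_
    · exact mul_le_mul (by gcongr) h1 (heatAverage_nonneg (fun x hx => mul_nonneg
        (cutoff_nonneg _ _) (hv.nonneg x (Metric.ball_subset_closedBall hx) t
          ⟨htT.1.le, htT.2⟩)) hs.le _) (by positivity)
    · refine mul_le_mul_of_nonneg_left (h2.trans ?_) (by positivity)
      gcongr
    · exact mul_le_mul_of_nonneg_left h3 (by positivity)
    · exact mul_le_mul_of_nonneg_left h1 (by positivity)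
  have hv1 := hδ δ hδ0 (min_le_left _ _)
  -- The delay costs the factor `√4` in the caloric part, by `e < 4`, and the boundary part
  -- contributes the `4` in `D = 4 √ε / d`.
  have hM : r + D ≤ 4 * majorant v ε x₀ t₀ := by
    have h1 := heatAverage_add_time_le b0 (fun _ _ => sq_nonneg _) ht₀.1 hδ0.le hx₀
    have h2 : Real.exp (δ / (2 * t₀ ^ 2)) ≤ 4 := by
      have h3 : δ / (2 * t₀ ^ 2) ≤ 1 := by
        have := ht₀.1
        rw [div_le_one (by positivity)]
        have := min_le_right δ₀ (t₀ ^ 2)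
        nlinarith
      linarith [Real.exp_le_exp.2 h3, Real.exp_one_lt_d9]
    have hg := heatAverage_nonneg (f := fun y => v y 0 ^ 2) (fun _ _ => sq_nonneg _) ht₀.1.le x₀
    have h4 : r ≤ 2 * √(heatAverage (fun y => v y 0 ^ 2) t₀ x₀) := by
      rw [hrdef, Real.sqrt_le_left (by positivity), mul_pow, Real.sq_sqrt hg]
      nlinarith
    have h5 : D = 4 * (√ε / d) := by rw [hDdef]; ring
    have h6 := Real.sqrt_nonneg (heatAverage (fun y => v y 0 ^ 2) t₀ x₀)
    unfold majorant
    linarith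
  have hD3 : 3 * √τ * D ≤ 3 * √τ * (r + D) := by gcongr; linarith
  have h7 : v x₀ t₀ ≤ C * (6 + 3 * √τ + N * stepFactor K A B τ ε κ V h) * (r + D) + θ := by
    have h8 := mul_le_mul_of_nonneg_left hinit hC.le
    have h9 := mul_le_mul_of_nonneg_left hD3 hC.le
    unfold stepFactor
    linarith
  calc v x₀ t₀ ≤ C * (6 + 3 * √τ + N * stepFactor K A B τ ε κ V h) * (r + D) + θ := h7
    _ ≤ C * (6 + 3 * √τ + N * stepFactor K A B τ ε κ V h) * (4 * majorant v ε x₀ t₀) + θ := by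
        gcongr
    _ = _ := by ring

end Step

/-! ### Iteration and the bound on the disc. -/

section

variable {𝒞 : Coefficients} {A B T ε : ℝ} {v : Plane → ℝ → ℝ}

lemma DiscSubsolution.exists_bound (hv : DiscSubsolution 𝒞 A B T v) :
    ∃ V, 0 ≤ V ∧ ∀ x ∈ disc, ∀ t ∈ Icc 0 T, v x t ≤ V := by
  obtain ⟨V, hV⟩ := ((isCompact_closedBall (0 : Plane) 1).prod
    isCompact_Icc).exists_bound_of_continuousOn hv.continuousOn
  refine ⟨max V 0, le_max_right _ _, fun x hx t ht => le_trans ?_ (le_max_left _ _)⟩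
  exact (le_abs_self _).trans (hV (x, t) ⟨Metric.ball_subset_closedBall hx, ht⟩)

/-- A linear step which halves the constant gives the bound with the fixed point as constant. -/
lemma le_majorant_of_step {b V C₁ : ℝ} (hV0 : 0 ≤ V) (hε : 0 < ε)
    (hV : ∀ t ∈ Ioc 0 b, ∀ x ∈ disc, v x t ≤ V) (hC : 0 ≤ C₁)
    (hstep : ∀ N, 0 ≤ N → (∀ t ∈ Ioc 0 b, ∀ x ∈ disc, v x t ≤ N * majorant v ε x t) →
      ∀ t ∈ Ioc 0 b, ∀ x ∈ disc, v x t ≤ (C₁ + N / 2) * majorant v ε x t) :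
    ∀ t ∈ Ioc 0 b, ∀ x ∈ disc, v x t ≤ 2 * C₁ * majorant v ε x t := by
  have hsε : 0 < √ε := Real.sqrt_pos.2 hε
  -- Iterates of `N ↦ C₁ + N / 2` from the crude start `V / √ε`, shifted by the fixed point `2 C₁`;
  -- the excess halves at each step.
  have key : ∀ k : ℕ, ∀ t ∈ Ioc 0 b, ∀ x ∈ disc,
      v x t ≤ (2 * C₁ + V / √ε * (1 / 2) ^ k) * majorant v ε x t := by
    intro k
    induction k with
    | zero =>
      intro t ht x hx
      have h1 := sqrt_le_majorant v hx t (ε := ε)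
      calc v x t ≤ V / √ε * √ε := by rw [div_mul_cancel₀ _ hsε.ne']; exact hV t ht x hx
        _ ≤ V / √ε * majorant v ε x t := by gcongr
        _ ≤ _ := by
            refine mul_le_mul_of_nonneg_right ?_ (majorant_nonneg v ε hx t)
            rw [pow_zero, mul_one]; linarith
    | succ k ih =>
      intro t ht x hx
      refine (hstep _ (by positivity) ih t ht x hx).trans_eq ?_
      ring
  intro t ht x hx
  have hlim : Filter.Tendsto (fun k : ℕ => (2 * C₁ + V / √ε * (1 / 2) ^ k) * majorant v ε x t)
      Filter.atTop (nhds ((2 * C₁ + V / √ε * 0) * majorant v ε x t)) :=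
    (((tendsto_pow_atTop_nhds_zero_of_lt_one (by norm_num) (by norm_num)).const_mul _).const_add
      _).mul_const _
  rw [mul_zero, add_zero] at hlim
  exact ge_of_tendsto' hlim fun k => key k t ht x hx

lemma majorant_le_of_norm_le (hv : DiscSubsolution 𝒞 A B T v) (hE : SmallEnergy T v ε)
    {x : Plane} (hx : ‖x‖ ≤ 3 / 5) {t : ℝ} (ht : 1 / 2 ≤ t) (htT : t ≤ T) :
    majorant v ε x t ≤ 4 * √ε := by
  have ht0 : 0 < t := by linarith
  have h1 := sqrt_heatAverage_le (hv.boundedOnDisc_init ⟨ht0, htT⟩) (fun _ _ => sq_nonneg _)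
    hE.init ht0 x
  have h2 : (√t)⁻¹ ≤ 2 := by
    have h3 : 1 / 2 ≤ √t := Real.le_sqrt_of_sq_le (by linarith)
    rw [inv_le_comm₀ (by linarith) (by norm_num)]
    linarith
  have h16 : 16 / 25 ≤ 1 - ‖x‖ ^ 2 := by nlinarith [norm_nonneg x]
  have h4 : √ε / (1 - ‖x‖ ^ 2) ≤ 2 * √ε := by
    rw [div_le_iff₀ (by linarith)]
    nlinarith [Real.sqrt_nonneg ε]
  have h5 : √ε * (√t)⁻¹ ≤ √ε * 2 := by gcongr
  unfold majorant
  linarith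

/-- The regularity theorem on the unit disc. -/
theorem exists_disc_bound : ∃ C : ℝ, 0 < C ∧ ∃ K₀ : ℝ, 0 < K₀ ∧ ∃ ε₀ : ℝ → ℝ, (∀ A, 0 < ε₀ A) ∧
    ∀ (𝒞 : Coefficients) (A B T ε : ℝ) (v : Plane → ℝ → ℝ), 𝒞.NearlyFlat K₀ → |B| ≤ K₀ →
      DiscSubsolution 𝒞 A B T v → SmallEnergy T v ε → ε < ε₀ A →
      ∀ x : Plane, ‖x‖ ≤ 3 / 5 → ∀ t, 1 / 2 ≤ t → t ≤ T → v x t ≤ C * √ε := by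
  obtain ⟨C, hC, hlin⟩ := exists_linear_step
  -- `σ` plays the role of `√τ`. By `120 C ≤ σ` the contribution `15 / √τ` to the step factor, times
  -- `C`, is at most `1/8`. The thresholds for `K`, `ε`, `h` and `B` then give shares `1/8`, `1/8`,
  -- `1/16` and `1/16`, which sum with the first to `1/2`.
  set σ := max 1 (120 * C) with hσ
  have hσ1 : 1 ≤ σ := le_max_left _ _
  have hσC : 120 * C ≤ σ := le_max_right _ _
  set C₁ := C * (6 + 3 * σ) with hC₁
  have hC₁0 : 0 < C₁ := by positivity
  -- The fixed point of the improvement `N ↦ C₁ + N / 2`. It is also the constant assumed on earlier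
  -- times, so the induction in time reproduces its hypothesis without loss.
  set κ := 2 * C₁ with hκ
  refine ⟨4 * κ, by positivity, min 1 (1 / (512 * C * σ ^ 2)), by positivity,
    fun A => 1 / (16384 * C * κ ^ 2 * σ ^ 2 * (|A| + 1)), fun A => by positivity,
    fun 𝒞 A B T ε v h𝒞 hB hv hE hεA x hx t ht htT => ?_⟩
  set K := min 1 (1 / (512 * C * σ ^ 2)) with hK
  have hK1 : K * (512 * C * σ ^ 2) ≤ 1 := by
    rw [← le_div_iff₀ (by positivity)]; exact min_le_right _ _
  have hK0 : 0 < K := by positivity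
  have hε := hE.pos
  have hε1 : ε * (16384 * C * κ ^ 2 * σ ^ 2 * (|A| + 1)) ≤ 1 := by
    rw [← le_div_iff₀ (by positivity)]; exact hεA.le
  obtain ⟨V, hV0, hV⟩ := hv.exists_bound
  -- The time step may depend on the supremum of this particular `v`, since the final bound does not
  -- contain `h`.
  set h := 1 / (512 * C * (|A| + 1) * (V ^ 2 + 1)) with hh
  have hh0 : 0 < h := by positivity
  have hsq : √(σ ^ 2) = σ := Real.sqrt_sq (by linarith)
  have hfac : C * stepFactor K A B (σ ^ 2) ε κ V h ≤ 1 / 2 := by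
    unfold stepFactor
    rw [hsq]
    have f1 : C * (15 / σ) ≤ 1 / 8 := by
      rw [mul_div_assoc', div_le_iff₀ (by linarith)]; linarith
    have f2 : C * (64 * K * σ) ≤ 1 / 8 := by
      have : C * (64 * K * σ) ≤ C * (64 * K * σ ^ 2) := by gcongr; nlinarith
      linarith
    have f3 : C * (2048 * |A| * κ ^ 2 * ε * σ ^ 2) ≤ 1 / 8 := by
      have : C * (2048 * |A| * κ ^ 2 * ε * σ ^ 2) ≤ C * (2048 * (|A| + 1) * κ ^ 2 * ε * σ ^ 2) := by
        gcongr; linarith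
      linarith
    have f4 : C * (32 * |A| * V ^ 2 * h) ≤ 1 / 16 := by
      have : C * (32 * |A| * V ^ 2 * h) ≤ C * (32 * (|A| + 1) * (V ^ 2 + 1) * h) := by
        gcongr <;> linarith
      refine this.trans_eq ?_
      rw [hh]; field_simp; norm_num
    have f5 : C * (32 * |B| * σ ^ 2) ≤ 1 / 16 := by
      have : C * (32 * |B| * σ ^ 2) ≤ C * (32 * K * σ ^ 2) := by gcongr
      linarith
    linarith
  -- Up to time `n h` the square of `v` is bounded by the induction hypothesis, and between `n h`
  -- and `(n + 1) h` by `V²`; the shortness of this interval makes the crude bound harmless.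
  have hind : ∀ n : ℕ, ∀ t ∈ Ioc 0 (min (n * h) T), ∀ x ∈ disc, v x t ≤ κ * majorant v ε x t := by
    intro n
    induction n with
    | zero =>
      intro t ht
      have := ht.2.trans (min_le_left _ _)
      simp at this
      exact absurd ht.1 (not_lt.2 this)
    | succ n ih =>
      refine le_majorant_of_step hV0 hε (fun t ht x hx => hV x hx t
        ⟨ht.1.le, ht.2.trans (min_le_right _ _)⟩) hC₁0.le fun N hN0 hN t ht x hx => ?_
      have htT : t ∈ Ioc 0 T := ⟨ht.1, ht.2.trans (min_le_right _ _)⟩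
      have hsub : ∀ s ∈ Ioc 0 t, s ∈ Ioc 0 (min (((n + 1 : ℕ) : ℝ) * h) T) :=
        fun s hs => ⟨hs.1, hs.2.trans ht.2⟩
      have := hlin 𝒞 K A B T ε v h𝒞 (min_le_left _ _) hv hE (σ ^ 2) N κ V (n * h) h
        (one_le_pow₀ hσ1) hN0 hh0.le x hx t htT
        (by have := ht.2.trans (min_le_left _ _); push_cast at this; linarith)
        (fun s hs => hN s (hsub s hs)) fun s hs y hy => by
          have hsT : s ∈ Ioc 0 T := ⟨hs.1, hs.2.trans htT.2⟩
          have hv0 := hv.nonneg y (Metric.ball_subset_closedBall hy) s ⟨hsT.1.le, hsT.2⟩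
          rcases le_or_gt s (n * h) with hsn | hsn
          · rw [indicator_of_notMem (by simpa using hsn), add_zero, ← mul_pow]
            have := ih s ⟨hs.1, le_min hsn hsT.2⟩ y hy
            gcongr
          · rw [indicator_of_mem (by simpa using hsn)]
            have h1 := hV y hy s ⟨hsT.1.le, hsT.2⟩
            have h2 : v y s ^ 2 ≤ V ^ 2 := by gcongr
            have h3 : 0 ≤ κ ^ 2 * majorant v ε y s ^ 2 := by positivity
            linarith
      refine this.trans (mul_le_mul_of_nonneg_right ?_ (majorant_nonneg v ε hx t))
      rw [hsq]
      nlinarith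
  obtain ⟨n, hn⟩ := exists_nat_ge (T / h)
  rw [div_le_iff₀ hh0] at hn
  have hx1 : x ∈ disc := by rw [Metric.mem_ball, dist_zero_right]; linarith
  have hfin := hind n t ⟨by linarith, le_min (htT.trans hn) htT⟩ x hx1
  have hm := majorant_le_of_norm_le hv hE hx ht htT
  calc v x t ≤ κ * majorant v ε x t := hfin
    _ ≤ κ * (4 * √ε) := by gcongr
    _ = _ := by ring

end

/-! ### The Laplace-Beltrami operator of a metric on the plane -/

/-- The Jacobian matrix of a map of the plane. -/
def jacobian (Φ : Plane → Plane) (z : Plane) : Matrix (Fin 2) (Fin 2) ℝ :=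
  Matrix.of fun k i => partialD i (fun y => Φ y k) z

/-- The components of the vector field `√(det G) G⁻¹ ∇ f`. -/
def flux (G : Plane → Matrix (Fin 2) (Fin 2) ℝ) (f : Plane → ℝ) (k : Fin 2) (z : Plane) : ℝ :=
  √(G z).det * ∑ j, (G z)⁻¹ k j * partialD j f z

/-- The Laplace-Beltrami operator of the metric with coefficient matrix `G`. -/
def flatLaplacian (G : Plane → Matrix (Fin 2) (Fin 2) ℝ) (f : Plane → ℝ) (y : Plane) : ℝ :=
  (√(G y).det)⁻¹ * ∑ i, partialD i (flux G f i) y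

lemma plane_eq_sum (v : Plane) : v = ∑ k, v k • e k := by
  ext i
  fin_cases i <;> simp [e, Fin.sum_univ_two]

lemma fderiv_apply_eq_sum_partialD (f : Plane → ℝ) (x v : Plane) :
    fderiv ℝ f x v = ∑ k, v k * partialD k f x := by
  conv_lhs => rw [plane_eq_sum v]
  simp [partialD]

lemma fderiv_plane_apply {Φ : Plane → Plane} {z : Plane} (hΦ : DifferentiableAt ℝ Φ z) (i k : Fin 2) :
    fderiv ℝ Φ z (e i) k = jacobian Φ z k i := by
  have h := ((EuclideanSpace.proj k : Plane →L[ℝ] ℝ).hasFDerivAt.comp z hΦ.hasFDerivAt).fderiv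
  have : jacobian Φ z k i = fderiv ℝ ((EuclideanSpace.proj k : Plane →L[ℝ] ℝ) ∘ Φ) z (e i) := rfl
  rw [this, h]
  simp

lemma partialD_comp_map {f : Plane → ℝ} {Φ : Plane → Plane} {z : Plane}
    (hf : DifferentiableAt ℝ f (Φ z)) (hΦ : DifferentiableAt ℝ Φ z) (i : Fin 2) :
    partialD i (f ∘ Φ) z = ∑ k, jacobian Φ z k i * partialD k f (Φ z) := by
  unfold partialD
  rw [fderiv_comp z hf hΦ]
  simp only [ContinuousLinearMap.comp_apply]
  rw [fderiv_apply_eq_sum_partialD]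
  simp [fderiv_plane_apply hΦ, partialD]

lemma _root_.ContDiffAt.partialD {f : Plane → ℝ} {y : Plane} {m n : ℕ∞ω} (hf : ContDiffAt ℝ n f y)
    (hmn : m + 1 ≤ n) (i : Fin 2) : ContDiffAt ℝ m (partialD i f) y :=
  (hf.fderiv_right hmn).clm_apply contDiffAt_const

lemma partialD_partialD_symm {f : Plane → ℝ} {y : Plane} (hf : ContDiffAt ℝ 2 f y) (i j : Fin 2) :
    partialD i (partialD j f) y = partialD j (partialD i f) y := by
  have h : ∀ i j, partialD i (partialD j f) y = fderiv ℝ (fderiv ℝ f) y (e i) (e j) := fun i j => by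
    have hd : DifferentiableAt ℝ (fderiv ℝ f) y :=
      (hf.fderiv_right (m := 1) (by norm_num)).differentiableAt one_ne_zero
    have e1 : partialD j f = fun z => fderiv ℝ f z (e j) := rfl
    rw [e1]
    unfold partialD
    rw [fderiv_clm_apply hd (differentiableAt_const _)]
    simp
  rw [h, h]
  exact (hf.isSymmSndFDerivAt (by simp)) (e i) (e j)

lemma contDiffAt_plane_apply {Φ : Plane → Plane} {y : Plane} {n : ℕ∞ω} (hΦ : ContDiffAt ℝ n Φ y)
    (k : Fin 2) : ContDiffAt ℝ n (fun z => Φ z k) y :=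
  (EuclideanSpace.proj k : Plane →L[ℝ] ℝ).contDiff.contDiffAt.comp y hΦ

lemma contDiffAt_jacobian {Φ : Plane → Plane} {y : Plane} {m n : ℕ∞ω} (hΦ : ContDiffAt ℝ n Φ y)
    (hmn : m + 1 ≤ n) (k i : Fin 2) : ContDiffAt ℝ m (fun z => jacobian Φ z k i) y :=
  (contDiffAt_plane_apply hΦ k).partialD hmn i

lemma partialD_sub {f g : Plane → ℝ} {x : Plane} (hf : DifferentiableAt ℝ f x)
    (hg : DifferentiableAt ℝ g x) (j : Fin 2) :
    partialD j (fun y => f y - g y) x = partialD j f x - partialD j g x := by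
  simp only [partialD]
  rw [fderiv_fun_sub hf hg]
  simp

/-- The Piola identity. -/
lemma sum_partialD_adjugate {Φ : Plane → Plane} {y : Plane} (hΦ : ContDiffAt ℝ 2 Φ y)
    {X : Fin 2 → Plane → ℝ} (hX : ∀ k, DifferentiableAt ℝ (X k) (Φ y)) :
    ∑ i, partialD i (fun z => ∑ k, (jacobian Φ z).adjugate i k * X k (Φ z)) y =
      (jacobian Φ y).det * ∑ k, partialD k (X k) (Φ y) := by
  have hd : DifferentiableAt ℝ Φ y := hΦ.differentiableAt two_ne_zero
  have hJ : ∀ k i, DifferentiableAt ℝ (fun z => jacobian Φ z k i) y := fun k i =>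
    (contDiffAt_jacobian hΦ (m := 1) (by norm_num) k i).differentiableAt one_ne_zero
  have hXΦ : ∀ k, DifferentiableAt ℝ (fun z => X k (Φ z)) y := fun k => (hX k).comp y hd
  -- Equality of mixed derivatives makes the rows of the adjugate Jacobian divergence free, so only
  -- derivatives of `X` survive.
  have hs : ∀ k, partialD 0 (fun z => jacobian Φ z k 1) y = partialD 1 (fun z => jacobian Φ z k 0) y :=
    fun k => partialD_partialD_symm (contDiffAt_plane_apply hΦ k) 0 1
  have hc : ∀ i k, partialD i (fun z => X k (Φ z)) y =
      ∑ l, jacobian Φ y l i * partialD l (X k) (Φ y) := fun i k => partialD_comp_map (hX k) hd i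
  have hm : ∀ i k a b, partialD i (fun z => jacobian Φ z a b * X k (Φ z)) y =
      partialD i (fun z => jacobian Φ z a b) y * X k (Φ y) +
        jacobian Φ y a b * partialD i (fun z => X k (Φ z)) y := fun i k a b => by
    rw [partialD_mul (hJ a b) (hXΦ k)]
  have e0 : (fun z => ∑ k, (jacobian Φ z).adjugate 0 k * X k (Φ z)) = fun z =>
      jacobian Φ z 1 1 * X 0 (Φ z) - jacobian Φ z 0 1 * X 1 (Φ z) := by
    ext z; simp [Matrix.adjugate_fin_two, Fin.sum_univ_two]; ring
  have e1 : (fun z => ∑ k, (jacobian Φ z).adjugate 1 k * X k (Φ z)) = fun z =>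
      jacobian Φ z 0 0 * X 1 (Φ z) - jacobian Φ z 1 0 * X 0 (Φ z) := by
    ext z; simp [Matrix.adjugate_fin_two, Fin.sum_univ_two]; ring
  have hJX : ∀ a b k, DifferentiableAt ℝ (fun z => jacobian Φ z a b * X k (Φ z)) y :=
    fun a b k => (hJ a b).mul (hXΦ k)
  rw [Fin.sum_univ_two, e0, e1, partialD_sub (hJX 1 1 0) (hJX 0 1 1),
    partialD_sub (hJX 0 0 1) (hJX 1 0 0)]
  simp only [hm, hc, Fin.sum_univ_two, hs, Matrix.det_fin_two]
  ring

lemma inv_fin_two_apply (G : Matrix (Fin 2) (Fin 2) ℝ) (i j : Fin 2) :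
    G⁻¹ i j = G.det⁻¹ * G.adjugate i j := by
  rw [Matrix.inv_def, Matrix.smul_apply, Ring.inverse_eq_inv', smul_eq_mul]

section Smooth

variable {G : Plane → Matrix (Fin 2) (Fin 2) ℝ} {y : Plane} {n : ℕ∞ω}

lemma contDiffAt_det (hG : ∀ i j, ContDiffAt ℝ n (fun z => G z i j) y) :
    ContDiffAt ℝ n (fun z => (G z).det) y := by
  simp only [Matrix.det_fin_two]
  exact ((hG 0 0).mul (hG 1 1)).sub ((hG 0 1).mul (hG 1 0))

lemma contDiffAt_inv (hG : ∀ i j, ContDiffAt ℝ n (fun z => G z i j) y) (hdet : 0 < (G y).det)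
    (i j : Fin 2) : ContDiffAt ℝ n (fun z => (G z)⁻¹ i j) y := by
  simp only [inv_fin_two_apply]
  refine ((contDiffAt_det hG).inv hdet.ne').mul ?_
  simp only [Matrix.adjugate_fin_two]
  fin_cases i <;> fin_cases j <;> simp
  · exact hG 1 1
  · exact (hG 0 1).neg
  · exact (hG 1 0).neg
  · exact hG 0 0

lemma contDiffAt_sqrt_det (hG : ∀ i j, ContDiffAt ℝ n (fun z => G z i j) y)
    (hdet : 0 < (G y).det) : ContDiffAt ℝ n (fun z => √(G z).det) y :=
  (contDiffAt_det hG).sqrt hdet.ne'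

lemma contDiffAt_flux {f : Plane → ℝ} {m : ℕ∞ω} (hG : ∀ i j, ContDiffAt ℝ n (fun z => G z i j) y)
    (hdet : 0 < (G y).det) (hf : ContDiffAt ℝ m f y) (hnm : n + 1 ≤ m) (k : Fin 2) :
    ContDiffAt ℝ n (flux G f k) y := by
  refine (contDiffAt_sqrt_det hG hdet).mul (ContDiffAt.sum fun j _ => ?_)
  exact (contDiffAt_inv hG hdet k j).mul (hf.partialD hnm j)

end Smooth

/-- The flux of the metric pulled back by `Φ`. -/
lemma flux_pullback {Φ : Plane → Plane} {G : Matrix (Fin 2) (Fin 2) ℝ}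
    {J : Matrix (Fin 2) (Fin 2) ℝ} (hJ : J.det ≠ 0) (u : Fin 2 → ℝ) (i : Fin 2) :
    √(J.transpose * G * J).det * ∑ j, (J.transpose * G * J)⁻¹ i j * ∑ k, J k j * u k =
      SignType.sign J.det * ∑ k, J.adjugate i k * (√G.det * ∑ j, G⁻¹ k j * u j) := by
  have hJt : IsUnit J.transpose.det := by rw [Matrix.det_transpose]; exact hJ.isUnit
  have h1 : (J.transpose * G * J).det = J.det ^ 2 * G.det := by
    rw [Matrix.det_mul, Matrix.det_mul, Matrix.det_transpose]; ring
  -- The root produces `|det J|`, while the adjugate contains `det J` with its sign; this explains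
  -- the sign in the statement.
  have h2 : √(J.transpose * G * J).det = SignType.sign J.det * J.det * √G.det := by
    rw [h1, Real.sqrt_mul (sq_nonneg _), Real.sqrt_sq_eq_abs, sign_mul_self]
  have h3 : ∑ j, (J.transpose * G * J)⁻¹ i j * ∑ k, J k j * u k =
      ((J.transpose * G * J)⁻¹.mulVec (J.transpose.mulVec u)) i := by
    simp [Matrix.mulVec, dotProduct]
  have h4 : ∑ k, J.adjugate i k * (√G.det * ∑ j, G⁻¹ k j * u j) =
      √G.det * (J.adjugate.mulVec (G⁻¹.mulVec u)) i := by
    simp only [Matrix.mulVec, dotProduct, Finset.mul_sum]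
    refine Finset.sum_congr rfl fun k _ => Finset.sum_congr rfl fun j _ => by ring
  rw [h2, h3, h4, Matrix.mul_inv_rev, Matrix.mul_inv_rev, Matrix.mulVec_mulVec,
    Matrix.mul_assoc, Matrix.mul_assoc, Matrix.nonsing_inv_mul _ hJt, Matrix.mul_one,
    ← Matrix.mulVec_mulVec]
  have h5 : J⁻¹ = J.det⁻¹ • J.adjugate := by rw [Matrix.inv_def, Ring.inverse_eq_inv']
  rw [h5, Matrix.smul_mulVec]
  simp only [Pi.smul_apply, smul_eq_mul]
  field_simp

/-- The Laplace-Beltrami operator is invariant under changes of coordinates. -/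
lemma flatLaplacian_comp {Φ : Plane → Plane} {G G' : Plane → Matrix (Fin 2) (Fin 2) ℝ}
    {f : Plane → ℝ} {y : Plane} (hΦ : ContDiffAt ℝ 2 Φ y) (hJ : (jacobian Φ y).det ≠ 0)
    (hG : ∀ i j, ContDiffAt ℝ 1 (fun z => G z i j) (Φ y)) (hdet : 0 < (G (Φ y)).det)
    (hf : ContDiffAt ℝ 2 f (Φ y))
    (hG' : ∀ᶠ z in nhds y, G' z = (jacobian Φ z).transpose * G (Φ z) * jacobian Φ z) :
    flatLaplacian G' (f ∘ Φ) y = flatLaplacian G f (Φ y) := by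
  have hcJ : ContinuousAt (fun z => (jacobian Φ z).det) y :=
    (contDiffAt_det fun i j => contDiffAt_jacobian hΦ (m := 1) (by norm_num) i j).continuousAt
  have hd : ∀ᶠ z in nhds y, DifferentiableAt ℝ Φ z :=
    (hΦ.eventually (by simp)).mono fun z hz => hz.differentiableAt two_ne_zero
  have hfd : ∀ᶠ z in nhds y, DifferentiableAt ℝ f (Φ z) :=
    hΦ.continuousAt.eventually
      ((hf.eventually (by simp)).mono fun z hz => hz.differentiableAt two_ne_zero)
  -- The sign is locally constant and passes through the derivatives. At the end it turns `det J`
  -- into `|det J|`, which cancels against the density of the pulled back metric.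
  have hsign : ∀ᶠ z in nhds y,
      (SignType.sign (jacobian Φ z).det : ℝ) = SignType.sign (jacobian Φ y).det := by
    rcases hJ.lt_or_gt with h | h
    · filter_upwards [hcJ.eventually_lt continuousAt_const h] with z hz
      rw [sign_neg hz, sign_neg h]
    · filter_upwards [continuousAt_const.eventually_lt hcJ h] with z hz
      rw [sign_pos hz, sign_pos h]
  have hne : ∀ᶠ z in nhds y, (jacobian Φ z).det ≠ 0 := hcJ.eventually_ne hJ
  set σ : ℝ := ((SignType.sign (jacobian Φ y).det : SignType) : ℝ) with hσ
  have hσ2 : σ * (jacobian Φ y).det = |(jacobian Φ y).det| := sign_mul_self _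
  have hflux : ∀ i, flux G' (f ∘ Φ) i =ᶠ[nhds y]
      fun z => σ * ∑ k, (jacobian Φ z).adjugate i k * flux G f k (Φ z) := fun i => by
    filter_upwards [hG', hd, hfd, hsign, hne] with z h1 h2 h3 h4 h5
    rw [← h4]
    unfold flux
    rw [h1, ← flux_pullback (Φ := Φ) h5]
    simp only [partialD_comp_map h3 h2]
  have hX : ∀ k, DifferentiableAt ℝ (flux G f k) (Φ y) := fun k =>
    (contDiffAt_flux hG hdet hf (by norm_num) k).differentiableAt one_ne_zero
  unfold flatLaplacian
  have h1 : ∀ i, partialD i (flux G' (f ∘ Φ) i) y =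
      σ * partialD i (fun z => ∑ k, (jacobian Φ z).adjugate i k * flux G f k (Φ z)) y := fun i => by
    rw [← congrFun (partialD_const_mul i σ _) y]
    unfold partialD
    rw [(hflux i).fderiv_eq]
  simp only [h1]
  rw [← Finset.mul_sum, sum_partialD_adjugate hΦ hX, hG'.self_of_nhds, Matrix.det_mul,
    Matrix.det_mul, Matrix.det_transpose]
  have h2 : √((jacobian Φ y).det * (G (Φ y)).det * (jacobian Φ y).det) =
      |(jacobian Φ y).det| * √(G (Φ y)).det := by
    rw [← Real.sqrt_sq_eq_abs, ← Real.sqrt_mul (sq_nonneg _)]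
    congr 1; ring
  rw [h2, ← mul_assoc σ, hσ2]
  have h3 : |(jacobian Φ y).det| ≠ 0 := abs_ne_zero.2 hJ
  have h4 : √(G (Φ y)).det ≠ 0 := (Real.sqrt_pos.2 hdet).ne'
  field_simp

/-- The coefficients of the Laplace-Beltrami operator of the metric `Q`. -/
def metricCoefficients (Q : Plane → Matrix (Fin 2) (Fin 2) ℝ) : Coefficients where
  a i j z := (Q z)⁻¹ i j
  q i j z := Q z i j
  b j z := (√(Q z).det)⁻¹ * ∑ i, partialD i (fun y => √(Q y).det * (Q y)⁻¹ i j) z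
  w z := √(Q z).det

lemma flatLaplacian_eq_op {Q : Plane → Matrix (Fin 2) (Fin 2) ℝ} {f : Plane → ℝ} {y : Plane}
    (hQ : ∀ i j, ContDiffAt ℝ 1 (fun z => Q z i j) y) (hdet : 0 < (Q y).det)
    (hf : ContDiffAt ℝ 2 f y) : flatLaplacian Q f y = (metricCoefficients Q).op f y := by
  have hA : ∀ i j, DifferentiableAt ℝ (fun z => √(Q z).det * (Q z)⁻¹ i j) y := fun i j =>
    ((contDiffAt_sqrt_det hQ hdet).mul (contDiffAt_inv hQ hdet i j)).differentiableAt one_ne_zero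
  have hp : ∀ j, DifferentiableAt ℝ (partialD j f) y := fun j =>
    (hf.partialD (m := 1) (by norm_num) j).differentiableAt one_ne_zero
  have h1 : ∀ i, partialD i (flux Q f i) y = ∑ j,
      (partialD i (fun z => √(Q z).det * (Q z)⁻¹ i j) y * partialD j f y +
        √(Q y).det * (Q y)⁻¹ i j * partialD i (partialD j f) y) := fun i => by
    have e : flux Q f i = fun z => √(Q z).det * (Q z)⁻¹ i 0 * partialD 0 f z +
        √(Q z).det * (Q z)⁻¹ i 1 * partialD 1 f z := by
      ext z; unfold flux; rw [Fin.sum_univ_two]; ring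
    have hm : ∀ j, DifferentiableAt ℝ (fun z => √(Q z).det * (Q z)⁻¹ i j * partialD j f z) y :=
      fun j => (hA i j).mul (hp j)
    rw [e, partialD_add (hm 0) (hm 1), partialD_mul (hA i 0) (hp 0),
      partialD_mul (hA i 1) (hp 1), Fin.sum_univ_two]
  have hw : √(Q y).det ≠ 0 := (Real.sqrt_pos.2 hdet).ne'
  unfold flatLaplacian Coefficients.op
  simp only [h1, metricCoefficients, Fin.sum_univ_two]
  field_simp
  ring

/-- Scaling of the metric. -/
lemma flatLaplacian_smul {Q : Plane → Matrix (Fin 2) (Fin 2) ℝ} {ρ : ℝ} (hρ : 0 < ρ)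
    (f : Plane → ℝ) (y : Plane) :
    flatLaplacian (fun z => ρ ^ 2 • Q z) f y = (ρ ^ 2)⁻¹ * flatLaplacian Q f y := by
  have h1 : ∀ z, √(ρ ^ 2 • Q z).det = ρ ^ 2 * √(Q z).det := fun z => by
    rw [Matrix.det_smul, Fintype.card_fin, Real.sqrt_mul (by positivity),
      Real.sqrt_sq (by positivity)]
  have h2 : ∀ i, flux (fun z => ρ ^ 2 • Q z) f i = flux Q f i := fun i => by
    ext z
    unfold flux
    rw [h1]
    have : ∀ j, (ρ ^ 2 • Q z)⁻¹ i j = (ρ ^ 2)⁻¹ * (Q z)⁻¹ i j := fun j => by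
      rw [inv_fin_two_apply, inv_fin_two_apply, Matrix.det_smul, Matrix.adjugate_smul]
      simp
      field_simp
    simp only [this, Fin.sum_univ_two]
    field_simp
  unfold flatLaplacian
  simp only [h1, h2]
  rw [mul_inv]
  ring

/-! ### The metric in the charts of a surface -/

section Charts

variable {M : Type*} [TopologicalSpace M] [ChartedSpace Plane M]

lemma contMDiffOn_chartAt_symm [IsManifold 𝓘(ℝ, Plane) ∞ M] (c : M) :
    ContMDiffOn 𝓘(ℝ, Plane) 𝓘(ℝ, Plane) ∞ (chartAt Plane c).symm (chartAt Plane c).target :=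
  contMDiffOn_chart_symm

lemma mdifferentiableAt_chartAt_symm [IsManifold 𝓘(ℝ, Plane) ∞ M] {c : M} {z : Plane}
    (hz : z ∈ (chartAt Plane c).target) :
    MDifferentiableAt 𝓘(ℝ, Plane) 𝓘(ℝ, Plane) (chartAt Plane c).symm z :=
  ((contMDiffOn_chartAt_symm c).contMDiffAt
    ((chartAt Plane c).open_target.mem_nhds hz)).mdifferentiableAt (by simp)

/-- The transition from the chart at `c` to the chart at `c'`. -/
def transitionMap (c c' : M) : Plane → Plane := chartAt Plane c' ∘ (chartAt Plane c).symm

lemma contDiffAt_transitionMap [IsManifold 𝓘(ℝ, Plane) ∞ M] {c c' : M} {z : Plane}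
    (hz : z ∈ (chartAt Plane c).target) (hz' : (chartAt Plane c).symm z ∈ (chartAt Plane c').source) :
    ContDiffAt ℝ ∞ (transitionMap c c') z := by
  rw [← contMDiffAt_iff_contDiffAt]
  refine ContMDiffAt.comp z (I' := 𝓘(ℝ, Plane)) ?_ ((contMDiffOn_chartAt_symm c).contMDiffAt
    ((chartAt Plane c).open_target.mem_nhds hz))
  exact contMDiffOn_chart.contMDiffAt ((chartAt Plane c').open_source.mem_nhds hz')

lemma symm_transitionMap {c c' : M} {z : Plane}
    (hz' : (chartAt Plane c).symm z ∈ (chartAt Plane c').source) :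
    (chartAt Plane c').symm (transitionMap c c' z) = (chartAt Plane c).symm z :=
  (chartAt Plane c').left_inv hz'

lemma transitionMap_mem_target {c c' : M} {z : Plane}
    (hz' : (chartAt Plane c).symm z ∈ (chartAt Plane c').source) :
    transitionMap c c' z ∈ (chartAt Plane c').target :=
  (chartAt Plane c').map_source hz'

lemma eventually_mem_source {c c' : M} {z : Plane} (hz : z ∈ (chartAt Plane c).target)
    (hz' : (chartAt Plane c).symm z ∈ (chartAt Plane c').source) :
    ∀ᶠ y in nhds z, y ∈ (chartAt Plane c).target ∧
      (chartAt Plane c).symm y ∈ (chartAt Plane c').source :=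
  ((chartAt Plane c).open_target.mem_nhds hz |> Filter.eventually_mem_set.2).and
    (((chartAt Plane c).symm.continuousAt hz).eventually
      ((chartAt Plane c').open_source.mem_nhds hz'))

variable [RiemannianBundle (fun x : M => TangentSpace 𝓘(ℝ, Plane) x)]

/-- The Riemannian metric, with tangent spaces identified with the plane. -/
def metricForm (x : M) (u v : Plane) : ℝ :=
  inner ℝ (E := TangentSpace 𝓘(ℝ, Plane) x) u v

lemma metricForm_sum (x : M) (u : Fin 2 → Plane) (a b : Fin 2 → ℝ) :
    metricForm x (∑ i, a i • u i) (∑ j, b j • u j) =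
      ∑ i, ∑ j, a i * b j * metricForm x (u i) (u j) := by
  have h := sum_inner (𝕜 := ℝ) (E := TangentSpace 𝓘(ℝ, Plane) x) Finset.univ (fun i => a i • u i)
    (∑ j, b j • u j)
  refine h.trans (Finset.sum_congr rfl fun i _ => ?_ : _ = ∑ i, ∑ j, _)
  refine (inner_sum (𝕜 := ℝ) (E := TangentSpace 𝓘(ℝ, Plane) x) Finset.univ (fun j => b j • u j)
    (a i • u i)).trans (Finset.sum_congr rfl fun j _ => ?_)
  have h2 := real_inner_smul_left (F := TangentSpace 𝓘(ℝ, Plane) x) (u i) (b j • u j) (a i)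
  have h3 := real_inner_smul_right (F := TangentSpace 𝓘(ℝ, Plane) x) (u i) (u j) (b j)
  refine h2.trans ?_
  rw [mul_assoc]
  exact congrArg (a i * ·) h3

/-- The derivative of the inverse chart. -/
def chartDeriv (c : M) (z : Plane) : Plane →L[ℝ] Plane :=
  mfderiv 𝓘(ℝ, Plane) 𝓘(ℝ, Plane) (chartAt Plane c).symm z

lemma gram_apply (c : M) (z : Plane) (i j : Fin 2) :
    gram c z i j =
      metricForm ((chartAt Plane c).symm z) (chartDeriv c z (e i)) (chartDeriv c z (e j)) := rfl

lemma metricForm_chartDeriv (c : M) (z ξ η : Plane) :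
    metricForm ((chartAt Plane c).symm z) (chartDeriv c z ξ) (chartDeriv c z η) =
      ∑ i, ∑ j, ξ i * η j * gram c z i j := by
  conv_lhs => rw [plane_eq_sum ξ, plane_eq_sum η]
  rw [map_sum, map_sum]
  simp only [map_smul]
  exact metricForm_sum _ _ _ _

lemma chartDeriv_comp [IsManifold 𝓘(ℝ, Plane) ∞ M] {c c' : M} {z : Plane}
    (hz : z ∈ (chartAt Plane c).target)
    (hz' : (chartAt Plane c).symm z ∈ (chartAt Plane c').source) (ξ : Plane) :
    chartDeriv c z ξ = chartDeriv c' (transitionMap c c' z) (fderiv ℝ (transitionMap c c') z ξ) := by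
  have h1 : (chartAt Plane c).symm =ᶠ[nhds z] (chartAt Plane c').symm ∘ transitionMap c c' := by
    filter_upwards [eventually_mem_source hz hz'] with y hy
    exact (symm_transitionMap hy.2).symm
  have hd := (contDiffAt_transitionMap hz hz').differentiableAt (by simp)
  have h2 := mfderiv_comp z (I' := 𝓘(ℝ, Plane))
    (mdifferentiableAt_chartAt_symm (transitionMap_mem_target hz')) hd.mdifferentiableAt
  have h3 := h1.mfderiv_eq (I := 𝓘(ℝ, Plane)) (I' := 𝓘(ℝ, Plane))
  rw [h2, mfderiv_eq_fderiv] at h3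
  exact congrArg (fun f : Plane →L[ℝ] Plane => f ξ) h3

lemma gram_transition [IsManifold 𝓘(ℝ, Plane) ∞ M] {c c' : M} {z : Plane}
    (hz : z ∈ (chartAt Plane c).target)
    (hz' : (chartAt Plane c).symm z ∈ (chartAt Plane c').source) :
    gram c z = (jacobian (transitionMap c c') z).transpose * gram c' (transitionMap c c' z) *
      jacobian (transitionMap c c') z := by
  have hd := (contDiffAt_transitionMap hz hz').differentiableAt (by simp)
  ext i j
  rw [gram_apply, chartDeriv_comp hz hz', chartDeriv_comp hz hz', ← symm_transitionMap hz',
    metricForm_chartDeriv]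
  simp only [fderiv_plane_apply hd, Matrix.mul_apply, Matrix.transpose_apply, Fin.sum_univ_two]
  ring

lemma gram_symm (c : M) (z : Plane) (i j : Fin 2) : gram c z i j = gram c z j i := by
  exact real_inner_comm (F := TangentSpace 𝓘(ℝ, Plane) ((chartAt Plane c).symm z)) _ _

lemma quadForm_gram_pos [IsManifold 𝓘(ℝ, Plane) ∞ M] {c : M} {z : Plane}
    (hz : z ∈ (chartAt Plane c).target) {ξ : Plane} (hξ : ξ ≠ 0) :
    0 < ∑ i, ∑ j, ξ i * ξ j * gram c z i j := by
  rw [← metricForm_chartDeriv]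
  have hinj : Function.Injective (chartDeriv c z) :=
    (mdifferentiable_chart (I := 𝓘(ℝ, Plane)) c).symm.mfderiv_injective hz
  have h0 : chartDeriv c z ξ ≠ 0 := fun h => hξ (hinj (h.trans (map_zero _).symm))
  exact real_inner_self_pos.2 h0

lemma gram_zero_zero_pos [IsManifold 𝓘(ℝ, Plane) ∞ M] {c : M} {z : Plane}
    (hz : z ∈ (chartAt Plane c).target) : 0 < gram c z 0 0 := by
  have h := quadForm_gram_pos hz (ξ := e 0) (fun h => by
    have := congrArg (fun v : Plane => v 0) h
    simp [e] at this)
  simpa [e, Fin.sum_univ_two] using h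

lemma det_gram_pos [IsManifold 𝓘(ℝ, Plane) ∞ M] {c : M} {z : Plane}
    (hz : z ∈ (chartAt Plane c).target) : 0 < (gram c z).det := by
  have h0 := gram_zero_zero_pos hz
  -- The value of the quadratic form at this vector is `g₀₀ det g`.
  set ξ : Plane := !₂[-gram c z 0 1, gram c z 0 0] with hξ
  have e0 : ξ 0 = -gram c z 0 1 := rfl
  have e1 : ξ 1 = gram c z 0 0 := rfl
  have h := quadForm_gram_pos hz (ξ := ξ) (fun h => by
    rw [h] at e1
    simp at e1
    exact h0.ne e1)
  simp only [Fin.sum_univ_two, e0, e1] at h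
  rw [Matrix.det_fin_two]
  rw [gram_symm c z 1 0] at h ⊢
  refine pos_of_mul_pos_right (a := gram c z 0 0) ?_ h0.le
  nlinarith

variable [IsManifold 𝓘(ℝ, Plane) ∞ M] [IsContMDiffRiemannianBundle 𝓘(ℝ, Plane) ∞ Plane
          (fun x : M => TangentSpace 𝓘(ℝ, Plane) x)]

lemma contMDiffOn_coordVec (c : M) (i : Fin 2) :
    ContMDiffOn 𝓘(ℝ, Plane) 𝓘(ℝ, Plane).tangent ∞
      (fun z => (⟨(chartAt Plane c).symm z, coordVec c i z⟩ : TangentBundle 𝓘(ℝ, Plane) M))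
      (chartAt Plane c).target := by
  have h1 := (contMDiffOn_chartAt_symm c).contMDiffOn_tangentMapWithin (m := ∞) (by simp)
    (chartAt Plane c).open_target.uniqueMDiffOn
  have h2 : ContMDiff 𝓘(ℝ, Plane) 𝓘(ℝ, Plane).tangent ∞
      (fun z => (⟨z, e i⟩ : TangentBundle 𝓘(ℝ, Plane) Plane)) :=
    contMDiff_vectorSpace_iff_contDiff.2 contDiff_const
  refine (h1.comp h2.contMDiffOn fun z hz => hz).congr fun z hz => ?_
  simp only [Function.comp_apply, tangentMapWithin, coordVec]
  rw [mfderivWithin_of_isOpen (chartAt Plane c).open_target hz]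

lemma contDiffAt_gram {c : M} {z : Plane} (hz : z ∈ (chartAt Plane c).target) (i j : Fin 2) :
    ContDiffAt ℝ ∞ (fun y => gram c y i j) z := by
  have h := ContMDiffOn.inner_bundle (contMDiffOn_coordVec c i) (contMDiffOn_coordVec c j)
  exact (contMDiffOn_iff_contDiffOn.1 h).contDiffAt ((chartAt Plane c).open_target.mem_nhds hz)

end Charts

/-! ### The Riemannian volume in charts -/

lemma det_fderiv_eq_det_jacobian {Φ : Plane → Plane} {z : Plane} (hΦ : DifferentiableAt ℝ Φ z) :
    (fderiv ℝ Φ z).det = (jacobian Φ z).det := by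
  rw [ContinuousLinearMap.det, ← LinearMap.det_toMatrix (EuclideanSpace.basisFun (Fin 2) ℝ).toBasis]
  congr 1
  ext k i
  rw [LinearMap.toMatrix_apply, ← fderiv_plane_apply hΦ]
  simp [e]

lemma measurableSet_inter_preimage_of_continuousOn {X Y : Type*} [TopologicalSpace X]
    [MeasurableSpace X] [OpensMeasurableSpace X] [TopologicalSpace Y] [MeasurableSpace Y]
    [BorelSpace Y] {f : X → Y} {s : Set X} {E : Set Y} (hs : MeasurableSet s)
    (hf : ContinuousOn f s) (hE : MeasurableSet E) : MeasurableSet (s ∩ f ⁻¹' E) := by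
  have h := hs.subtype_image ((continuousOn_iff_continuous_restrict.1 hf).measurable hE)
  convert! h using 1
  ext x
  simp [and_comm]

section Charts

variable {M : Type*} [TopologicalSpace M] [ChartedSpace Plane M] [MeasurableSpace M] [BorelSpace M]
  [RiemannianBundle (fun x : M => TangentSpace 𝓘(ℝ, Plane) x)]

/-- The measure `√(det g) dy` on the range of a chart. -/
def coordVolume (c : M) : Measure Plane :=
  (volume.restrict (chartAt Plane c).target).withDensity fun y => ENNReal.ofReal (volDensity c y)

lemma coordVolume_absolutelyContinuous (c : M) :
    coordVolume c ≪ volume.restrict (chartAt Plane c).target :=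
  withDensity_absolutelyContinuous _ _

lemma aemeasurable_chartAt_symm (c : M) : AEMeasurable (chartAt Plane c).symm (coordVolume c) :=
  ((chartAt Plane c).continuousOn_symm.aemeasurable
    (chartAt Plane c).open_target.measurableSet).mono_ac (coordVolume_absolutelyContinuous c)

lemma measurableEmbedding_chartAt_symm (c : M) :
    MeasurableEmbedding (fun y : (chartAt Plane c).target => (chartAt Plane c).symm y) :=
  (chartAt Plane c).symm.isOpenEmbedding_restrict.measurableEmbedding

lemma coordVolume_restrict_target (c : M) :
    (coordVolume c).restrict (chartAt Plane c).target = coordVolume c := by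
  rw [coordVolume, restrict_withDensity (chartAt Plane c).open_target.measurableSet,
    Measure.restrict_restrict (chartAt Plane c).open_target.measurableSet, inter_self]

lemma map_comap_coordVolume (c : M) :
    ((coordVolume c).comap ((↑) : (chartAt Plane c).target → Plane)).map (↑) = coordVolume c := by
  rw [(MeasurableEmbedding.subtype_coe (chartAt Plane c).open_target.measurableSet).map_comap,
    Subtype.range_coe, coordVolume_restrict_target]

/-- The inverse chart is well behaved only on the target. Passing through the subtype turns it into
a measurable embedding, and the transfer of integrals then needs no measurability of the integrand.
-/
lemma chartVolume_eq_map (c : M) :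
    chartVolume c = ((coordVolume c).comap ((↑) : (chartAt Plane c).target → Plane)).map
      (fun y : (chartAt Plane c).target => (chartAt Plane c).symm y) := by
  have h := AEMeasurable.map_map_of_aemeasurable
    (μ := (coordVolume c).comap ((↑) : (chartAt Plane c).target → Plane))
    (g := (chartAt Plane c).symm) (f := ((↑) : (chartAt Plane c).target → Plane))
    (by rw [map_comap_coordVolume]; exact aemeasurable_chartAt_symm c)
    measurable_subtype_coe.aemeasurable
  rw [map_comap_coordVolume] at h
  exact h

lemma integral_chartVolume (c : M) (F : M → ℝ) :
    ∫ x, F x ∂(chartVolume c) = ∫ z, F ((chartAt Plane c).symm z) ∂(coordVolume c) := by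
  rw [chartVolume_eq_map, (measurableEmbedding_chartAt_symm c).integral_map]
  conv_rhs => rw [← map_comap_coordVolume]
  rw [(MeasurableEmbedding.subtype_coe (chartAt Plane c).open_target.measurableSet).integral_map]

lemma lintegral_chartVolume (c : M) (F : M → ℝ≥0∞) :
    ∫⁻ x, F x ∂(chartVolume c) = ∫⁻ z, F ((chartAt Plane c).symm z) ∂(coordVolume c) := by
  rw [chartVolume_eq_map, (measurableEmbedding_chartAt_symm c).lintegral_map]
  conv_rhs => rw [← map_comap_coordVolume]
  rw [(MeasurableEmbedding.subtype_coe (chartAt Plane c).open_target.measurableSet).lintegral_map]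

lemma measurableSet_target_inter_preimage (c : M) {E : Set M} (hE : MeasurableSet E) :
    MeasurableSet ((chartAt Plane c).target ∩ (chartAt Plane c).symm ⁻¹' E) :=
  measurableSet_inter_preimage_of_continuousOn (chartAt Plane c).open_target.measurableSet
    (chartAt Plane c).continuousOn_symm hE

lemma chartVolume_apply (c : M) {E : Set M} (hE : MeasurableSet E) :
    chartVolume c E = ∫⁻ z in (chartAt Plane c).target ∩ (chartAt Plane c).symm ⁻¹' E,
      ENNReal.ofReal (volDensity c z) := by
  have h0 : chartVolume c = (coordVolume c).map (chartAt Plane c).symm := rfl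
  have hm := measurableSet_target_inter_preimage c hE
  rw [h0, Measure.map_apply_of_aemeasurable (aemeasurable_chartAt_symm c) hE,
    ← coordVolume_restrict_target, Measure.restrict_apply' (chartAt Plane c).open_target.measurableSet,
    inter_comm, coordVolume, withDensity_apply _ hm, Measure.restrict_restrict hm,
    inter_eq_left.2 inter_subset_left]

variable [IsManifold 𝓘(ℝ, Plane) ∞ M]

lemma volDensity_transition {c c' : M} {z : Plane} (hz : z ∈ (chartAt Plane c).target)
    (hz' : (chartAt Plane c).symm z ∈ (chartAt Plane c').source) :
    volDensity c z =
      |(jacobian (transitionMap c c') z).det| * volDensity c' (transitionMap c c' z) := by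
  unfold volDensity
  rw [gram_transition hz hz', Matrix.det_mul, Matrix.det_mul, Matrix.det_transpose,
    ← Real.sqrt_sq_eq_abs, ← Real.sqrt_mul (sq_nonneg _)]
  congr 1; ring

/-- The densities differ by the Jacobian determinant of the transition map, which is injective, so
the area formula carries one integral into the other. -/
lemma chartVolume_le_chartVolume (c c' : M) {E : Set M} (hE : MeasurableSet E)
    (hE' : E ⊆ (chartAt Plane c').source) : chartVolume c E ≤ chartVolume c' E := by
  rw [chartVolume_apply c hE, chartVolume_apply c' hE]
  set S := (chartAt Plane c).target ∩ (chartAt Plane c).symm ⁻¹' E with hS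
  have hSm : MeasurableSet S := measurableSet_target_inter_preimage c hE
  have hd : ∀ z ∈ S, DifferentiableAt ℝ (transitionMap c c') z := fun z hz =>
    (contDiffAt_transitionMap hz.1 (hE' hz.2)).differentiableAt (by simp)
  have hinj : InjOn (transitionMap c c') S := fun z hz z' hz' h =>
    (chartAt Plane c).symm.injOn hz.1 hz'.1 (by
      rw [← symm_transitionMap (hE' hz.2), ← symm_transitionMap (hE' hz'.2), h])
  have himage : transitionMap c c' '' S ⊆
      (chartAt Plane c').target ∩ (chartAt Plane c').symm ⁻¹' E := by
    rintro _ ⟨z, hz, rfl⟩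
    refine ⟨transitionMap_mem_target (hE' hz.2), ?_⟩
    rw [mem_preimage, symm_transitionMap (hE' hz.2)]
    exact hz.2
  calc ∫⁻ z in S, ENNReal.ofReal (volDensity c z)
      = ∫⁻ z in S, ENNReal.ofReal |(fderiv ℝ (transitionMap c c') z).det| *
          ENNReal.ofReal (volDensity c' (transitionMap c c' z)) := by
        refine setLIntegral_congr_fun hSm fun z hz => ?_
        rw [volDensity_transition hz.1 (hE' hz.2), ENNReal.ofReal_mul (abs_nonneg _),
          det_fderiv_eq_det_jacobian (hd z hz)]
    _ = ∫⁻ z in transitionMap c c' '' S, ENNReal.ofReal (volDensity c' z) :=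
        (lintegral_image_eq_lintegral_abs_det_fderiv_mul volume hSm
          (fun z hz => (hd z hz).hasFDerivAt.hasFDerivWithinAt) hinj
          fun z => ENNReal.ofReal (volDensity c' z)).symm
    _ ≤ _ := lintegral_mono_set himage

/-- Inside the domain of `c` no other chart measure exceeds that of `c`, so the supremum of all of
them is attained there by `c`. -/
lemma riemannianVolume_restrict_source (c : M) :
    (riemannianVolume M).restrict (chartAt Plane c).source = chartVolume c := by
  have hs : MeasurableSet (chartAt Plane c).source := (chartAt Plane c).open_source.measurableSet
  have hc0 : chartVolume c (chartAt Plane c).sourceᶜ = 0 := by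
    rw [chartVolume_apply c hs.compl]
    have : (chartAt Plane c).target ∩ (chartAt Plane c).symm ⁻¹' (chartAt Plane c).sourceᶜ = ∅ := by
      ext z
      simp only [mem_inter_iff, mem_preimage, mem_compl_iff, mem_empty_iff_false, iff_false, not_and,
        not_not]
      exact fun hz => (chartAt Plane c).map_target hz
    rw [this]
    simp
  -- A supremum of measures cannot be evaluated set by set, so it is dominated by a measure. The sum
  -- may be large, but it lives off the domain of `c` and disappears after restriction.
  have hle : riemannianVolume M ≤
      chartVolume c + Measure.sum fun x : M => (chartVolume x).restrict (chartAt Plane c).sourceᶜ := by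
    refine iSup_le fun x => Measure.le_iff.2 fun E hE => ?_
    rw [Measure.add_apply, ← measure_inter_add_sdiff E hs]
    refine add_le_add ((chartVolume_le_chartVolume x c (hE.inter hs) inter_subset_right).trans
      (measure_mono inter_subset_left)) ?_
    refine le_trans ?_ (Measure.le_sum (fun x : M => (chartVolume x).restrict
      (chartAt Plane c).sourceᶜ) x E)
    rw [Measure.restrict_apply hE]
    exact le_rfl
  refine le_antisymm (Measure.le_iff.2 fun E hE => ?_) (Measure.le_iff.2 fun E hE => ?_)
  · rw [Measure.restrict_apply hE]
    refine (hle _).trans ?_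
    rw [Measure.add_apply, Measure.sum_apply _ (hE.inter hs)]
    have : ∀ x : M, (chartVolume x).restrict (chartAt Plane c).sourceᶜ
        (E ∩ (chartAt Plane c).source) = 0 := fun x => by
      rw [Measure.restrict_apply (hE.inter hs), inter_assoc, inter_compl_self, inter_empty,
        measure_empty]
    simp only [this, tsum_zero, add_zero]
    exact measure_mono inter_subset_left
  · rw [Measure.restrict_apply hE, ← measure_inter_add_sdiff E hs]
    have : chartVolume c (E \ (chartAt Plane c).source) = 0 :=
      measure_mono_null (fun x hx => hx.2) hc0
    rw [this, add_zero]
    exact le_iSup (fun c : M => chartVolume c) c _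

variable [IsContMDiffRiemannianBundle 𝓘(ℝ, Plane) ∞ Plane
  (fun x : M => TangentSpace 𝓘(ℝ, Plane) x)]

lemma contDiffAt_volDensity {c : M} {z : Plane} (hz : z ∈ (chartAt Plane c).target) :
    ContDiffAt ℝ ∞ (volDensity c) z :=
  contDiffAt_sqrt_det (fun i j => contDiffAt_gram hz i j) (det_gram_pos hz)

lemma aemeasurable_volDensity (c : M) :
    AEMeasurable (fun z => ENNReal.ofReal (volDensity c z))
      (volume.restrict (chartAt Plane c).target) := by
  have h : ContinuousOn (volDensity c) (chartAt Plane c).target := fun z hz =>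
    (contDiffAt_volDensity hz).continuousAt.continuousWithinAt
  exact (h.aemeasurable (chartAt Plane c).open_target.measurableSet).ennreal_ofReal

lemma measurableSet_symm_image (c : M) {U : Set Plane} (hU : MeasurableSet U)
    (hUt : U ⊆ (chartAt Plane c).target) : MeasurableSet ((chartAt Plane c).symm '' U) := by
  have : (chartAt Plane c).symm '' U = (chartAt Plane c).source ∩ chartAt Plane c ⁻¹' U := by
    exact (chartAt Plane c).symm.image_eq_target_inter_inv_preimage hUt
  rw [this]
  exact measurableSet_inter_preimage_of_continuousOn (chartAt Plane c).open_source.measurableSet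
    (chartAt Plane c).continuousOn hU

lemma symm_image_subset_source (c : M) {U : Set Plane} (hUt : U ⊆ (chartAt Plane c).target) :
    (chartAt Plane c).symm '' U ⊆ (chartAt Plane c).source := by
  rintro _ ⟨z, hz, rfl⟩
  exact (chartAt Plane c).map_target (hUt hz)

lemma indicator_symm_image (c : M) {U : Set Plane} (hUt : U ⊆ (chartAt Plane c).target) {α : Type*}
    [Zero α] (F : M → α) {z : Plane} (hz : z ∈ (chartAt Plane c).target) :
    ((chartAt Plane c).symm '' U).indicator F ((chartAt Plane c).symm z) =
      U.indicator (fun z => F ((chartAt Plane c).symm z)) z := by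
  have : (chartAt Plane c).symm z ∈ (chartAt Plane c).symm '' U ↔ z ∈ U :=
    (chartAt Plane c).symm.injOn.mem_image_iff hUt hz
  by_cases h : z ∈ U
  · rw [indicator_of_mem h, indicator_of_mem (this.2 h)]
  · rw [indicator_of_notMem h, indicator_of_notMem (fun h' => h (this.1 h'))]

lemma riemannianVolume_restrict_of_subset (c : M) {S : Set M}
    (hS : S ⊆ (chartAt Plane c).source) :
    (riemannianVolume M).restrict S = (chartVolume c).restrict S := by
  rw [← riemannianVolume_restrict_source c, Measure.restrict_restrict_of_subset hS]

lemma setIntegral_symm_image (c : M) {U : Set Plane} (hU : MeasurableSet U)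
    (hUt : U ⊆ (chartAt Plane c).target) (F : M → ℝ) :
    ∫ x in (chartAt Plane c).symm '' U, F x ∂(riemannianVolume M) =
      ∫ z in U, volDensity c z * F ((chartAt Plane c).symm z) := by
  have ht := (chartAt Plane c).open_target.measurableSet
  rw [riemannianVolume_restrict_of_subset c (symm_image_subset_source c hUt),
    ← integral_indicator (measurableSet_symm_image c hU hUt), integral_chartVolume, coordVolume,
    integral_withDensity_eq_integral_toReal_smul₀ (aemeasurable_volDensity c)
      (Filter.Eventually.of_forall fun _ => ENNReal.ofReal_lt_top)]
  have h : ∀ z ∈ (chartAt Plane c).target, (ENNReal.ofReal (volDensity c z)).toReal •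
      ((chartAt Plane c).symm '' U).indicator F ((chartAt Plane c).symm z) =
      U.indicator (fun z => volDensity c z * F ((chartAt Plane c).symm z)) z := fun z hz => by
    rw [indicator_symm_image c hUt F hz, ENNReal.toReal_ofReal (show 0 ≤ volDensity c z from Real.sqrt_nonneg _), smul_eq_mul]
    by_cases h : z ∈ U <;> simp [h]
  rw [setIntegral_congr_fun ht h, setIntegral_indicator hU, inter_eq_right.2 hUt]

lemma setLIntegral_symm_image (c : M) {U : Set Plane} (hU : MeasurableSet U)
    (hUt : U ⊆ (chartAt Plane c).target) (F : M → ℝ≥0∞) :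
    ∫⁻ x in (chartAt Plane c).symm '' U, F x ∂(riemannianVolume M) =
      ∫⁻ z in U, ENNReal.ofReal (volDensity c z) * F ((chartAt Plane c).symm z) := by
  have ht := (chartAt Plane c).open_target.measurableSet
  rw [riemannianVolume_restrict_of_subset c (symm_image_subset_source c hUt),
    ← lintegral_indicator (measurableSet_symm_image c hU hUt), lintegral_chartVolume, coordVolume,
    lintegral_withDensity_eq_lintegral_mul_non_measurable₀ _ (aemeasurable_volDensity c)
      (Filter.Eventually.of_forall fun _ => ENNReal.ofReal_lt_top)]
  have h : ∀ z ∈ (chartAt Plane c).target, ((fun z => ENNReal.ofReal (volDensity c z)) *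
      fun z => ((chartAt Plane c).symm '' U).indicator F ((chartAt Plane c).symm z)) z =
      U.indicator (fun z => ENNReal.ofReal (volDensity c z) * F ((chartAt Plane c).symm z)) z :=
    fun z hz => by
    rw [Pi.mul_apply, indicator_symm_image c hUt F hz]
    by_cases h : z ∈ U <;> simp [h]
  rw [setLIntegral_congr_fun ht h, setLIntegral_indicator hU, inter_eq_left.2 hUt]

end Charts

/-! ### Affine changes of the charts and distances -/

/-- The matrix of a linear map of the plane. -/
def linMatrix (L : Plane →L[ℝ] Plane) : Matrix (Fin 2) (Fin 2) ℝ := Matrix.of fun k i => L (e i) k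

lemma linear_apply_eq_sum (L : Plane →L[ℝ] Plane) (ξ : Plane) (k : Fin 2) :
    L ξ k = ∑ i, linMatrix L k i * ξ i := by
  conv_lhs => rw [plane_eq_sum ξ, map_sum]
  simp [linMatrix, Fin.sum_univ_two, mul_comm]

/-- The Cholesky decomposition. -/
lemma exists_cholesky {G : Matrix (Fin 2) (Fin 2) ℝ} (h00 : 0 < G 0 0) (hdet : 0 < G.det)
    (hsymm : G 1 0 = G 0 1) :
    ∃ L : Plane ≃L[ℝ] Plane, (linMatrix L).transpose * G * linMatrix L = 1 := by
  set a := √(G 0 0) with ha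
  set s := √G.det with hs
  have ha0 : 0 < a := Real.sqrt_pos.2 h00
  have hs0 : 0 < s := Real.sqrt_pos.2 hdet
  have ha2 : G 0 0 = a ^ 2 := (Real.sq_sqrt h00.le).symm
  have hs2 : G.det = s ^ 2 := (Real.sq_sqrt hdet.le).symm
  have h11 : G 1 1 = (s ^ 2 + G 0 1 ^ 2) / a ^ 2 := by
    rw [Matrix.det_fin_two, hsymm, ha2] at hs2
    field_simp
    linarith
  -- The columns result from the Gram–Schmidt process applied to the coordinate basis.
  set A : Matrix (Fin 2) (Fin 2) ℝ := !![1 / a, -(G 0 1) / (a * s); 0, a / s] with hA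
  have hone : A.transpose * G * A = 1 := by
    ext i j
    fin_cases i <;> fin_cases j <;>
      simp [hA, Matrix.mul_apply, Fin.sum_univ_two, hsymm, ha2, h11] <;> field_simp <;>
      first | ring1 | simp
  have hone' : A * (A.transpose * G) = 1 := mul_eq_one_comm.1 hone
  have hinv1 : ∀ x, Matrix.toEuclideanCLM (𝕜 := ℝ) (A.transpose * G)
      (Matrix.toEuclideanCLM (𝕜 := ℝ) A x) = x := fun x => by
    rw [← ContinuousLinearMap.mul_apply, ← map_mul, hone, map_one]; rfl
  have hinv2 : ∀ x, Matrix.toEuclideanCLM (𝕜 := ℝ) A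
      (Matrix.toEuclideanCLM (𝕜 := ℝ) (A.transpose * G) x) = x := fun x => by
    rw [← ContinuousLinearMap.mul_apply, ← map_mul, hone', map_one]; rfl
  refine ⟨ContinuousLinearEquiv.equivOfInverse _ _ hinv1 hinv2, ?_⟩
  have : linMatrix (ContinuousLinearEquiv.equivOfInverse _ _ hinv1 hinv2 : Plane ≃L[ℝ] Plane) = A := by
    ext k i
    simp [linMatrix, e]
  rw [this, hone]

/-- Quadratic forms close to the Euclidean one. -/
lemma quadratic_form_near {Q : Matrix (Fin 2) (Fin 2) ℝ}
    (hQ : ∀ i j, |Q i j - if i = j then 1 else 0| ≤ 1 / 50) (ξ : Plane) :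
    24 / 25 * ‖ξ‖ ^ 2 ≤ ∑ i, ∑ j, ξ i * ξ j * Q i j ∧
      ∑ i, ∑ j, ξ i * ξ j * Q i j ≤ 26 / 25 * ‖ξ‖ ^ 2 := by
  have h00 := abs_le.1 (hQ 0 0)
  have h01 := abs_le.1 (hQ 0 1)
  have h10 := abs_le.1 (hQ 1 0)
  have h11 := abs_le.1 (hQ 1 1)
  simp only [Fin.sum_univ_two, if_true, Fin.reduceEq, if_false, sub_zero] at *
  have hab : |ξ 0 * ξ 1 * (Q 0 1 + Q 1 0)| ≤ (ξ 0 ^ 2 + ξ 1 ^ 2) / 2 * (1 / 25) := by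
    rw [abs_mul]
    refine mul_le_mul ?_ (abs_le.2 ⟨by linarith, by linarith⟩) (abs_nonneg _) (by positivity)
    exact abs_le.2 ⟨by nlinarith [sq_nonneg (ξ 0 + ξ 1)], by nlinarith [sq_nonneg (ξ 0 - ξ 1)]⟩
  have h1 := abs_le.1 hab
  rw [norm_sq_plane]
  constructor <;> nlinarith [sq_nonneg (ξ 0), sq_nonneg (ξ 1)]

section Charts

variable {M : Type*} [TopologicalSpace M] [ChartedSpace Plane M]

/-- An affine map from the plane to the range of the chart at `c`. -/
def affineParam (c : M) (L : Plane ≃L[ℝ] Plane) (ξ : Plane) : Plane := chartAt Plane c c + L ξ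

/-- The inverse chart at `c` in affine coordinates. -/
def param (c : M) (L : Plane ≃L[ℝ] Plane) (ξ : Plane) : M :=
  (chartAt Plane c).symm (affineParam c L ξ)

/-- The affine coordinates of a point. -/
def coords (c : M) (L : Plane ≃L[ℝ] Plane) (x : M) : Plane :=
  L.symm (chartAt Plane c x - chartAt Plane c c)

lemma affineParam_coords (c : M) (L : Plane ≃L[ℝ] Plane) (x : M) :
    affineParam c L (coords c L x) = chartAt Plane c x := by
  simp [affineParam, coords]

lemma param_coords {c x : M} (L : Plane ≃L[ℝ] Plane) (hx : x ∈ (chartAt Plane c).source) :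
    param c L (coords c L x) = x := by
  rw [param, affineParam_coords, (chartAt Plane c).left_inv hx]

lemma coords_param {c : M} {L : Plane ≃L[ℝ] Plane} {ξ : Plane}
    (h : affineParam c L ξ ∈ (chartAt Plane c).target) : coords c L (param c L ξ) = ξ := by
  rw [param, coords, (chartAt Plane c).right_inv h]
  simp [affineParam]

lemma contDiff_affineParam (c : M) (L : Plane ≃L[ℝ] Plane) : ContDiff ℝ ∞ (affineParam c L) := by
  unfold affineParam
  fun_prop

lemma hasFDerivAt_affineParam (c : M) (L : Plane ≃L[ℝ] Plane) (ξ : Plane) :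
    HasFDerivAt (affineParam c L) (L : Plane →L[ℝ] Plane) ξ :=
  (L : Plane →L[ℝ] Plane).hasFDerivAt.const_add _

lemma jacobian_affineParam (c : M) (L : Plane ≃L[ℝ] Plane) (ξ : Plane) :
    jacobian (affineParam c L) ξ = linMatrix L := by
  ext k i
  rw [← fderiv_plane_apply (hasFDerivAt_affineParam c L ξ).differentiableAt,
    (hasFDerivAt_affineParam c L ξ).fderiv]
  rfl

variable [RiemannianBundle (fun x : M => TangentSpace 𝓘(ℝ, Plane) x)]

/-- The matrix of the metric in affine coordinates. -/
def paramGram (c : M) (L : Plane ≃L[ℝ] Plane) (ξ : Plane) : Matrix (Fin 2) (Fin 2) ℝ :=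
  (linMatrix L).transpose * gram c (affineParam c L ξ) * linMatrix L

/-- On the ball of radius `r` the affine coordinates are defined, and the metric is close to the
Euclidean one. -/
structure NearlyNormal (c : M) (L : Plane ≃L[ℝ] Plane) (r : ℝ) : Prop where
  mem_target : ∀ ξ ∈ Metric.ball (0 : Plane) r, affineParam c L ξ ∈ (chartAt Plane c).target
  near : ∀ ξ ∈ Metric.ball (0 : Plane) r, ∀ i j,
    |paramGram c L ξ i j - if i = j then 1 else 0| ≤ 1 / 50

lemma enorm_tangent (x : M) (v : Plane) :
    enorm (E := TangentSpace 𝓘(ℝ, Plane) x) v = ENNReal.ofReal √(metricForm x v v) := by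
  rw [← ofReal_norm (E := TangentSpace 𝓘(ℝ, Plane) x) v,
    norm_eq_sqrt_real_inner (F := TangentSpace 𝓘(ℝ, Plane) x) v]
  rfl

lemma metricForm_param (c : M) (L : Plane ≃L[ℝ] Plane) (ξ η : Plane) :
    metricForm (param c L ξ) (chartDeriv c (affineParam c L ξ) (L η))
      (chartDeriv c (affineParam c L ξ) (L η)) = ∑ i, ∑ j, η i * η j * paramGram c L ξ i j := by
  rw [param, metricForm_chartDeriv]
  have h := linear_apply_eq_sum (L : Plane →L[ℝ] Plane) η
  simp only [ContinuousLinearEquiv.coe_coe] at h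
  simp only [h, paramGram, Matrix.mul_apply, Matrix.transpose_apply, Fin.sum_univ_two]
  ring

lemma NearlyNormal.enorm_le {c : M} {L : Plane ≃L[ℝ] Plane} {r : ℝ} (h : NearlyNormal c L r)
    {ξ : Plane} (hξ : ξ ∈ Metric.ball 0 r) (η : Plane) :
    enorm (E := TangentSpace 𝓘(ℝ, Plane) (param c L ξ)) (chartDeriv c (affineParam c L ξ) (L η)) ≤
      ENNReal.ofReal (51 / 50) * ‖η‖ₑ := by
  rw [enorm_tangent, metricForm_param, ← ofReal_norm, ← ENNReal.ofReal_mul (by norm_num)]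
  refine ENNReal.ofReal_le_ofReal (Real.sqrt_le_iff.2 ⟨by positivity, ?_⟩)
  have := (quadratic_form_near (h.near ξ hξ) η).2
  nlinarith [sq_nonneg ‖η‖]

lemma NearlyNormal.le_enorm {c : M} {L : Plane ≃L[ℝ] Plane} {r : ℝ} (h : NearlyNormal c L r)
    {ξ : Plane} (hξ : ξ ∈ Metric.ball 0 r) (η : Plane) :
    ‖η‖ₑ ≤ ENNReal.ofReal (103 / 100) *
      enorm (E := TangentSpace 𝓘(ℝ, Plane) (param c L ξ))
        (chartDeriv c (affineParam c L ξ) (L η)) := by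
  rw [enorm_tangent, metricForm_param, ← ofReal_norm, ← ENNReal.ofReal_mul (by norm_num)]
  refine ENNReal.ofReal_le_ofReal ?_
  have h1 := (quadratic_form_near (h.near ξ hξ) η).1
  have h2 : 100 / 103 * ‖η‖ ≤ √(∑ i, ∑ j, η i * η j * paramGram c L ξ i j) := by
    refine Real.le_sqrt_of_sq_le ?_
    nlinarith [sq_nonneg ‖η‖]
  linarith

variable [IsManifold 𝓘(ℝ, Plane) ∞ M]

lemma mfderivWithin_param_comp {c : M} {L : Plane ≃L[ℝ] Plane} {u : ℝ → Plane} {t : ℝ}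
    (ht : t ∈ Icc (0 : ℝ) 1) (hu : DifferentiableWithinAt ℝ u (Icc 0 1) t)
    (hm : affineParam c L (u t) ∈ (chartAt Plane c).target) :
    (mfderivWithin 𝓘(ℝ, ℝ) 𝓘(ℝ, Plane) (param c L ∘ u) (Icc 0 1) t : ℝ →L[ℝ] Plane) 1 =
      chartDeriv c (affineParam c L (u t)) (L (derivWithin u (Icc 0 1) t)) := by
  have huniq : UniqueDiffWithinAt ℝ (Icc (0 : ℝ) 1) t := uniqueDiffOn_Icc zero_lt_one t ht
  have hd : HasFDerivWithinAt (affineParam c L ∘ u)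
      ((L : Plane →L[ℝ] Plane).comp (fderivWithin ℝ u (Icc 0 1) t)) (Icc 0 1) t :=
    (hasFDerivAt_affineParam c L (u t)).comp_hasFDerivWithinAt t hu.hasFDerivWithinAt
  have h1 := mfderiv_comp_mfderivWithin t (I := 𝓘(ℝ, ℝ)) (I' := 𝓘(ℝ, Plane)) (I'' := 𝓘(ℝ, Plane))
    (g := (chartAt Plane c).symm) (f := affineParam c L ∘ u) (s := Icc 0 1)
    (mdifferentiableAt_chartAt_symm hm) hd.differentiableWithinAt.mdifferentiableWithinAt
    huniq.uniqueMDiffWithinAt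
  rw [mfderivWithin_eq_fderivWithin, hd.fderivWithin huniq] at h1
  refine (congrArg (fun f : ℝ →L[ℝ] Plane => f 1) h1).trans ?_
  rw [← fderivWithin_derivWithin]
  rfl

end Charts

/-! ### Distances in nearly normal coordinates. -/

section Distance

variable {M : Type*} [EMetricSpace M] [ChartedSpace Plane M]
  [RiemannianBundle (fun x : M => TangentSpace 𝓘(ℝ, Plane) x)]
  [IsManifold 𝓘(ℝ, Plane) ∞ M] [IsRiemannianManifold 𝓘(ℝ, Plane) M]
  {c : M} {L : Plane ≃L[ℝ] Plane} {r : ℝ}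

/-- The image of the straight segment is an admissible path, whose speed is at most `51/50` times
the Euclidean one. -/
lemma NearlyNormal.edist_param_le (h : NearlyNormal c L r) {ξ ξ' : Plane}
    (hξ : ξ ∈ Metric.ball 0 r) (hξ' : ξ' ∈ Metric.ball 0 r) :
    edist (param c L ξ) (param c L ξ') ≤ ENNReal.ofReal (51 / 50) * ‖ξ' - ξ‖ₑ := by
  set u : ℝ → Plane := fun t => ξ + t • (ξ' - ξ) with hu
  have hmem : ∀ t ∈ Icc (0 : ℝ) 1, u t ∈ Metric.ball (0 : Plane) r := fun t ht =>
    (convex_ball (0 : Plane) r).add_smul_sub_mem hξ hξ' ht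
  have hder : ∀ t, HasDerivAt u (ξ' - ξ) t := fun t => by
    have h := ((hasDerivAt_id t).smul_const (ξ' - ξ)).const_add ξ
    rw [one_smul] at h
    exact h
  have hsm : ContDiff ℝ 1 (affineParam c L ∘ u) :=
    ((contDiff_affineParam c L).of_le (by simp)).comp (by rw [hu]; fun_prop)
  have hγ : ContMDiffOn 𝓘(ℝ, ℝ) 𝓘(ℝ, Plane) 1 (param c L ∘ u) (Icc 0 1) :=
    ((contMDiffOn_chartAt_symm c).of_le (by simp)).comp hsm.contMDiff.contMDiffOn
      fun t ht => h.mem_target _ (hmem t ht)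
  rw [IsRiemannianManifold.out (I := 𝓘(ℝ, Plane)) (param c L ξ) (param c L ξ')]
  refine (Manifold.riemannianEDist_le_pathELength hγ (by simp [hu]) (by simp [hu])
    zero_le_one).trans ?_
  rw [Manifold.pathELength_eq_lintegral_mfderivWithin_Icc]
  calc _ ≤ ∫⁻ t in Icc (0 : ℝ) 1, ENNReal.ofReal (51 / 50) * ‖ξ' - ξ‖ₑ := by
        refine setLIntegral_mono' measurableSet_Icc fun t ht => ?_
        have h1 := mfderivWithin_param_comp ht (hder t).differentiableAt.differentiableWithinAt
          (h.mem_target _ (hmem t ht)) (L := L)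
        rw [(hder t).hasDerivWithinAt.derivWithin (uniqueDiffOn_Icc zero_lt_one t ht)] at h1
        have h2 := h.enorm_le (hmem t ht) (ξ' - ξ)
        rw [← h1] at h2
        exact h2
    _ = _ := by simp

/-- A ball in the domain of the affine coordinates. -/
lemma NearlyNormal.enorm_coords_sub_lt (h : NearlyNormal c L r) {p x : M} {s : ℝ≥0∞}
    (hs : Metric.eball p s ⊆ {y | y ∈ (chartAt Plane c).source ∧ coords c L y ∈ Metric.ball 0 r})
    (hx : edist x p < s) : ‖coords c L x - coords c L p‖ₑ < ENNReal.ofReal (103 / 100) * s := by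
  rw [edist_comm, IsRiemannianManifold.out (I := 𝓘(ℝ, Plane)) p x] at hx
  obtain ⟨γ, hγ0, hγ1, hγ, hlen, -⟩ :=
    Manifold.exists_lt_locally_constant_of_riemannianEDist_lt hx zero_lt_one
  -- Initial arcs of a path shorter than `s` stay in the ball of radius `s`, so the whole path can
  -- be read in the coordinates.
  have hmem : ∀ t ∈ Icc (0 : ℝ) 1,
      γ t ∈ (chartAt Plane c).source ∧ coords c L (γ t) ∈ Metric.ball 0 r := fun t ht => by
    refine hs (?_ : edist (γ t) p < s)
    rw [edist_comm, IsRiemannianManifold.out (I := 𝓘(ℝ, Plane)) p (γ t)]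
    refine (Manifold.riemannianEDist_le_pathELength hγ.contMDiffOn hγ0 rfl ht.1).trans_lt ?_
    exact (Manifold.pathELength_mono le_rfl ht.2).trans_lt hlen
  set u : ℝ → Plane := coords c L ∘ γ with hu
  have hus : ContDiffOn ℝ 1 u (Icc 0 1) := by
    have h1 : ContMDiffOn 𝓘(ℝ, ℝ) 𝓘(ℝ, Plane) 1 (chartAt Plane c ∘ γ) (Icc 0 1) :=
      (contMDiffOn_chart (I := 𝓘(ℝ, Plane)) (n := 1) (H := Plane)).comp hγ.contMDiffOn
        fun t ht => (hmem t ht).1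
    have h2 : ContDiff ℝ 1 fun z : Plane => L.symm (z - chartAt Plane c c) := by fun_prop
    exact h2.comp_contDiffOn (contMDiffOn_iff_contDiffOn.1 h1)
  have hγu : EqOn γ (param c L ∘ u) (Icc 0 1) := fun t ht => (param_coords L (hmem t ht).1).symm
  have hmain : ‖u 1 - u 0‖ₑ ≤ ENNReal.ofReal (103 / 100) *
      Manifold.pathELength 𝓘(ℝ, Plane) γ 0 1 := by
    refine (enorm_sub_le_lintegral_derivWithin_Icc_of_contDiffOn_Icc hus zero_le_one).trans ?_
    rw [Manifold.pathELength_congr hγu, Manifold.pathELength_eq_lintegral_mfderivWithin_Icc,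
      ← lintegral_const_mul' _ _ ENNReal.ofReal_ne_top]
    refine setLIntegral_mono' measurableSet_Icc fun t ht => ?_
    have h1 := mfderivWithin_param_comp ht (hus.differentiableOn one_ne_zero t ht)
      (h.mem_target _ (hmem t ht).2)
    have h2 := h.le_enorm (ξ := u t) (hmem t ht).2 (derivWithin u (Icc 0 1) t)
    rw [← h1] at h2
    exact h2
  have e0 : u 0 = coords c L p := by rw [hu, Function.comp_apply, hγ0]
  have e1 : u 1 = coords c L x := by rw [hu, Function.comp_apply, hγ1]
  rw [e0, e1] at hmain
  exact hmain.trans_lt (ENNReal.mul_lt_mul_right (by simp) ENNReal.ofReal_ne_top hlen)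

end Distance

/-! ### Rescaling -/

lemma jacobian_comp {Φ Ψ : Plane → Plane} {z : Plane} (hΦ : DifferentiableAt ℝ Φ (Ψ z))
    (hΨ : DifferentiableAt ℝ Ψ z) : jacobian (Φ ∘ Ψ) z = jacobian Φ (Ψ z) * jacobian Ψ z := by
  ext k i
  have hk : DifferentiableAt ℝ (fun y => Φ y k) (Ψ z) :=
    (EuclideanSpace.proj k : Plane →L[ℝ] ℝ).differentiableAt.comp _ hΦ
  have h := partialD_comp_map hk hΨ i
  rw [Matrix.mul_apply]
  refine h.trans (Finset.sum_congr rfl fun l _ => ?_)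
  rw [mul_comm]
  rfl

/-- The dilation by `ρ`, with base point `ξ`. -/
def dilate (ξ : Plane) (ρ : ℝ) (y : Plane) : Plane := ξ + ρ • y

lemma contDiff_dilate (ξ : Plane) (ρ : ℝ) : ContDiff ℝ ∞ (dilate ξ ρ) := by
  unfold dilate; fun_prop

lemma hasFDerivAt_dilate (ξ : Plane) (ρ : ℝ) (y : Plane) :
    HasFDerivAt (dilate ξ ρ) (ρ • ContinuousLinearMap.id ℝ Plane) y :=
  ((hasFDerivAt_id y).const_smul ρ).const_add ξ

lemma jacobian_dilate (ξ : Plane) (ρ : ℝ) (y : Plane) :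
    jacobian (dilate ξ ρ) y = ρ • (1 : Matrix (Fin 2) (Fin 2) ℝ) := by
  ext k i
  rw [← fderiv_plane_apply (hasFDerivAt_dilate ξ ρ y).differentiableAt,
    (hasFDerivAt_dilate ξ ρ y).fderiv]
  simp [e, Matrix.one_apply]

lemma partialD_comp_dilate {f : Plane → ℝ} {ξ : Plane} {ρ : ℝ} {y : Plane}
    (hf : DifferentiableAt ℝ f (dilate ξ ρ y)) (i : Fin 2) :
    partialD i (fun z => f (dilate ξ ρ z)) y = ρ * partialD i f (dilate ξ ρ y) := by
  have h := partialD_comp_map hf (hasFDerivAt_dilate ξ ρ y).differentiableAt i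
  refine h.trans ?_
  rw [jacobian_dilate]
  simp [Matrix.one_apply]

lemma _root_.Filter.EventuallyEq.flatLaplacian_eq {G : Plane → Matrix (Fin 2) (Fin 2) ℝ}
    {f g : Plane → ℝ} {y : Plane} (h : f =ᶠ[nhds y] g) :
    flatLaplacian G f y = flatLaplacian G g y := by
  have hflux : ∀ i, flux G f i =ᶠ[nhds y] flux G g i := fun i => by
    filter_upwards [h.eventuallyEq_nhds] with z hz
    unfold flux partialD
    rw [hz.fderiv_eq]
  unfold flatLaplacian partialD
  simp only [(hflux _).fderiv_eq]

lemma det_pos_of_near {Q : Matrix (Fin 2) (Fin 2) ℝ}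
    (hQ : ∀ i j, |Q i j - if i = j then 1 else 0| ≤ 1 / 50) :
    (1 / 2) ^ 2 ≤ Q.det ∧ Q.det ≤ 2 ^ 2 := by
  have h00 := abs_le.1 (hQ 0 0)
  have h01 := abs_le.1 (hQ 0 1)
  have h10 := abs_le.1 (hQ 1 0)
  have h11 := abs_le.1 (hQ 1 1)
  simp only [if_true, Fin.reduceEq, if_false, sub_zero] at h00 h01 h10 h11
  rw [Matrix.det_fin_two]
  constructor <;> nlinarith

/-! ### Controlled charts and the Laplacian in rescaled coordinates. -/

section Charts

variable {M : Type*} [TopologicalSpace M] [ChartedSpace Plane M]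
  [RiemannianBundle (fun x : M => TangentSpace 𝓘(ℝ, Plane) x)] [IsManifold 𝓘(ℝ, Plane) ∞ M]
  [IsContMDiffRiemannianBundle 𝓘(ℝ, Plane) ∞ Plane (fun x : M => TangentSpace 𝓘(ℝ, Plane) x)]
  {c : M} {L : Plane ≃L[ℝ] Plane} {r : ℝ}

lemma contDiffAt_paramGram {ξ : Plane} (h : affineParam c L ξ ∈ (chartAt Plane c).target)
    (i j : Fin 2) : ContDiffAt ℝ ∞ (fun ξ => paramGram c L ξ i j) ξ := by
  have hg : ∀ k l, ContDiffAt ℝ ∞ (fun ξ => gram c (affineParam c L ξ) k l) ξ := fun k l =>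
    (contDiffAt_gram h k l).comp ξ (contDiff_affineParam c L).contDiffAt
  simp only [paramGram, Matrix.mul_apply, Matrix.transpose_apply]
  exact ContDiffAt.sum fun k _ => (ContDiffAt.sum fun l _ => contDiffAt_const.mul (hg l k)).mul
    contDiffAt_const

/-- Bounds for the coefficients of the Laplacian in affine coordinates. -/
structure ControlledChart (c : M) (L : Plane ≃L[ℝ] Plane) (r K : ℝ) : Prop
    extends NearlyNormal c L r where
  inv_near : ∀ ξ ∈ Metric.ball (0 : Plane) r, ∀ i j,
    |(paramGram c L ξ)⁻¹ i j - if i = j then 1 else 0| ≤ 1 / 10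
  inv_lipschitz : ∀ i j, ∀ ξ ∈ Metric.ball (0 : Plane) r, ∀ ξ' ∈ Metric.ball (0 : Plane) r,
    |(paramGram c L ξ)⁻¹ i j - (paramGram c L ξ')⁻¹ i j| ≤ K * ‖ξ - ξ'‖
  drift : ∀ j, ∀ ξ ∈ Metric.ball (0 : Plane) r,
    |(metricCoefficients (paramGram c L)).b j ξ| ≤ K

lemma exists_paramGram_eq_one (c : M) : ∃ L : Plane ≃L[ℝ] Plane, paramGram c L 0 = 1 := by
  have hc : chartAt Plane c c ∈ (chartAt Plane c).target := mem_chart_target Plane c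
  obtain ⟨L, hL⟩ := exists_cholesky (gram_zero_zero_pos hc) (det_gram_pos hc) (gram_symm c _ 1 0)
  exact ⟨L, by simpa [paramGram, affineParam] using hL⟩

lemma contDiffAt_metricCoefficients_b {Q : Plane → Matrix (Fin 2) (Fin 2) ℝ} {y : Plane}
    (hQ : ∀ i j, ContDiffAt ℝ ∞ (fun z => Q z i j) y) (hdet : 0 < (Q y).det) (j : Fin 2) :
    ContDiffAt ℝ ∞ ((metricCoefficients Q).b j) y := by
  refine ((contDiffAt_sqrt_det hQ hdet).inv (Real.sqrt_pos.2 hdet).ne').mul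
    (ContDiffAt.sum fun i _ => ?_)
  exact ((contDiffAt_sqrt_det hQ hdet).mul (contDiffAt_inv hQ hdet i j)).partialD (by simp) i

/-- After the linear change of coordinates the metric is the identity at the centre, so by
smoothness all bounds hold on a small ball. No smallness of `K` is needed, as rescaling provides it.
-/
lemma exists_controlledChart (c : M) :
    ∃ (L : Plane ≃L[ℝ] Plane) (r K : ℝ), 0 < r ∧ 0 < K ∧ ControlledChart c L r K := by
  obtain ⟨L, hL⟩ := exists_paramGram_eq_one c
  have h0 : affineParam c L 0 = chartAt Plane c c := by simp [affineParam]
  have ht : affineParam c L 0 ∈ (chartAt Plane c).target := h0 ▸ mem_chart_target Plane c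
  have hQ : ∀ i j, ContDiffAt ℝ ∞ (fun ξ => paramGram c L ξ i j) 0 := contDiffAt_paramGram ht
  have hdet : 0 < (paramGram c L 0).det := by rw [hL]; simp
  have hA : ∀ i j, ContDiffAt ℝ ∞ (fun ξ => (paramGram c L ξ)⁻¹ i j) 0 := contDiffAt_inv hQ hdet
  have hb : ∀ j, ContDiffAt ℝ ∞ ((metricCoefficients (paramGram c L)).b j) 0 :=
    contDiffAt_metricCoefficients_b hQ hdet
  have e1 : ∀ᶠ ξ in nhds (0 : Plane), affineParam c L ξ ∈ (chartAt Plane c).target :=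
    (contDiff_affineParam c L).continuous.continuousAt.eventually
      ((chartAt Plane c).open_target.mem_nhds ht)
  have e2 : ∀ᶠ ξ in nhds (0 : Plane), ∀ i j,
      |paramGram c L ξ i j - if i = j then 1 else 0| < 1 / 50 := by
    refine Filter.eventually_all.2 fun i => Filter.eventually_all.2 fun j => ?_
    refine ((hQ i j).continuousAt.sub continuousAt_const).abs.eventually_lt continuousAt_const ?_
    simp [hL, Matrix.one_apply]
  have e3 : ∀ᶠ ξ in nhds (0 : Plane), ∀ i j,
      |(paramGram c L ξ)⁻¹ i j - if i = j then 1 else 0| < 1 / 10 := by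
    refine Filter.eventually_all.2 fun i => Filter.eventually_all.2 fun j => ?_
    refine ((hA i j).continuousAt.sub continuousAt_const).abs.eventually_lt continuousAt_const ?_
    simp [hL, Matrix.one_apply]
  have e4 : ∀ᶠ ξ in nhds (0 : Plane), ∀ j, |(metricCoefficients (paramGram c L)).b j ξ| <
      |(metricCoefficients (paramGram c L)).b j 0| + 1 :=
    Filter.eventually_all.2 fun j =>
      (hb j).continuousAt.abs.eventually_lt continuousAt_const (by simp)
  choose κ t htn hlip using fun i j => ((hA i j).of_le (m := 1) (by simp)).exists_lipschitzOnWith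
  have e5 : ∀ᶠ ξ in nhds (0 : Plane), ∀ i j, ξ ∈ t i j :=
    Filter.eventually_all.2 fun i => Filter.eventually_all.2 fun j => htn i j
  obtain ⟨r, hr, hball⟩ := Metric.eventually_nhds_iff_ball.1
    (e1.and (e2.and (e3.and (e4.and e5))))
  have hκ : ∀ i j, (κ i j : ℝ) ≤ ∑ i, ∑ j, (κ i j : ℝ) := fun i j =>
    (Finset.single_le_sum (f := fun j => (κ i j : ℝ)) (fun j _ => (κ i j).2)
      (Finset.mem_univ j)).trans
    (Finset.single_le_sum (f := fun i => ∑ j, (κ i j : ℝ))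
      (fun i _ => Finset.sum_nonneg fun j _ => (κ i j).2) (Finset.mem_univ i))
  have hb' : ∀ j, |(metricCoefficients (paramGram c L)).b j 0| ≤
      ∑ j, |(metricCoefficients (paramGram c L)).b j 0| := fun j =>
    Finset.single_le_sum (f := fun j => |(metricCoefficients (paramGram c L)).b j 0|)
      (fun j _ => abs_nonneg _) (Finset.mem_univ j)
  have hκ0 : 0 ≤ ∑ i, ∑ j, (κ i j : ℝ) := (κ 0 0).2.trans (hκ 0 0)
  have hb0 := (abs_nonneg _).trans (hb' 0)
  refine ⟨L, r, ∑ i, ∑ j, (κ i j : ℝ) + ∑ j, |(metricCoefficients (paramGram c L)).b j 0| + 1, hr,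
    by linarith, ⟨fun ξ hξ => (hball ξ hξ).1, fun ξ hξ i j => ((hball ξ hξ).2.1 i j).le⟩,
    fun ξ hξ i j => ((hball ξ hξ).2.2.1 i j).le, fun i j ξ hξ ξ' hξ' => ?_, fun j ξ hξ => ?_⟩
  · have h := (hlip i j).dist_le_mul ξ ((hball ξ hξ).2.2.2.2 i j) ξ' ((hball ξ' hξ').2.2.2.2 i j)
    rw [Real.dist_eq, dist_eq_norm] at h
    refine h.trans (mul_le_mul_of_nonneg_right ?_ (norm_nonneg _))
    linarith [hκ i j]
  · exact ((hball ξ hξ).2.2.2.1 j).le.trans (by linarith [hb' j])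

/-- The coefficients of the rescaled Laplacian. -/
def scaledCoefficients (c : M) (L : Plane ≃L[ℝ] Plane) (ξ : Plane) (ρ : ℝ) : Coefficients :=
  metricCoefficients fun y => paramGram c L (dilate ξ ρ y)

/-- Dilation by `ρ` multiplies first derivatives of the coefficients by `ρ`, hence the Lipschitz and
drift bounds as well; bounds on values are inherited. -/
lemma ControlledChart.nearlyFlat {K : ℝ} (h : ControlledChart c L r K) {ξ : Plane} {ρ : ℝ}
    (hρ : 0 < ρ) (hsub : ∀ y ∈ Metric.closedBall (0 : Plane) 1, dilate ξ ρ y ∈ Metric.ball 0 r) :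
    (scaledCoefficients c L ξ ρ).NearlyFlat (ρ * K) := by
  have hQ : ∀ y ∈ Metric.closedBall (0 : Plane) 1, ∀ i j,
      ContDiffAt ℝ ∞ (fun ξ => paramGram c L ξ i j) (dilate ξ ρ y) := fun y hy =>
    contDiffAt_paramGram (h.mem_target _ (hsub y hy))
  have hdet : ∀ y ∈ Metric.closedBall (0 : Plane) 1, 0 < (paramGram c L (dilate ξ ρ y)).det :=
    fun y hy => lt_of_lt_of_le (by norm_num) (det_pos_of_near (h.near _ (hsub y hy))).1
  have hQ' : ∀ y ∈ Metric.closedBall (0 : Plane) 1, ∀ i j,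
      ContDiffAt ℝ ∞ (fun y => paramGram c L (dilate ξ ρ y) i j) y := fun y hy i j =>
    (hQ y hy i j).comp y (contDiff_dilate ξ ρ).contDiffAt
  have hsym : ∀ ζ i j, paramGram c L ζ i j = paramGram c L ζ j i := fun ζ i j => by
    simp only [paramGram, Matrix.mul_apply, Matrix.transpose_apply, Fin.sum_univ_two]
    rw [gram_symm c _ 1 0]
    ring
  refine ⟨fun i j y hy => ?_, fun i j y hy => hsym _ _ _, fun i k y hy => ?_,
    fun i j y hy => h.inv_near _ (hsub y hy) i j, fun i j y hy => (h.near _ (hsub y hy) i j).trans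
      (by norm_num), fun i j y hy y' hy' => ?_, fun j y hy => ?_, fun y hy => ?_, fun y hy => ?_,
    fun i j y hy => ?_, fun j y hy => ?_, fun y hy => ?_⟩
  · change (paramGram c L (dilate ξ ρ y))⁻¹ i j = (paramGram c L (dilate ξ ρ y))⁻¹ j i
    rw [inv_fin_two_apply, inv_fin_two_apply, Matrix.adjugate_fin_two]
    fin_cases i <;> fin_cases j <;> simp [hsym _ 0 1]
  · have h1 := congrFun (congrFun (Matrix.nonsing_inv_mul (paramGram c L (dilate ξ ρ y))
      (hdet y hy).ne'.isUnit) i) k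
    rw [Matrix.mul_apply, Matrix.one_apply] at h1
    exact h1
  · refine (h.inv_lipschitz i j _ (hsub y hy) _ (hsub y' hy')).trans_eq ?_
    have : dilate ξ ρ y - dilate ξ ρ y' = ρ • (y - y') := by simp [dilate, smul_sub]
    rw [this, norm_smul, Real.norm_of_nonneg hρ.le]
    ring
  · have hd : ∀ i, DifferentiableAt ℝ (fun y => √(paramGram c L y).det * (paramGram c L y)⁻¹ i j)
        (dilate ξ ρ y) := fun i =>
      ((contDiffAt_sqrt_det (hQ y hy) (hdet y hy)).mul
        (contDiffAt_inv (hQ y hy) (hdet y hy) i j)).differentiableAt (by simp)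
    have e1 : (scaledCoefficients c L ξ ρ).b j y =
        ρ * (metricCoefficients (paramGram c L)).b j (dilate ξ ρ y) := by
      simp only [scaledCoefficients, metricCoefficients]
      simp only [partialD_comp_dilate (hd _)]
      rw [← Finset.mul_sum]
      ring
    rw [e1, abs_mul, abs_of_pos hρ]
    exact mul_le_mul_of_nonneg_left (h.drift j _ (hsub y hy)) hρ.le
  · exact Real.le_sqrt_of_sq_le (det_pos_of_near (h.near _ (hsub y hy))).1
  · exact Real.sqrt_le_iff.2 ⟨by norm_num, (det_pos_of_near (h.near _ (hsub y hy))).2⟩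
  · exact (contDiffAt_inv (hQ' y hy) (hdet y hy) i j).continuousAt.continuousWithinAt
  · exact (contDiffAt_metricCoefficients_b (hQ' y hy)
      (hdet y hy) j).continuousAt.continuousWithinAt
  · exact (contDiffAt_sqrt_det (hQ' y hy) (hdet y hy)).continuousAt.continuousWithinAt

/-- The Laplace-Beltrami operator in rescaled coordinates. -/
lemma NearlyNormal.laplaceBeltrami_eq (h : NearlyNormal c L r) {ξ : Plane} {ρ : ℝ} (hρ : 0 < ρ)
    {y : Plane} (hy : dilate ξ ρ y ∈ Metric.ball 0 r) {f : M → ℝ}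
    (hf : ContMDiffAt 𝓘(ℝ, Plane) 𝓘(ℝ, ℝ) ∞ f (param c L (dilate ξ ρ y))) :
    laplaceBeltrami f (param c L (dilate ξ ρ y)) =
      (ρ ^ 2)⁻¹ * (scaledCoefficients c L ξ ρ).op (fun y => f (param c L (dilate ξ ρ y))) y := by
  set x := param c L (dilate ξ ρ y) with hx
  have ht := h.mem_target _ hy
  -- `laplaceBeltrami` is computed at each point in that point's own chart, so the invariance under
  -- the transition map is needed to express it in the single chart at `c`.
  have hxs : (chartAt Plane c).symm (affineParam c L (dilate ξ ρ y)) ∈ (chartAt Plane x).source :=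
    mem_chart_source Plane x
  set Θ : Plane → Plane := affineParam c L ∘ dilate ξ ρ with hΘ
  have hΘs : ContDiff ℝ ∞ Θ := (contDiff_affineParam c L).comp (contDiff_dilate ξ ρ)
  have hT := contDiffAt_transitionMap (z := Θ y) ht hxs
  set Φ : Plane → Plane := transitionMap c x ∘ Θ with hΦ
  have hΦs : ContDiffAt ℝ ∞ Φ y := hT.comp y hΘs.contDiffAt
  have hΦy : Φ y = chartAt Plane x x := rfl
  have hxt : Φ y ∈ (chartAt Plane x).target := mem_chart_target Plane x
  have hev : ∀ᶠ z in nhds y, Θ z ∈ (chartAt Plane c).target ∧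
      (chartAt Plane c).symm (Θ z) ∈ (chartAt Plane x).source :=
    hΘs.continuous.continuousAt.eventually (eventually_mem_source ht hxs)
  have hJΘ : ∀ z, jacobian Θ z = ρ • linMatrix L := fun z => by
    rw [hΘ, jacobian_comp (hasFDerivAt_affineParam c L _).differentiableAt
      (hasFDerivAt_dilate ξ ρ z).differentiableAt, jacobian_affineParam, jacobian_dilate]
    simp
  have hG' : ∀ᶠ z in nhds y, ρ ^ 2 • paramGram c L (dilate ξ ρ z) =
      (jacobian Φ z).transpose * gram x (Φ z) * jacobian Φ z := by
    filter_upwards [hev] with z hz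
    have hd := (contDiffAt_transitionMap hz.1 hz.2).differentiableAt (by simp)
    have hd' := hΘs.differentiable (by simp) z
    rw [hΦ, jacobian_comp hd hd', hJΘ, paramGram, show affineParam c L (dilate ξ ρ z) = Θ z from rfl,
      gram_transition (c' := x) hz.1 hz.2]
    simp only [Matrix.transpose_mul, Matrix.transpose_smul, Matrix.smul_mul, Matrix.mul_smul,
      smul_smul, Matrix.mul_assoc, Function.comp_apply, pow_two]
  have hdetQ : 0 < (paramGram c L (dilate ξ ρ y)).det :=
    lt_of_lt_of_le (by norm_num) (det_pos_of_near (h.near _ hy)).1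
  have hJ : (jacobian Φ y).det ≠ 0 := fun h0 => by
    have h1 := congrArg Matrix.det hG'.self_of_nhds
    rw [Matrix.det_mul, h0, mul_zero, Matrix.det_smul, Fintype.card_fin] at h1
    have : 0 < (ρ ^ 2) ^ 2 * (paramGram c L (dilate ξ ρ y)).det := by positivity
    exact this.ne' h1
  have hfs : ContDiffAt ℝ ∞ (f ∘ (chartAt Plane x).symm) (Φ y) := by
    rw [← contMDiffAt_iff_contDiffAt]
    have hsx : (chartAt Plane x).symm (Φ y) = x := (chartAt Plane x).left_inv (mem_chart_source _ x)
    refine ContMDiffAt.comp (Φ y) (I' := 𝓘(ℝ, Plane)) (by rw [hsx]; exact hf)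
      ((contMDiffOn_chartAt_symm x).contMDiffAt ((chartAt Plane x).open_target.mem_nhds hxt))
  have h1 := flatLaplacian_comp (hΦs.of_le ENat.LEInfty.out) hJ
    (fun i j => (contDiffAt_gram hxt i j).of_le (by simp)) (det_gram_pos hxt) (hfs.of_le ENat.LEInfty.out)
    hG'
  have h2 : (f ∘ (chartAt Plane x).symm) ∘ Φ =ᶠ[nhds y]
      fun y => f (param c L (dilate ξ ρ y)) := by
    filter_upwards [hev] with z hz
    exact congrArg f (symm_transitionMap hz.2)
  have hgs : ContDiffAt ℝ ∞ (fun y => f (param c L (dilate ξ ρ y))) y :=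
    (hfs.comp y hΦs).congr_of_eventuallyEq h2.symm
  have h3 : laplaceBeltrami f x = flatLaplacian (gram x) (f ∘ (chartAt Plane x).symm) (Φ y) := rfl
  rw [h3, ← h1, h2.flatLaplacian_eq, flatLaplacian_smul hρ, flatLaplacian_eq_op]
  · rfl
  · exact fun i j => ((contDiffAt_paramGram ht i j).comp y
      (contDiff_dilate ξ ρ).contDiffAt).of_le (by simp)
  · exact hdetQ
  · exact hgs.of_le ENat.LEInfty.out

end Charts

/-! ### Rescaled solutions -/

lemma _root_.Filter.EventuallyEq.op_eq {𝒞 : Coefficients} {f g : Plane → ℝ} {y : Plane}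
    (h : f =ᶠ[nhds y] g) : 𝒞.op f y = 𝒞.op g y := by
  have h1 : ∀ j, partialD j f =ᶠ[nhds y] partialD j g := fun j => by
    filter_upwards [h.eventuallyEq_nhds] with z hz
    unfold partialD
    rw [hz.fderiv_eq]
  have h2 : ∀ i j, partialD i (partialD j f) y = partialD i (partialD j g) y := fun i j => by
    unfold partialD
    exact congrArg (fun T : Plane →L[ℝ] ℝ => T (e i)) (h1 j).fderiv_eq
  have h3 : ∀ j, partialD j f y = partialD j g y := fun j => (h1 j).self_of_nhds
  simp only [Coefficients.op, h2, h3]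

section Charts

variable {M : Type*} [TopologicalSpace M] [ChartedSpace Plane M]

/-- The parametrization of a neighbourhood of `param c L ξ` by the unit disc, at scale `ρ`. -/
def blowup (c : M) (L : Plane ≃L[ℝ] Plane) (ξ : Plane) (ρ : ℝ) (y : Plane) : M :=
  param c L (dilate ξ ρ y)

/-- The transport of a function on the disc to the surface. -/
def pushforward (c : M) (L : Plane ≃L[ℝ] Plane) (ξ : Plane) (ρ : ℝ) (φ : Plane → ℝ → ℝ) (x : M)
    (t : ℝ) : ℝ :=
  (chartAt Plane c).source.indicator (fun x => φ (ρ⁻¹ • (coords c L x - ξ)) ((ρ ^ 2)⁻¹ * t)) x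

variable {c : M} {L : Plane ≃L[ℝ] Plane} {r ρ : ℝ} {ξ : Plane}

lemma continuousAt_blowup {y : Plane}
    (h : affineParam c L (dilate ξ ρ y) ∈ (chartAt Plane c).target) :
    ContinuousAt (blowup c L ξ ρ) y := by
  have h1 : ContinuousAt (affineParam c L ∘ dilate ξ ρ) y :=
    ((contDiff_affineParam c L).continuous.comp (contDiff_dilate ξ ρ).continuous).continuousAt
  exact ContinuousAt.comp (f := affineParam c L ∘ dilate ξ ρ) (g := (chartAt Plane c).symm)
    ((chartAt Plane c).continuousAt_symm h) h1

lemma pushforward_blowup (hρ : 0 < ρ) {y : Plane}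
    (h : affineParam c L (dilate ξ ρ y) ∈ (chartAt Plane c).target) (φ : Plane → ℝ → ℝ) (t : ℝ) :
    pushforward c L ξ ρ φ (blowup c L ξ ρ y) t = φ y ((ρ ^ 2)⁻¹ * t) := by
  have hs : blowup c L ξ ρ y ∈ (chartAt Plane c).source := (chartAt Plane c).map_target h
  rw [pushforward, indicator_of_mem hs, blowup, coords_param h]
  simp [dilate, smul_smul, inv_mul_cancel₀ hρ.ne']

lemma support_pushforward_subset (hρ : 0 < ρ) (φ : Plane → ℝ → ℝ) :
    Function.support (fun z : M × ℝ => pushforward c L ξ ρ φ z.1 z.2) ⊆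
      (fun z : Plane × ℝ => (blowup c L ξ ρ z.1, ρ ^ 2 * z.2)) ''
        tsupport (fun z : Plane × ℝ => φ z.1 z.2) := by
  rintro ⟨x, t⟩ hx
  rw [Function.mem_support] at hx
  by_cases hxs : x ∈ (chartAt Plane c).source
  · refine ⟨(ρ⁻¹ • (coords c L x - ξ), (ρ ^ 2)⁻¹ * t), subset_tsupport _ ?_, ?_⟩
    · rw [pushforward, indicator_of_mem hxs] at hx
      exact hx
    · have h1 : dilate ξ ρ (ρ⁻¹ • (coords c L x - ξ)) = coords c L x := by
        simp [dilate, smul_smul, mul_inv_cancel₀ hρ.ne']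
      simp only [blowup, h1, param_coords L hxs]
      rw [mul_inv_cancel_left₀ (by positivity)]
  · rw [pushforward, indicator_of_notMem hxs] at hx
    exact absurd rfl hx

section Pushforward

variable {φ : Plane → ℝ → ℝ} {T : ℝ}

lemma isCompact_image_tsupport
    (hsub : ∀ y ∈ Metric.closedBall (0 : Plane) 1,
      affineParam c L (dilate ξ ρ y) ∈ (chartAt Plane c).target)
    (hφc : HasCompactSupport (fun z : Plane × ℝ => φ z.1 z.2))
    (hφt : tsupport (fun z : Plane × ℝ => φ z.1 z.2) ⊆ disc ×ˢ Ioo 0 T) :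
    IsCompact ((fun z : Plane × ℝ => (blowup c L ξ ρ z.1, ρ ^ 2 * z.2)) ''
      tsupport (fun z : Plane × ℝ => φ z.1 z.2)) := by
  refine hφc.image_of_continuousOn fun z hz => ContinuousAt.continuousWithinAt ?_
  refine ContinuousAt.prodMk ?_ (by fun_prop)
  exact (continuousAt_blowup (hsub _ (Metric.ball_subset_closedBall (hφt hz).1))).comp
    continuousAt_fst

lemma tsupport_pushforward_subset [T2Space M] (hρ : 0 < ρ)
    (hsub : ∀ y ∈ Metric.closedBall (0 : Plane) 1,
      affineParam c L (dilate ξ ρ y) ∈ (chartAt Plane c).target)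
    (hφc : HasCompactSupport (fun z : Plane × ℝ => φ z.1 z.2))
    (hφt : tsupport (fun z : Plane × ℝ => φ z.1 z.2) ⊆ disc ×ˢ Ioo 0 T) :
    tsupport (fun z : M × ℝ => pushforward c L ξ ρ φ z.1 z.2) ⊆
      (fun z : Plane × ℝ => (blowup c L ξ ρ z.1, ρ ^ 2 * z.2)) ''
        tsupport (fun z : Plane × ℝ => φ z.1 z.2) :=
  closure_minimal (support_pushforward_subset hρ φ)
    (isCompact_image_tsupport hsub hφc hφt).isClosed

lemma contMDiffAt_coords [IsManifold 𝓘(ℝ, Plane) ∞ M] {x : M} (hx : x ∈ (chartAt Plane c).source) :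
    ContMDiffAt 𝓘(ℝ, Plane) 𝓘(ℝ, Plane) ∞ (coords c L) x := by
  have h1 : ContDiff ℝ ∞ fun z : Plane => L.symm (z - chartAt Plane c c) := by fun_prop
  exact h1.contMDiff.contMDiffAt.comp x
    (contMDiffOn_chart.contMDiffAt ((chartAt Plane c).open_source.mem_nhds hx))

lemma isTestFunction_pushforward [T2Space M] [IsManifold 𝓘(ℝ, Plane) ∞ M] (hρ : 0 < ρ)
    (hsub : ∀ y ∈ Metric.closedBall (0 : Plane) 1,
      affineParam c L (dilate ξ ρ y) ∈ (chartAt Plane c).target)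
    (hφ : ContDiff ℝ ∞ (fun z : Plane × ℝ => φ z.1 z.2))
    (hφc : HasCompactSupport (fun z : Plane × ℝ => φ z.1 z.2))
    (hφt : tsupport (fun z : Plane × ℝ => φ z.1 z.2) ⊆ disc ×ˢ Ioo 0 T) (hφ0 : ∀ x t, 0 ≤ φ x t)
    {Ω : Set M} (hΩ : ∀ y ∈ disc, blowup c L ξ ρ y ∈ Ω) {T' : EReal}
    (hT : ((ρ ^ 2 * T : ℝ) : EReal) ≤ T') :
    IsTestFunction Ω T' (pushforward c L ξ ρ φ) := by
  have hts := tsupport_pushforward_subset (c := c) (L := L) (ξ := ξ) hρ hsub hφc hφt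
  refine ⟨contMDiff_of_tsupport fun z hz => ?_,
    HasCompactSupport.of_support_subset_isCompact (isCompact_image_tsupport hsub hφc hφt)
      (support_pushforward_subset hρ φ), fun z hz => ?_, fun x t => ?_⟩
  · obtain ⟨w, hw, rfl⟩ := hts hz
    have hs : blowup c L ξ ρ w.1 ∈ (chartAt Plane c).source :=
      (chartAt Plane c).map_target (hsub _ (Metric.ball_subset_closedBall (hφt hw).1))
    have hev : (fun z : M × ℝ => pushforward c L ξ ρ φ z.1 z.2)
        =ᶠ[nhds (blowup c L ξ ρ w.1, ρ ^ 2 * w.2)] (fun z : Plane × ℝ => φ z.1 z.2) ∘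
          fun z : M × ℝ => (ρ⁻¹ • (coords c L z.1 - ξ), (ρ ^ 2)⁻¹ * z.2) := by
      filter_upwards [((chartAt Plane c).open_source.prod isOpen_univ).mem_nhds ⟨hs, mem_univ _⟩]
        with z hz
      exact indicator_of_mem hz.1 _
    refine ContMDiffAt.congr_of_eventuallyEq ?_ hev
    refine hφ.contMDiff.contMDiffAt.comp _ ?_
    have h1 : ContDiff ℝ ∞ fun z : Plane => ρ⁻¹ • (z - ξ) := by fun_prop
    have h2 : ContDiff ℝ ∞ fun t : ℝ => (ρ ^ 2)⁻¹ * t := by fun_prop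
    refine ContMDiffAt.prodMk_space ?_ ?_
    · refine h1.contMDiff.contMDiffAt.comp _ ?_
      exact ContMDiffAt.comp (g := coords c L) (f := Prod.fst) (blowup c L ξ ρ w.1, ρ ^ 2 * w.2)
        (contMDiffAt_coords hs) contMDiffAt_fst
    · exact h2.contMDiff.contMDiffAt.comp _ contMDiffAt_snd
  · obtain ⟨w, hw, rfl⟩ := hts hz
    have h := hφt hw
    refine ⟨hΩ _ h.1, mul_pos (by positivity) h.2.1, lt_of_lt_of_le ?_ hT⟩
    exact EReal.coe_lt_coe_iff.2 (mul_lt_mul_of_pos_left h.2.2 (by positivity))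
  · unfold pushforward
    exact indicator_nonneg (fun _ _ => hφ0 _ _) _

end Pushforward

end Charts

/-! ### Integration over rescaled discs. -/

section Volume

variable {M : Type*} [TopologicalSpace M] [ChartedSpace Plane M] [MeasurableSpace M] [BorelSpace M]
  [RiemannianBundle (fun x : M => TangentSpace 𝓘(ℝ, Plane) x)] [IsManifold 𝓘(ℝ, Plane) ∞ M]
  [IsContMDiffRiemannianBundle 𝓘(ℝ, Plane) ∞ Plane (fun x : M => TangentSpace 𝓘(ℝ, Plane) x)]
  {c : M} {L : Plane ≃L[ℝ] Plane} {r ρ : ℝ} {ξ : Plane} {U : Set Plane}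

lemma blowup_image_eq (c : M) (L : Plane ≃L[ℝ] Plane) (ξ : Plane) (ρ : ℝ) (U : Set Plane) :
    blowup c L ξ ρ '' U = (chartAt Plane c).symm '' ((affineParam c L ∘ dilate ξ ρ) '' U) := by
  rw [image_image]; rfl

lemma injective_affineParam_dilate (c : M) (L : Plane ≃L[ℝ] Plane) (ξ : Plane) (hρ : 0 < ρ) :
    Function.Injective (affineParam c L ∘ dilate ξ ρ) := by
  intro y y' h
  simpa [affineParam, dilate, hρ.ne'] using h

lemma hasFDerivAt_affineParam_dilate (c : M) (L : Plane ≃L[ℝ] Plane) (ξ : Plane) (ρ : ℝ)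
    (y : Plane) : HasFDerivAt (affineParam c L ∘ dilate ξ ρ)
      ((L : Plane →L[ℝ] Plane).comp (ρ • ContinuousLinearMap.id ℝ Plane)) y :=
  (hasFDerivAt_affineParam c L _).comp y (hasFDerivAt_dilate ξ ρ y)

lemma abs_det_mul_volDensity (c : M) (L : Plane ≃L[ℝ] Plane) (ξ : Plane) (ρ : ℝ) (y : Plane) :
    |((L : Plane →L[ℝ] Plane).comp (ρ • ContinuousLinearMap.id ℝ Plane)).det| *
      volDensity c (affineParam c L (dilate ξ ρ y)) =
      ρ ^ 2 * (scaledCoefficients c L ξ ρ).w y := by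
  rw [← (hasFDerivAt_affineParam_dilate c L ξ ρ y).fderiv, det_fderiv_eq_det_jacobian
    (hasFDerivAt_affineParam_dilate c L ξ ρ y).differentiableAt,
    jacobian_comp (hasFDerivAt_affineParam c L _).differentiableAt
      (hasFDerivAt_dilate ξ ρ y).differentiableAt, jacobian_affineParam, jacobian_dilate]
  simp only [scaledCoefficients, metricCoefficients, paramGram, volDensity]
  have h : ((linMatrix L).transpose * gram c (affineParam c L (dilate ξ ρ y)) * linMatrix L).det =
      (linMatrix (L : Plane →L[ℝ] Plane)).det ^ 2 *
        (gram c (affineParam c L (dilate ξ ρ y))).det := by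
    rw [Matrix.det_mul, Matrix.det_mul, Matrix.det_transpose]; ring
  rw [h, Real.sqrt_mul (sq_nonneg _), Real.sqrt_sq_eq_abs, Matrix.mul_smul, Matrix.mul_one,
    Matrix.det_smul, Fintype.card_fin, abs_mul, abs_of_nonneg (sq_nonneg ρ)]
  ring

lemma measurableSet_image_affineParam_dilate (c : M) (L : Plane ≃L[ℝ] Plane) (ξ : Plane)
    (hρ : 0 < ρ) (hU : MeasurableSet U) :
    MeasurableSet ((affineParam c L ∘ dilate ξ ρ) '' U) :=
  hU.image_of_continuousOn_injOn ((contDiff_affineParam c L).continuous.comp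
    (contDiff_dilate ξ ρ).continuous).continuousOn
    (injective_affineParam_dilate c L ξ hρ).injOn

lemma setIntegral_blowup_image (hρ : 0 < ρ) (hU : MeasurableSet U)
    (hsub : ∀ y ∈ U, affineParam c L (dilate ξ ρ y) ∈ (chartAt Plane c).target) (F : M → ℝ) :
    ∫ x in blowup c L ξ ρ '' U, F x ∂(riemannianVolume M) =
      ρ ^ 2 * ∫ y in U, F (blowup c L ξ ρ y) * (scaledCoefficients c L ξ ρ).w y := by
  rw [blowup_image_eq, setIntegral_symm_image c (measurableSet_image_affineParam_dilate c L ξ hρ hU)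
    (by rintro _ ⟨y, hy, rfl⟩; exact hsub y hy),
    integral_image_eq_integral_abs_det_fderiv_smul volume hU
      (fun y _ => (hasFDerivAt_affineParam_dilate c L ξ ρ y).hasFDerivWithinAt)
      (injective_affineParam_dilate c L ξ hρ).injOn, ← integral_const_mul]
  refine setIntegral_congr_fun hU fun y _ => ?_
  have h := abs_det_mul_volDensity c L ξ ρ y
  simp only [Function.comp_apply, smul_eq_mul]
  rw [← mul_assoc, h, blowup, param]
  ring

lemma setLIntegral_blowup_image (hρ : 0 < ρ) (hU : MeasurableSet U)
    (hsub : ∀ y ∈ U, affineParam c L (dilate ξ ρ y) ∈ (chartAt Plane c).target) (F : M → ℝ≥0∞) :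
    ∫⁻ x in blowup c L ξ ρ '' U, F x ∂(riemannianVolume M) =
      ∫⁻ y in U, ENNReal.ofReal (ρ ^ 2 * (scaledCoefficients c L ξ ρ).w y) *
        F (blowup c L ξ ρ y) := by
  rw [blowup_image_eq, setLIntegral_symm_image c
    (measurableSet_image_affineParam_dilate c L ξ hρ hU)
    (by rintro _ ⟨y, hy, rfl⟩; exact hsub y hy),
    lintegral_image_eq_lintegral_abs_det_fderiv_mul volume hU
      (fun y _ => (hasFDerivAt_affineParam_dilate c L ξ ρ y).hasFDerivWithinAt)
      (injective_affineParam_dilate c L ξ hρ).injOn]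
  refine setLIntegral_congr_fun hU fun y _ => ?_
  have h := abs_det_mul_volDensity c L ξ ρ y
  simp only [Function.comp_apply]
  rw [← mul_assoc, ← ENNReal.ofReal_mul (abs_nonneg _), h]
  rfl

end Volume

/-! ### Rescaled weak solutions and their energy. -/

section Solutions

variable {M : Type*} [TopologicalSpace M] [ChartedSpace Plane M] [MeasurableSpace M] [BorelSpace M]
  [RiemannianBundle (fun x : M => TangentSpace 𝓘(ℝ, Plane) x)] [IsManifold 𝓘(ℝ, Plane) ∞ M]
  [IsContMDiffRiemannianBundle 𝓘(ℝ, Plane) ∞ Plane (fun x : M => TangentSpace 𝓘(ℝ, Plane) x)]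
  {c : M} {L : Plane ≃L[ℝ] Plane} {r ρ : ℝ} {ξ : Plane}

lemma laplaceBeltrami_eq_zero {f : M → ℝ} {x : M} (h : f =ᶠ[nhds x] fun _ => 0) :
    laplaceBeltrami f x = 0 := by
  have hx : (chartAt Plane x).symm (chartAt Plane x x) = x :=
    (chartAt Plane x).left_inv (mem_chart_source _ x)
  have hc := (chartAt Plane x).continuousAt_symm (mem_chart_target Plane x)
  rw [← hx] at h
  have h1 : f ∘ (chartAt Plane x).symm =ᶠ[nhds (chartAt Plane x x)] fun _ => 0 := hc.eventually h
  have h2 : laplaceBeltrami f x =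
      flatLaplacian (gram x) (f ∘ (chartAt Plane x).symm) (chartAt Plane x x) := rfl
  have h3 : ∀ i, flux (gram x) (fun _ => 0) i = fun _ => 0 := fun i => by
    ext; simp [flux, partialD]
  rw [h2, h1.flatLaplacian_eq]
  simp [flatLaplacian, h3, partialD]

lemma ContMDiff.slice {φ : M → ℝ → ℝ} (hφ : ContMDiff (𝓘(ℝ, Plane).prod 𝓘(ℝ, ℝ)) 𝓘(ℝ, ℝ) ∞
    (fun z : M × ℝ => φ z.1 z.2)) (t : ℝ) :
    ContMDiff 𝓘(ℝ, Plane) 𝓘(ℝ, ℝ) ∞ fun x => φ x t :=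
  hφ.comp (contMDiff_id.prodMk contMDiff_const)

/-- The rescaled function. -/
def rescale (c : M) (L : Plane ≃L[ℝ] Plane) (ξ : Plane) (ρ : ℝ) (v : M → ℝ → ℝ) (y : Plane)
    (s : ℝ) : ℝ :=
  ρ * v (blowup c L ξ ρ y) (ρ ^ 2 * s)

lemma integral_time_rescale (hρ : 0 < ρ) (H : ℝ → ℝ) :
    ∫ t, H t = ρ ^ 2 * ∫ s, H (ρ ^ 2 * s) := by
  rw [Measure.integral_comp_mul_left, abs_of_pos (by positivity), smul_eq_mul,
    mul_inv_cancel_left₀ (by positivity)]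

/-- Under `v ↦ ρ v` in parabolically scaled variables the differential operator and the cubic term
scale alike, whereas the linear term gains `ρ²`. Test functions on the disc are extended by zero to
the surface, where compactness of the support keeps them smooth. -/
lemma NearlyNormal.discSubsolution_rescale [T2Space M] (h : NearlyNormal c L r) (hρ : 0 < ρ)
    (hsub : ∀ y ∈ Metric.closedBall (0 : Plane) 1, dilate ξ ρ y ∈ Metric.ball 0 r) {Ω : Set M}
    (hΩ : ∀ y ∈ Metric.closedBall (0 : Plane) 1, blowup c L ξ ρ y ∈ Ω) {A B T : ℝ} {T' : EReal}
    (hT : ((ρ ^ 2 * T : ℝ) : EReal) < T') {v : M → ℝ → ℝ} (hv : IsWeakSolution A B Ω T' v) :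
    DiscSubsolution (scaledCoefficients c L ξ ρ) A (B * ρ ^ 2) T (rescale c L ξ ρ v) := by
  have htgt : ∀ y ∈ Metric.closedBall (0 : Plane) 1,
      affineParam c L (dilate ξ ρ y) ∈ (chartAt Plane c).target := fun y hy =>
    h.mem_target _ (hsub y hy)
  have htgt' : ∀ y ∈ disc, affineParam c L (dilate ξ ρ y) ∈ (chartAt Plane c).target :=
    fun y hy => htgt y (Metric.ball_subset_closedBall hy)
  have htime : ∀ s ∈ Icc 0 T, 0 ≤ ρ ^ 2 * s ∧ ((ρ ^ 2 * s : ℝ) : EReal) < T' := fun s hs =>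
    ⟨mul_nonneg (by positivity) hs.1, lt_of_le_of_lt
      (EReal.coe_le_coe_iff.2 (mul_le_mul_of_nonneg_left hs.2 (by positivity))) hT⟩
  refine ⟨?_, fun y hy s hs => mul_nonneg hρ.le (hv.nonneg _ (hΩ y hy) _ (htime s hs).1
    (htime s hs).2), fun φ hφ hφc hφt hφ0 => ?_⟩
  · have hc : ContinuousOn (fun z : Plane × ℝ => (blowup c L ξ ρ z.1, ρ ^ 2 * z.2))
        (Metric.closedBall 0 1 ×ˢ Icc 0 T) := fun z hz =>
      (ContinuousAt.prodMk ((continuousAt_blowup (htgt z.1 hz.1)).comp continuousAt_fst)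
        (by fun_prop)).continuousWithinAt
    exact continuousOn_const.mul (hv.continuousOn.comp hc fun z hz =>
      ⟨hΩ z.1 hz.1, htime z.2 hz.2⟩)
  have htest := isTestFunction_pushforward (c := c) (L := L) (ξ := ξ) hρ htgt hφ hφc hφt hφ0
    (fun y hy => hΩ y (Metric.ball_subset_closedBall hy)) hT.le
  have hts := tsupport_pushforward_subset (c := c) (L := L) (ξ := ξ) hρ htgt hφc hφt
  set ψ : M → ℝ → ℝ := pushforward c L ξ ρ φ with hψ
  have hout : ∀ x ∉ blowup c L ξ ρ '' disc, ∀ t,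
      (x, t) ∉ tsupport (fun z : M × ℝ => ψ z.1 z.2) := fun x hx t hxt => by
    obtain ⟨w, hw, hw'⟩ := hts hxt
    exact hx ⟨w.1, (hφt hw).1, congrArg Prod.fst hw'⟩
  have hψ0 : ∀ x ∉ blowup c L ξ ρ '' disc, ∀ t, ψ x t = 0 := fun x hx t =>
    image_eq_zero_of_notMem_tsupport (f := fun z : M × ℝ => ψ z.1 z.2) (hout x hx t)
  have hψlap : ∀ x ∉ blowup c L ξ ρ '' disc, ∀ t, laplaceBeltrami (fun z => ψ z t) x = 0 :=
    fun x hx t => laplaceBeltrami_eq_zero (by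
      have h1 := notMem_tsupport_iff_eventuallyEq.1 (hout x hx t)
      have h2 : ContinuousAt (fun z : M => (z, t)) x := by fun_prop
      exact h2.eventually h1)
  have hψderiv : ∀ x ∉ blowup c L ξ ρ '' disc, ∀ t, deriv (ψ x) t = 0 := fun x hx t => by
    rw [show ψ x = fun _ => 0 from funext fun t => hψ0 x hx t]
    simp
  have hψval : ∀ y ∈ disc, ∀ t, ψ (blowup c L ξ ρ y) t = φ y ((ρ ^ 2)⁻¹ * t) := fun y hy t =>
    pushforward_blowup hρ (htgt' y hy) φ t
  have hψval' : ∀ y ∈ disc, ∀ s, ψ (blowup c L ξ ρ y) (ρ ^ 2 * s) = φ y s := fun y hy s => by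
    rw [hψval y hy, inv_mul_cancel_left₀ (by positivity)]
  have hd : ∀ y ∈ disc, ∀ s, deriv (ψ (blowup c L ξ ρ y)) (ρ ^ 2 * s) =
      (ρ ^ 2)⁻¹ * deriv (φ y) s := fun y hy s => by
    rw [show ψ (blowup c L ξ ρ y) = fun t => φ y ((ρ ^ 2)⁻¹ * t) from funext (hψval y hy),
      deriv_comp_mul_left, inv_mul_cancel_left₀ (by positivity), smul_eq_mul]
  have hl : ∀ y ∈ disc, ∀ s, laplaceBeltrami (fun z => ψ z (ρ ^ 2 * s)) (blowup c L ξ ρ y) =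
      (ρ ^ 2)⁻¹ * (scaledCoefficients c L ξ ρ).op (fun z => φ z s) y := fun y hy s => by
    have h1 := h.laplaceBeltrami_eq hρ (hsub y (Metric.ball_subset_closedBall hy))
      ((ContMDiff.slice htest.smooth (ρ ^ 2 * s)).contMDiffAt)
    refine h1.trans (congrArg _ (Filter.EventuallyEq.op_eq ?_))
    filter_upwards [Metric.isOpen_ball.mem_nhds hy] with z hz
    exact hψval' z hz s
  have hL : ∫ t, ∫ x, v x t * (-deriv (ψ x) t - laplaceBeltrami (fun z => ψ z t) x)
      ∂(riemannianVolume M) = ρ * ∫ s, ∫ y in disc, rescale c L ξ ρ v y s *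
        (-deriv (φ y) s - (scaledCoefficients c L ξ ρ).op (fun z => φ z s) y) *
          (scaledCoefficients c L ξ ρ).w y := by
    -- Powers of `ρ`: time and volume give `ρ² ρ²`, the operator `ρ⁻²` and the amplitude `ρ⁻¹`,
    -- hence `ρ` in all. On the right side the cube gives `ρ⁴ ρ⁻³ = ρ` too.
    rw [integral_time_rescale hρ, ← integral_const_mul, ← integral_const_mul]
    congr 1; ext s
    rw [← setIntegral_eq_integral_of_forall_compl_eq_zero (s := blowup c L ξ ρ '' disc)
      (fun x hx => by rw [hψderiv x hx, hψlap x hx]; simp),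
      setIntegral_blowup_image hρ measurableSet_disc htgt', ← integral_const_mul,
      ← integral_const_mul, ← integral_const_mul]
    refine setIntegral_congr_fun measurableSet_disc fun y hy => ?_
    rw [hd y hy, hl y hy, rescale]
    field_simp
  have hR : ∫ t, ∫ x, (A * v x t ^ 3 + B * v x t) * ψ x t ∂(riemannianVolume M) =
      ρ * ∫ s, ∫ y in disc, (A * rescale c L ξ ρ v y s ^ 3 + B * ρ ^ 2 * rescale c L ξ ρ v y s) *
        φ y s * (scaledCoefficients c L ξ ρ).w y := by
    rw [integral_time_rescale hρ, ← integral_const_mul, ← integral_const_mul]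
    congr 1; ext s
    rw [← setIntegral_eq_integral_of_forall_compl_eq_zero (s := blowup c L ξ ρ '' disc)
      (fun x hx => by rw [hψ0 x hx]; simp),
      setIntegral_blowup_image hρ measurableSet_disc htgt', ← integral_const_mul,
      ← integral_const_mul, ← integral_const_mul]
    refine setIntegral_congr_fun measurableSet_disc fun y hy => ?_
    rw [hψval' y hy, rescale]
    ring
  have hmain := hv.weak ψ htest
  rw [hL, hR] at hmain
  exact le_of_mul_le_mul_left hmain hρ

/-- The rescaled energy. -/
lemma setIntegral_rescale_sq_le {K ε t : ℝ} {U : Set Plane} {S : Set M}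
    (hflat : (scaledCoefficients c L ξ ρ).NearlyFlat K) (hρ : 0 < ρ) (hU : MeasurableSet U)
    (hUd : U ⊆ disc) (hε : 0 ≤ ε)
    (htgt : ∀ y ∈ U, affineParam c L (dilate ξ ρ y) ∈ (chartAt Plane c).target)
    (hS : ∀ y ∈ U, blowup c L ξ ρ y ∈ S) {v : M → ℝ → ℝ}
    (hv : AEStronglyMeasurable (fun y => rescale c L ξ ρ v y t ^ 2) (volume.restrict U))
    (hE : energy (fun x => v x (ρ ^ 2 * t)) S ≤ ENNReal.ofReal ε) :
    ∫ y in U, rescale c L ξ ρ v y t ^ 2 ≤ 2 * ε := by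
  rw [integral_eq_lintegral_of_nonneg_ae (Filter.Eventually.of_forall fun _ => sq_nonneg _) hv]
  refine ENNReal.toReal_le_of_le_ofReal (by positivity) ?_
  have h1 : ∫⁻ y in U, ENNReal.ofReal (ρ ^ 2 * (scaledCoefficients c L ξ ρ).w y) *
      ENNReal.ofReal (v (blowup c L ξ ρ y) (ρ ^ 2 * t) ^ 2) ≤ ENNReal.ofReal ε := by
    rw [← setLIntegral_blowup_image hρ hU htgt
      (fun x => ENNReal.ofReal (v x (ρ ^ 2 * t) ^ 2))]
    refine le_trans (lintegral_mono_set ?_) hE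
    rintro _ ⟨y, hy, rfl⟩
    exact hS y hy
  -- The powers of `ρ` from the amplitude and the volume agree; the factor `2` is lost because the
  -- density is only known to be at least `1/2`.
  calc _ ≤ ∫⁻ y in U, ENNReal.ofReal 2 *
        (ENNReal.ofReal (ρ ^ 2 * (scaledCoefficients c L ξ ρ).w y) *
          ENNReal.ofReal (v (blowup c L ξ ρ y) (ρ ^ 2 * t) ^ 2)) := by
        refine setLIntegral_mono' hU fun y hy => ?_
        have hw := hflat.density_ge y (Metric.ball_subset_closedBall (hUd hy))
        rw [← ENNReal.ofReal_mul (by positivity), ← ENNReal.ofReal_mul (by norm_num)]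
        refine ENNReal.ofReal_le_ofReal ?_
        rw [rescale, mul_pow]
        have : 0 ≤ ρ ^ 2 * v (blowup c L ξ ρ y) (ρ ^ 2 * t) ^ 2 := by positivity
        nlinarith
    _ = ENNReal.ofReal 2 * ∫⁻ y in U, ENNReal.ofReal (ρ ^ 2 * (scaledCoefficients c L ξ ρ).w y) *
          ENNReal.ofReal (v (blowup c L ξ ρ y) (ρ ^ 2 * t) ^ 2) :=
        lintegral_const_mul' _ _ ENNReal.ofReal_ne_top
    _ ≤ ENNReal.ofReal 2 * ENNReal.ofReal ε := by gcongr
    _ = _ := (ENNReal.ofReal_mul (by norm_num)).symm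

end Solutions

lemma Coefficients.NearlyFlat.mono {𝒞 : Coefficients} {K K' : ℝ} (h : 𝒞.NearlyFlat K)
    (hK : K ≤ K') : 𝒞.NearlyFlat K' :=
  { h with
    lipschitz := fun i j x hx y hy => (h.lipschitz i j x hx y hy).trans
      (mul_le_mul_of_nonneg_right hK (norm_nonneg _))
    drift := fun j x hx => (h.drift j x hx).trans hK }

/-! ### Geodesic balls and rescaled discs. -/

section Geometry

variable {M : Type*} [EMetricSpace M] [ChartedSpace Plane M]
  [RiemannianBundle (fun x : M => TangentSpace 𝓘(ℝ, Plane) x)]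
  [IsManifold 𝓘(ℝ, Plane) ∞ M] [IsRiemannianManifold 𝓘(ℝ, Plane) M]
  {c : M} {L : Plane ≃L[ℝ] Plane} {r : ℝ}

/-- Comparison of small geodesic balls with rescaled discs. -/
lemma NearlyNormal.eventually_blowup (h : NearlyNormal c L r) (hr : 0 < r) :
    ∃ R₁ : ℝ, 0 < R₁ ∧ ∀ᶠ p in nhds c, ∀ R, 0 < R → R ≤ R₁ →
      (∀ y ∈ Metric.closedBall (0 : Plane) 1,
        dilate (coords c L p) (9 / 10 * R) y ∈ Metric.ball 0 r) ∧
      (∀ y ∈ Metric.closedBall (0 : Plane) 1,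
        blowup c L (coords c L p) (9 / 10 * R) y ∈ ball p R) ∧
      (∀ y ∈ outerAnnulus,
        blowup c L (coords c L p) (9 / 10 * R) y ∈ annulus p (R / 2) R) ∧
      (∀ x ∈ ball p (R / 2), ∃ y : Plane, ‖y‖ ≤ 3 / 5 ∧
        blowup c L (coords c L p) (9 / 10 * R) y = x) := by
  have hcc : coords c L c = 0 := by simp [coords]
  have hcont : ContinuousAt (coords c L) c :=
    (contMDiffAt_coords (mem_chart_source Plane c)).continuousAt
  have hev : ∀ ρ, 0 < ρ → ∀ᶠ x in nhds c,
      x ∈ (chartAt Plane c).source ∧ coords c L x ∈ Metric.ball 0 ρ := fun ρ hρ =>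
    Filter.Eventually.and ((chartAt Plane c).open_source.mem_nhds (mem_chart_source Plane c))
      (hcont.eventually (by rw [hcc]; exact Metric.ball_mem_nhds 0 hρ))
  obtain ⟨s, hs, hsub⟩ := EMetric.mem_nhds_iff.1 (hev r hr)
  -- One `δ` is for the distance from `p` to `c` and one for the radius about `p`.
  obtain ⟨δ, hδ0, hδs⟩ : ∃ δ : ℝ, 0 < δ ∧ ENNReal.ofReal δ + ENNReal.ofReal δ ≤ s := by
    rcases eq_or_ne s ⊤ with rfl | hst
    · exact ⟨1, one_pos, le_top⟩
    · have hs0 : 0 < s.toReal := ENNReal.toReal_pos hs.ne' hst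
      refine ⟨s.toReal / 2, by positivity, ?_⟩
      rw [← ENNReal.ofReal_add (by positivity) (by positivity), add_halves,
        ENNReal.ofReal_toReal hst]
  refine ⟨min δ (r / 2), by positivity, ?_⟩
  have hδ' : 0 < ENNReal.ofReal δ := ENNReal.ofReal_pos.2 hδ0
  filter_upwards [hev (r / 2) (by positivity), Metric.eball_mem_nhds c hδ'] with p hp hpδ R hR hR₁
  have hRδ : R ≤ δ := hR₁.trans (min_le_left _ _)
  have hRr : R ≤ r / 2 := hR₁.trans (min_le_right _ _)
  set ξ := coords c L p with hξ
  have hξn : ‖ξ‖ < r / 2 := by simpa using hp.2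
  have hpξ : param c L ξ = p := param_coords L hp.1
  have hdil : ∀ y ∈ Metric.closedBall (0 : Plane) 1,
      dilate ξ (9 / 10 * R) y ∈ Metric.ball 0 r := fun y hy => by
    rw [mem_closedBall_zero_iff] at hy
    rw [mem_ball_zero_iff]
    calc ‖dilate ξ (9 / 10 * R) y‖ ≤ ‖ξ‖ + ‖(9 / 10 * R) • y‖ := norm_add_le _ _
      _ = ‖ξ‖ + 9 / 10 * R * ‖y‖ := by rw [norm_smul, Real.norm_of_nonneg (by positivity)]
      _ < r := by nlinarith
  have hdiff : ∀ y : Plane, ‖dilate ξ (9 / 10 * R) y - ξ‖ = 9 / 10 * R * ‖y‖ := fun y => by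
    rw [dilate, add_sub_cancel_left, norm_smul, Real.norm_of_nonneg (by positivity)]
  have hball : ∀ y ∈ Metric.closedBall (0 : Plane) 1, blowup c L ξ (9 / 10 * R) y ∈ ball p R :=
    fun y hy => by
    -- The disc of radius `9/10 R` stays in the geodesic ball since `51/50 · 9/10 < 1`.
    have h1 := h.edist_param_le (hdil y hy) (ξ' := ξ) (by rw [mem_ball_zero_iff]; linarith)
    rw [hpξ, ← ofReal_norm, norm_sub_rev, hdiff, ← ENNReal.ofReal_mul (by norm_num)] at h1
    refine lt_of_le_of_lt h1 ((ENNReal.ofReal_lt_ofReal_iff hR).2 ?_)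
    rw [mem_closedBall_zero_iff] at hy
    nlinarith
  have hin : ∀ R' ≤ R, Metric.eball p (ENNReal.ofReal R') ⊆
      {y | y ∈ (chartAt Plane c).source ∧ coords c L y ∈ Metric.ball 0 r} := fun R' hR' x hx => by
    refine hsub (lt_of_lt_of_le ?_ hδs)
    refine (edist_triangle x p c).trans_lt (ENNReal.add_lt_add ?_ hpδ)
    exact lt_of_lt_of_le hx (ENNReal.ofReal_le_ofReal (hR'.trans hRδ))
  have hnorm : ∀ R', 0 < R' → R' ≤ R → ∀ x, edist x p < ENNReal.ofReal R' →
      ‖coords c L x - ξ‖ < 103 / 100 * R' := fun R' hR'0 hR' x hx => by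
    have h1 := h.enorm_coords_sub_lt (hin R' hR') hx
    rw [← ofReal_norm, ← ENNReal.ofReal_mul (by norm_num)] at h1
    exact (ENNReal.ofReal_lt_ofReal_iff (by positivity)).1 h1
  refine ⟨hdil, hball, fun y hy => ⟨hball y (Metric.ball_subset_closedBall hy.1), fun hle => ?_⟩,
    fun x hx => ?_⟩
  · have hy1 := Metric.ball_subset_closedBall hy.1
    -- Enlarging `1/2` to `51/100` makes the inequality strict. There is still room, as `103/100 ·
    -- 51/100 < 9/10 · 3/5`.
    have h1 : edist (blowup c L ξ (9 / 10 * R) y) p < ENNReal.ofReal (51 / 100 * R) :=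
      lt_of_le_of_lt hle ((ENNReal.ofReal_lt_ofReal_iff (by positivity)).2 (by linarith))
    have h2 := hnorm (51 / 100 * R) (by positivity) (by linarith) _ h1
    rw [blowup, coords_param (h.mem_target _ (hdil y hy1)), hdiff] at h2
    have h3 : 3 / 5 < ‖y‖ := by
      have := hy.2
      rwa [mem_closedBall_zero_iff, not_le] at this
    nlinarith
  · have h1 := hnorm (R / 2) (by positivity) (by linarith) x hx
    have h2 := hin (R / 2) (by linarith) hx
    refine ⟨(9 / 10 * R)⁻¹ • (coords c L x - ξ), ?_, ?_⟩
    · rw [norm_smul, norm_inv, Real.norm_of_nonneg (by positivity), inv_mul_le_iff₀ (by positivity)]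
      linarith
    · have : dilate ξ (9 / 10 * R) ((9 / 10 * R)⁻¹ • (coords c L x - ξ)) = coords c L x := by
        have h9 : 9 / 10 * R ≠ 0 := by positivity
        rw [dilate, smul_smul, mul_inv_cancel₀ h9, one_smul, add_sub_cancel]
      rw [blowup, this, param_coords L h2.1]

end Geometry

/-- The regularity theorem near a point of the surface. -/
theorem exists_local_bound :
    ∃ C : ℝ, 0 < C ∧ ∃ ε₀ : ℝ → ℝ, (∀ A, 0 < ε₀ A) ∧
      ∀ (M : Type*) [EMetricSpace M] [MeasurableSpace M] [BorelSpace M]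
        [ChartedSpace Plane M] [IsManifold 𝓘(ℝ, Plane) ∞ M]
        [RiemannianBundle (fun x : M => TangentSpace 𝓘(ℝ, Plane) x)]
        [IsContMDiffRiemannianBundle 𝓘(ℝ, Plane) ∞ Plane
          (fun x : M => TangentSpace 𝓘(ℝ, Plane) x)]
        [IsRiemannianManifold 𝓘(ℝ, Plane) M] (B : ℝ) (c : M),
      ∃ R₁ : ℝ, 0 < R₁ ∧ ∀ᶠ p in nhds c,
        ∀ (A R : ℝ) (T : EReal) (v : M → ℝ → ℝ) (ε : ℝ),
          0 < R → R ≤ R₁ → IsWeakSolution A B (ball p R) T v → 0 ≤ ε → ε < ε₀ A →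
          energy (fun x => v x 0) (ball p R)
            + (⨆ t ∈ {t : ℝ | 0 ≤ t ∧ (t : EReal) < T},
                energy (fun x => v x t) (annulus p (R / 2) R)) ≤ ENNReal.ofReal ε →
          ∀ x ∈ ball p (R / 2), ∀ t : ℝ, R ^ 2 / 2 ≤ t → (t : EReal) < T →
            v x t ≤ C * √ε / R := by
  obtain ⟨C, hC, K₀, hK₀, ε₀, hε₀, hdisc⟩ := exists_disc_bound
  -- Halving `ε₀` allows for the doubled energy after rescaling; `2 C` covers `C · 3/2 · 10/9`, from
  -- `√2 ≤ 3/2` and `ρ = 9/10 R`.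
  refine ⟨2 * C, by positivity, fun A => ε₀ A / 2, fun A => half_pos (hε₀ A), ?_⟩
  intro M _ _ _ _ _ _ _ _ B c
  obtain ⟨L, r, K, hr, hK, hchart⟩ := exists_controlledChart c
  obtain ⟨R₁, hR₁, hev⟩ := hchart.toNearlyNormal.eventually_blowup hr
  have hR₂ : 0 < min R₁ (min (K₀ / K) (min 1 (K₀ / (|B| + 1)))) := by positivity
  refine ⟨_, hR₂, ?_⟩
  filter_upwards [hev] with p hp A R T v ε hR hRle hv hε hεA hE x hx t ht htT
  obtain ⟨hdil, hball, hann, hinner⟩ := hp R hR (hRle.trans (min_le_left _ _))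
  have hRK : R * K ≤ K₀ := by
    rw [← le_div_iff₀ hK]
    exact hRle.trans ((min_le_right _ _).trans (min_le_left _ _))
  have hR1 : R ≤ 1 :=
    hRle.trans ((min_le_right _ _).trans ((min_le_right _ _).trans (min_le_left _ _)))
  have hRB : R * (|B| + 1) ≤ K₀ := by
    rw [← le_div_iff₀ (by positivity)]
    exact hRle.trans ((min_le_right _ _).trans ((min_le_right _ _).trans (min_le_right _ _)))
  set ρ := 9 / 10 * R with hρdef
  have hρ : 0 < ρ := by positivity
  set ξ := coords c L p with hξ
  have hflat : (scaledCoefficients c L ξ ρ).NearlyFlat K₀ :=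
    (hchart.nearlyFlat hρ hdil).mono (by nlinarith)
  have hB : |B * ρ ^ 2| ≤ K₀ := by
    rw [abs_mul, abs_of_nonneg (sq_nonneg ρ)]
    refine le_trans ?_ hRB
    have h1 : ρ ^ 2 ≤ R := by rw [hρdef]; nlinarith
    nlinarith [abs_nonneg B]
  have hscale : ρ ^ 2 * (t / ρ ^ 2) = t := by field_simp
  set t' := t / ρ ^ 2 with ht'
  have ht0 : 0 ≤ t := by nlinarith
  have ht'0 : 0 ≤ t' := by positivity
  have ht'1 : 1 / 2 ≤ t' := by
    rw [ht', le_div_iff₀ (by positivity), hρdef]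
    nlinarith
  -- The final time is the rescaled evaluation time itself. It lies strictly before the end of
  -- existence, so the solution is continuous on a closed interval and the supremum used for the
  -- time step is finite.
  have hsol : DiscSubsolution (scaledCoefficients c L ξ ρ) A (B * ρ ^ 2) t'
      (rescale c L ξ ρ v) :=
    hchart.toNearlyNormal.discSubsolution_rescale hρ hdil hball (by rw [hscale]; exact htT) hv
  have htgt : ∀ y ∈ disc, affineParam c L (dilate ξ ρ y) ∈ (chartAt Plane c).target := fun y hy =>
    hchart.mem_target _ (hdil y (Metric.ball_subset_closedBall hy))
  have hinit : energy (fun x => v x (ρ ^ 2 * 0)) (ball p R) ≤ ENNReal.ofReal ε := by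
    rw [mul_zero]
    exact le_self_add.trans hE
  have houter : ∀ s ∈ Icc 0 t', energy (fun x => v x (ρ ^ 2 * s)) (annulus p (R / 2) R) ≤
      ENNReal.ofReal ε := fun s hs => by
    have hs0 : 0 ≤ ρ ^ 2 * s := mul_nonneg (by positivity) hs.1
    have hs1 : ((ρ ^ 2 * s : ℝ) : EReal) < T := by
      refine lt_of_le_of_lt (EReal.coe_le_coe_iff.2 ?_) htT
      calc ρ ^ 2 * s ≤ ρ ^ 2 * t' := mul_le_mul_of_nonneg_left hs.2 (by positivity)
        _ = t := hscale
    have h1 := le_iSup₂ (f := fun (t : ℝ) (_ : t ∈ {t : ℝ | 0 ≤ t ∧ (t : EReal) < T}) =>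
      energy (fun x => v x t) (annulus p (R / 2) R)) (ρ ^ 2 * s) ⟨hs0, hs1⟩
    exact h1.trans (le_add_self.trans hE)
  have hmeas : ∀ s ∈ Icc 0 t', ∀ U ⊆ disc,
      AEStronglyMeasurable (fun y => rescale c L ξ ρ v y s ^ 2) (volume.restrict U) :=
    fun s hs U hU => ((hsol.boundedOnDisc hs).pow 2).1.mono_measure (Measure.restrict_mono_set _ hU)
  -- The disc theorem needs a positive energy bound. Working with `ε' > 2 ε` and letting `ε'` tend
  -- to `2 ε` includes the case `ε = 0`.
  have hsmall : ∀ ε', 2 * ε < ε' → SmallEnergy t' (rescale c L ξ ρ v) ε' := fun ε' hε' =>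
    ⟨by linarith, (setIntegral_rescale_sq_le hflat hρ measurableSet_disc subset_rfl hε htgt
      (fun y hy => hball y (Metric.ball_subset_closedBall hy))
      (hmeas 0 ⟨le_rfl, ht'0⟩ _ subset_rfl) hinit).trans hε'.le,
    fun s hs => (setIntegral_rescale_sq_le hflat hρ measurableSet_outerAnnulus sdiff_subset hε
      (fun y hy => htgt y hy.1) hann (hmeas s hs _ sdiff_subset) (houter s hs)).trans hε'.le⟩
  obtain ⟨y, hy, hyx⟩ := hinner x hx
  have hbound : ∀ ε', 2 * ε < ε' → ε' < ε₀ A → ρ * v x t ≤ C * √ε' := fun ε' h1 h2 => by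
    have := hdisc _ A _ t' ε' _ hflat hB hsol (hsmall ε' h1) h2 y hy t' ht'1 le_rfl
    rwa [rescale, hscale, hyx] at this
  have hlim : ρ * v x t ≤ C * √(2 * ε) := by
    have hc : Filter.Tendsto (fun ε' => C * √ε') (nhdsWithin (2 * ε) (Ioi (2 * ε)))
        (nhds (C * √(2 * ε))) :=
      ((Real.continuous_sqrt.const_mul C).tendsto (2 * ε)).mono_left nhdsWithin_le_nhds
    refine ge_of_tendsto hc ?_
    filter_upwards [Ioo_mem_nhdsGT (show 2 * ε < ε₀ A by linarith)] with ε' h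
    exact hbound ε' h.1 h.2
  have h2 : √(2 * ε) ≤ 3 / 2 * √ε := by
    rw [Real.sqrt_mul (by norm_num)]
    refine mul_le_mul_of_nonneg_right ?_ (Real.sqrt_nonneg _)
    rw [Real.sqrt_le_left (by norm_num)]
    norm_num
  rw [le_div_iff₀ hR]
  have h3 := mul_le_mul_of_nonneg_left h2 hC.le
  have h4 : 0 ≤ C * √ε := by positivity
  rw [hρdef] at hlim
  linarith

end Surface

end

/-! ### The theorem on a compact surface. -/

theorem mainTheorem12 :
    ∃ C : ℝ, 0 < C ∧ ∃ ε₀ : ℝ → ℝ, (∀ A, 0 < ε₀ A) ∧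
      ∀ (M : Type*) [EMetricSpace M] [CompactSpace M] [MeasurableSpace M] [BorelSpace M]
        [ChartedSpace Surface.Plane M] [IsManifold 𝓘(ℝ, Surface.Plane) ∞ M]
        [RiemannianBundle (fun x : M => TangentSpace 𝓘(ℝ, Surface.Plane) x)]
        [IsContMDiffRiemannianBundle 𝓘(ℝ, Surface.Plane) ∞ Surface.Plane
          (fun x : M => TangentSpace 𝓘(ℝ, Surface.Plane) x)]
        [IsRiemannianManifold 𝓘(ℝ, Surface.Plane) M] (B : ℝ),
      ∃ R₀ : ℝ, 0 < R₀ ∧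
        ∀ (A : ℝ) (p : M) (R : ℝ) (T : EReal) (v : M → ℝ → ℝ) (ε : ℝ),
          0 < R → R ≤ R₀ → ((R ^ 2 : ℝ) : EReal) ≤ T →
          Surface.IsWeakSolution A B (Surface.ball p R) T v →
          0 ≤ ε → ε < ε₀ A →
          Surface.energy (fun x => v x 0) (Surface.ball p R)
            + (⨆ t ∈ {t : ℝ | 0 ≤ t ∧ (t : EReal) < T},
                Surface.energy (fun x => v x t) (Surface.annulus p (R / 2) R))
            ≤ ENNReal.ofReal ε →
          ∀ x ∈ Surface.ball p (R / 2), ∀ t : ℝ, R ^ 2 / 2 ≤ t → (t : EReal) < T →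
            v x t ≤ C * √ε / R := by
  obtain ⟨C, hC, ε₀, hε₀, hloc⟩ := Surface.exists_local_bound
  refine ⟨C, hC, ε₀, hε₀, ?_⟩
  intro M _ _ _ _ _ _ _ _ _ B
  choose R₁ hR₁ hev using hloc M B
  -- Only the admissible radius depends on the centre `c`, while `C` and `ε₀` are already universal;
  -- a finite subcover then yields a uniform radius as the minimum of finitely many.
  obtain ⟨s, -, hs⟩ := isCompact_univ.elim_nhds_subcover
    (fun c => {p | ∀ (A R : ℝ) (T : EReal) (v : M → ℝ → ℝ) (ε : ℝ),
      0 < R → R ≤ R₁ c → Surface.IsWeakSolution A B (Surface.ball p R) T v → 0 ≤ ε → ε < ε₀ A →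
      Surface.energy (fun x => v x 0) (Surface.ball p R)
        + (⨆ t ∈ {t : ℝ | 0 ≤ t ∧ (t : EReal) < T},
            Surface.energy (fun x => v x t) (Surface.annulus p (R / 2) R)) ≤ ENNReal.ofReal ε →
      ∀ x ∈ Surface.ball p (R / 2), ∀ t : ℝ, R ^ 2 / 2 ≤ t → (t : EReal) < T →
        v x t ≤ C * √ε / R}) fun c _ => hev c
  obtain ⟨R₀, hR₀, hle⟩ : ∃ R₀ : ℝ, 0 < R₀ ∧ ∀ c ∈ s, R₀ ≤ R₁ c := by
    rcases s.eq_empty_or_nonempty with rfl | hne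
    · exact ⟨1, one_pos, by simp⟩
    · exact ⟨s.inf' hne R₁, (Finset.lt_inf'_iff hne).2 fun c _ => hR₁ c,
        fun c hc => Finset.inf'_le R₁ hc⟩
  refine ⟨R₀, hR₀, fun A p R T v ε hR hRR₀ _ hv hε hεA hE => ?_⟩
  obtain ⟨c, hc, hp⟩ := mem_iUnion₂.1 (hs (mem_univ p))
  exact hp A R T v ε hR (hRR₀.trans (hle c hc)) hv hε hεA hE
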